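/- **Notation.** Let $M,N\ge 1$ be integers and let $q,t,p\in\mathbf C$ with $0<|q|<1$, $|p|<1$, $t\neq 0$. Put $(x;q)_\infty=\prod_{n\ge0}(1-xq^n)$, $(x;q,p)_\infty=\prod_{m,n\ge0}(1-xq^mp^n)$, $\Theta_p(x)=(p;p)_\infty(x;p)_\infty(px^{-1};p)_\infty$ and $\Gamma_{q,p}(x)=(qpx^{-1};q,p)_\infty/(x;q,p)_\infty$. For functions of $x=(x_1,\dots,x_M)$ let $T_{q,x_i}$ replace $x_i$ by $qx_i$, and define the elliptic Macdonald operator $$H_M(q,t,p)_x=\sum_{i=1}^M\prod_{j\ne i}\frac{\Theta_p(tx_i/x_j)}{\Theta_p(x_i/x_j)}\,T_{q,x_i},$$ similarly $H_N(q,t,p)_y$ for $y=(y_1,\dots,y_N)$, and the elliptic kernel function $$\Pi_{MN}(q,t,p)(x,y)=\prod_{i=1}^M\prod_{j=1}^N\frac{\Gamma_{q,p}(x_iy_j)}{\Gamma_{q,p}(tx_iy_j)}.$$ Let $$C_{MN}(p;x,y)=\left[\prod_{i=1}^M\frac{\Theta_p(t^{-1}x_iz)}{\Theta_p(x_iz)}\prod_{j=1}^N\frac{\Theta_p(z/y_j)}{\Theta_p(t^{-1}z/y_j)}\right]_1$$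 be the constant term in $z$ of the Laurent expansion in the annulus $|p|<|x_iz|<1$, $|p|<|t^{-1}z/y_j|<1$ (all $i,j$). **Theorem (functional equation of the elliptic kernel function).** (1) Suppose $t\notin p^{\mathbf Z}$, the $x_i$ are nonzero and pairwise distinct, the $y_j$ are nonzero and pairwise distinct, $x_iy_jq^mp^n\ne1$ for all $i,j$ and all $m,n\ge0$, and the above annulus is nonempty. Then the Laurent expansion defining $C_{MN}$ exists and $$\{H_M(q,t,p)_x-t^{M-N}H_N(q,t,p)_y\}\Pi_{MN}(q,t,p)(x,y)=\frac{(1-t^{M-N})(p;p)_\infty^3}{\Theta_p(t)}\,C_{MN}(p;x,y)\,\Pi_{MN}(q,t,p)(x,y).$$ (2) Suppose $p\ne0$ and $t$ is not a root of unity. Let $a_n,b_n$ ($n\in\mathbf Z\setminus\{0\}$) be bosons with $[a_m,b_n]=0$, $[a_m,a_n]=m(1-p^{|m|})\frac{1-q^{|m|}}{1-t^{|m|}}\delta_{m+n,0}$, $[b_m,b_n]=m\frac{1-p^{|m|}}{(qt^{-1}p)^{|m|}}\frac{1-q^{|m|}}{1-t^{|m|}}\delta_{m+n,0}$, acting on the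 Fock space with vacuum $|0\rangle$ ($a_n|0\rangle=b_n|0\rangle=0$ for $n>0$) and dual vacuum $\langle0|$ ($\langle 0|a_n=\langle 0|b_n=0$ for $n<0$, $\langle 0|0\rangle=1$). Put $$(\eta(p;z))_\pm=\exp\Big(-\sum_{\pm n>0}\tfrac{1-t^{-n}}{1-p^{|n|}}p^{|n|}b_n\tfrac{z^n}{n}\Big)\exp\Big(-\sum_{\pm n>0}\tfrac{1-t^{n}}{1-p^{|n|}}a_n\tfrac{z^{-n}}{n}\Big),$$ $$\phi(p;z)=\exp\Big(\sum_{n>0}\tfrac{(1-t^n)(qt^{-1}p)^n}{(1-q^n)(1-p^n)}b_{-n}\tfrac{z^{-n}}n\Big)\exp\Big(\sum_{n>0}\tfrac{1-t^n}{(1-q^n)(1-p^n)}a_{-n}\tfrac{z^n}n\Big),$$ let $\phi^*(p;z)$ be the same expression with $a_n,b_n$ in place of $a_{-n},b_{-n}$, and put $\phi_N(p;y)=\prod_j\phi(p;y_j)$, $\phi^*_M(p;x)=\prod_i\phi^*(p;x_i)$. Suppose that for all $i,j$ $$|x_iy_j|<1,\quad |tx_iy_j|<1,\quad |qp|<|x_iy_j|,\quad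 |qp|<|tx_iy_j|,$$ and that for some $r>0$ and all $i,j$ $$\max(1,|t|^{-1})|x_i|r<1,\quad \max(1,|t|)|p|<|x_i|r,\quad \max(1,|t|)|py_j|<r,\quad r<\min(1,|t|)|y_j|.$$ Then the expansion of the following matrix element in monomials in the bosons converges absolutely, $\Pi_{MN}(q,t,p)(x,y)\neq0$, and $$C_{MN}(p;x,y)=\frac{\langle0|\phi^*_M(p;x)\,[(\eta(p;z))_-(\eta(p;p^{-1}z))_+]_1\,\phi_N(p;y)|0\rangle}{\Pi_{MN}(q,t,p)(x,y)}.$$ (3) Suppose $t\ne1$, the $x_i$ are nonzero and pairwise distinct, the $y_j$ are nonzero and pairwise distinct, and $x_iy_jq^m\neq1$ for all $i,j$ and $m\ge0$. As $p\to0$ ($p\neq 0$), $C_{MN}(p;x,y)\to1$, and the left and right sides of the equation in (1) converge to the left and right sides, respectively, of the Komori–Noumi–Shiraishi identity $$\{H_M(q,t)_x-t^{M-N}H_N(q,t)_y\}\Pi_{MN}(q,t)(x,y)=\frac{1-t^{M-N}}{1-t}\Pi_{MN}(q,t)(x,y),$$ which therefore holds; here $H_M(q,t)_x=\sum_{i}\prod_{j\neq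 i}\frac{tx_i-x_j}{x_i-x_j}T_{q,x_i}$ and $\Pi_{MN}(q,t)(x,y)=\prod_{i,j}\frac{(tx_iy_j;q)_\infty}{(x_iy_j;q)_\infty}$. -/

import Mathlib

open scoped Topology LaurentPolynomial

namespace EllipticKernel

noncomputable section

/-! ### Infinite products, theta function, elliptic gamma function -/

/-- `(x; q)_∞ = ∏_{n ≥ 0} (1 - x qⁿ)`. -/
def qPoch (q x : ℂ) : ℂ := ∏' n : ℕ, (1 - x * q ^ n)

/-- `(x; q, p)_∞ = ∏_{m, n ≥ 0} (1 - x qᵐ pⁿ)`. -/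
def qpPoch (q p x : ℂ) : ℂ := ∏' k : ℕ × ℕ, (1 - x * q ^ k.1 * p ^ k.2)

/-- `Θ_p(x) = (p; p)_∞ (x; p)_∞ (p x⁻¹; p)_∞`. -/
def theta (p x : ℂ) : ℂ := qPoch p p * qPoch p x * qPoch p (p * x⁻¹)

/-- `Γ_{q,p}(x) = (q p x⁻¹; q, p)_∞ / (x; q, p)_∞`. -/
def ellGamma (q p x : ℂ) : ℂ := qpPoch q p (q * p * x⁻¹) / qpPoch q p x

/-! ### Macdonald operators and kernel functions -/

/-- The `q`-shift `T_{q,x_i}`: it replaces the `i`-th variable `x_i` by `q x_i`. -/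
def qShift {M : ℕ} (q : ℂ) (i : Fin M) (f : (Fin M → ℂ) → ℂ) (x : Fin M → ℂ) : ℂ :=
  f (Function.update x i (q * x i))

/-- The elliptic Macdonald operator `H_M(q,t,p)`. -/
def ellMacdonald (M : ℕ) (q t p : ℂ) (f : (Fin M → ℂ) → ℂ) (x : Fin M → ℂ) : ℂ :=
  ∑ i, (∏ j ∈ Finset.univ.erase i, theta p (t * x i / x j) / theta p (x i / x j)) * qShift q i f x

/-- The elliptic kernel function `Π_{MN}(q,t,p)(x,y)`. -/
def ellKernel (M N : ℕ) (q t p : ℂ) (x : Fin M → ℂ) (y : Fin N → ℂ) : ℂ :=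
  ∏ i, ∏ j, ellGamma q p (x i * y j) / ellGamma q p (t * x i * y j)

/-- The (trigonometric) Macdonald operator `H_M(q,t)`. -/
def trigMacdonald (M : ℕ) (q t : ℂ) (f : (Fin M → ℂ) → ℂ) (x : Fin M → ℂ) : ℂ :=
  ∑ i, (∏ j ∈ Finset.univ.erase i, (t * x i - x j) / (x i - x j)) * qShift q i f x

/-- The (trigonometric) kernel function `Π_{MN}(q,t)(x,y)`. -/
def trigKernel (M N : ℕ) (q t : ℂ) (x : Fin M → ℂ) (y : Fin N → ℂ) : ℂ :=
  ∏ i, ∏ j, qPoch q (t * x i * y j) / qPoch q (x i * y j)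

/-! ### Constant terms of Laurent expansions -/

/-- `∑_{n ∈ ℤ} a_n zⁿ` converges (absolutely) to `f z` for all `z ∈ A`. -/
def HasLaurentExpansionOn (f : ℂ → ℂ) (A : Set ℂ) (a : ℤ → ℂ) : Prop :=
  ∀ z ∈ A, HasSum (fun n : ℤ => a n * z ^ n) (f z)

open Classical in
/-- The constant term `[f(z)]_1` of the Laurent expansion of `f` on `A`. It is used only for
nonempty open annuli `A` centred at `0`, where the expansion is unique. -/
def constantTerm (f : ℂ → ℂ) (A : Set ℂ) : ℂ :=
  if h : ∃ a, HasLaurentExpansionOn f A a then h.choose 0 else 0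

/-- The ratio of theta functions whose constant term in `z` is `C_{MN}(p;x,y)`. -/
def thetaRatio (M N : ℕ) (t p : ℂ) (x : Fin M → ℂ) (y : Fin N → ℂ) (z : ℂ) : ℂ :=
  (∏ i, theta p (t⁻¹ * x i * z) / theta p (x i * z)) *
    ∏ j, theta p (z / y j) / theta p (t⁻¹ * z / y j)

/-- The annulus on which `thetaRatio` is expanded: `|p| < |x_i z| < 1` and
`|p| < |t⁻¹ z / y_j| < 1` for all `i`, `j`. -/
def expansionDomain (M N : ℕ) (t p : ℂ) (x : Fin M → ℂ) (y : Fin N → ℂ) : Set ℂ :=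
  {z | (∀ i, ‖p‖ < ‖x i * z‖ ∧ ‖x i * z‖ < 1) ∧
    ∀ j, ‖p‖ < ‖t⁻¹ * z / y j‖ ∧ ‖t⁻¹ * z / y j‖ < 1}

/-- `C_{MN}(p;x,y)`. -/
def ellC (M N : ℕ) (t p : ℂ) (x : Fin M → ℂ) (y : Fin N → ℂ) : ℂ :=
  constantTerm (thetaRatio M N t p x y) (expansionDomain M N t p x y)

/-! ### Boson Fock space and the vacuum expectation value -/

/-- The boson modes: `Sum.inl n` stands for `a_{±n}` and `Sum.inr n` for `b_{±n}`, `n ≥ 1`. -/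
abbrev Mode : Type := ℕ+ ⊕ ℕ+

/-- The Fock space spanned by the vectors `a_{-λ} b_{-μ} |0⟩`, identified with the polynomials in
the creation operators `a_{-n}`, `b_{-n}`; the vacuum `|0⟩` is the polynomial `1`. -/
abbrev Fock : Type := MvPolynomial Mode ℂ

/-- The commutators `[a_n, a_{-n}]` and `[b_n, b_{-n}]` for `n ≥ 1`. -/
def bosonNorm (q t p : ℂ) : Mode → ℂ
  | Sum.inl n => (n : ℂ) * (1 - p ^ (n : ℕ)) * ((1 - q ^ (n : ℕ)) / (1 - t ^ (n : ℕ)))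
  | Sum.inr n => (n : ℂ) * ((1 - p ^ (n : ℕ)) / (q * t⁻¹ * p) ^ (n : ℕ)) *
      ((1 - q ^ (n : ℕ)) / (1 - t ^ (n : ℕ)))

/-- The creation operators `a_{-n}`, `b_{-n}` on the Fock space. -/
def creation (m : Mode) : Module.End ℂ Fock := LinearMap.mulLeft ℂ (MvPolynomial.X m)

/-- The annihilation operators `a_n`, `b_n` on the Fock space: they kill the vacuum and satisfy
the boson commutation relations with the creation operators. -/
def annihilation (q t p : ℂ) (m : Mode) : Module.End ℂ Fock :=
  bosonNorm q t p m • ((MvPolynomial.pderiv m : Derivation ℂ Fock Fock) : Fock →ₗ[ℂ] Fock)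

theorem creation_commute (m n : Mode) : Commute (creation m) (creation n) := by
  apply LinearMap.ext
  intro f
  simp [creation, mul_left_comm]

theorem annihilation_commute (q t p : ℂ) (m n : Mode) :
    Commute (annihilation q t p m) (annihilation q t p n) := by
  have h : ⁅(MvPolynomial.pderiv m : Derivation ℂ Fock Fock), (MvPolynomial.pderiv n : Derivation ℂ Fock Fock)⁆ = 0 := by
    apply MvPolynomial.derivation_ext
    intro i
    classical
    simp [Derivation.commutator_apply, MvPolynomial.pderiv_X, Pi.single_apply, apply_ite]
  apply Commute.smul_left
  apply Commute.smul_right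
  apply LinearMap.ext
  intro f
  have := congrArg (fun D : Derivation ℂ Fock Fock => D f) h
  simpa [Derivation.commutator_apply, sub_eq_zero] using this

theorem annihilation_vacuum (q t p : ℂ) (m : Mode) : annihilation q t p m 1 = 0 := by
  simp [annihilation]

theorem annihilation_creation_comm (q t p : ℂ) (m n : Mode) :
    annihilation q t p m * creation n - creation n * annihilation q t p m =
      if m = n then bosonNorm q t p m • (1 : Module.End ℂ Fock) else 0 := by
  classical
  apply LinearMap.ext
  intro f
  by_cases h : m = n
  · subst h
    simp [annihilation, creation, mul_comm, smul_add]
  · have h' : n ≠ m := fun e => h e.symm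
    simp [annihilation, creation, h, MvPolynomial.pderiv_X_of_ne h']

/-- The product `∏_m a_{-m}^{k_m}` of creation operators. -/
def creationMonomial (k : Mode →₀ ℕ) : Module.End ℂ Fock :=
  k.support.noncommProd (fun m => creation m ^ k m)
    (fun m _ n _ _ => (creation_commute m n).pow_pow _ _)

/-- The product `∏_m a_m^{k_m}` of annihilation operators. -/
def annihilationMonomial (q t p : ℂ) (k : Mode →₀ ℕ) : Module.End ℂ Fock :=
  k.support.noncommProd (fun m => annihilation q t p m ^ k m)
    (fun m _ n _ _ => (annihilation_commute q t p m n).pow_pow _ _)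

/-- The vacuum expectation value `⟨0| A |0⟩`: the coefficient of `|0⟩` in `A |0⟩`. -/
def vev (A : Module.End ℂ Fock) : ℂ := MvPolynomial.constantCoeff (A 1)

/-- The expansion of `exp (∑_m d_m u_m)` in monomials in commuting symbols `u_m`. -/
def expSeries {R : Type*} [CommRing R] [Algebra ℂ R] (d : Mode → R) : MvPowerSeries Mode R :=
  fun k => k.prod fun m e => ((e.factorial : ℂ)⁻¹) • d m ^ e

/-- The coefficients in the exponents of `φ(p;z)` (of `a_{-n}` and `b_{-n}`) and of `φ^*(p;z)`
(of `a_n` and `b_n`). -/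
def phiCoeff (q t p z : ℂ) : Mode → ℂ
  | Sum.inl n => (1 - t ^ (n : ℕ)) / ((1 - q ^ (n : ℕ)) * (1 - p ^ (n : ℕ))) *
      (z ^ (n : ℕ) / (n : ℂ))
  | Sum.inr n => (1 - t ^ (n : ℕ)) * (q * t⁻¹ * p) ^ (n : ℕ) /
      ((1 - q ^ (n : ℕ)) * (1 - p ^ (n : ℕ))) * ((z ^ (n : ℕ))⁻¹ / (n : ℂ))

/-- The coefficient of `a_n` (`n ≠ 0`) in the exponent of `η(p; c z)`, with `z` the Laurent
variable: `-(1 - tⁿ) / (1 - p^|n|) * (c z)⁻ⁿ / n`. -/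
def etaCoeffA (t p c : ℂ) (n : ℤ) : ℂ[T;T⁻¹] :=
  LaurentPolynomial.C (-((1 - t ^ n) / (1 - p ^ n.natAbs)) * (c ^ (-n) / (n : ℂ))) *
    LaurentPolynomial.T (-n)

/-- The coefficient of `b_n` (`n ≠ 0`) in the exponent of `η(p; c z)`, with `z` the Laurent
variable: `-(1 - t⁻ⁿ) / (1 - p^|n|) * p^|n| * (c z)ⁿ / n`. -/
def etaCoeffB (t p c : ℂ) (n : ℤ) : ℂ[T;T⁻¹] :=
  LaurentPolynomial.C (-((1 - t ^ (-n)) / (1 - p ^ n.natAbs) * p ^ n.natAbs) *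
    (c ^ n / (n : ℂ))) * LaurentPolynomial.T n

/-- The coefficients of `a_{-n}`, `b_{-n}`, `n ≥ 1`, in the exponent of `(η(p; c z))_-`. -/
def etaMinusCoeff (t p c : ℂ) : Mode → ℂ[T;T⁻¹]
  | Sum.inl n => etaCoeffA t p c (-(n : ℤ))
  | Sum.inr n => etaCoeffB t p c (-(n : ℤ))

/-- The coefficients of `a_n`, `b_n`, `n ≥ 1`, in the exponent of `(η(p; c z))_+`. -/
def etaPlusCoeff (t p c : ℂ) : Mode → ℂ[T;T⁻¹]
  | Sum.inl n => etaCoeffA t p c (n : ℤ)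
  | Sum.inr n => etaCoeffB t p c (n : ℤ)

/-- The term of
`⟨0| φ^*_M(p;x) [(η(p;z))_- (η(p;p⁻¹z))_+]_1 φ_N(p;y) |0⟩`
obtained by taking from the four factors (in this order) the monomials with exponents
`k.1`, `k.2.1`, `k.2.2.1`, `k.2.2.2` in the annihilation, creation, annihilation and creation
operators, respectively. -/
def matrixElementTerm (M N : ℕ) (q t p : ℂ) (x : Fin M → ℂ) (y : Fin N → ℂ)
    (k : (Mode →₀ ℕ) × (Mode →₀ ℕ) × (Mode →₀ ℕ) × (Mode →₀ ℕ)) : ℂ :=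
  MvPowerSeries.coeff k.1 (∏ i, expSeries (phiCoeff q t p (x i))) *
  (MvPowerSeries.coeff k.2.1 (expSeries (etaMinusCoeff t p 1)) *
    MvPowerSeries.coeff k.2.2.1 (expSeries (etaPlusCoeff t p p⁻¹))).coeff 0 *
  MvPowerSeries.coeff k.2.2.2 (∏ j, expSeries (phiCoeff q t p (y j))) *
  vev (annihilationMonomial q t p k.1 * creationMonomial k.2.1 *
    annihilationMonomial q t p k.2.2.1 * creationMonomial k.2.2.2)

/-- `⟨0| φ^*_M(p;x) [(η(p;z))_- (η(p;p⁻¹z))_+]_1 φ_N(p;y) |0⟩`. -/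
def matrixElement (M N : ℕ) (q t p : ℂ) (x : Fin M → ℂ) (y : Fin N → ℂ) : ℂ :=
  ∑' k, matrixElementTerm M N q t p x y k

/-- The region in which the free field series converges absolutely: there is a radius `r = |z|`
for which all power series in `x_i y_j`, `q p t⁻¹ / (x_i y_j)`, `x_i z`, `p / (x_i z)`,
`p y_j / z`, `z / y_j` that occur as exponents in commuting two of the four factors converge. -/
def FreeFieldRegion (M N : ℕ) (q t p : ℂ) (x : Fin M → ℂ) (y : Fin N → ℂ) : Prop :=
  (∀ i j, ‖x i * y j‖ < 1 ∧ ‖t * x i * y j‖ < 1 ∧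
    ‖q * p‖ < ‖x i * y j‖ ∧ ‖q * p‖ < ‖t * x i * y j‖) ∧
  ∃ r : ℝ, 0 < r ∧
    (∀ i, ‖x i‖ * r < 1 ∧ ‖t⁻¹ * x i‖ * r < 1 ∧ ‖p‖ < ‖x i‖ * r ∧ ‖t * p‖ < ‖x i‖ * r) ∧
    ∀ j, ‖p * y j‖ < r ∧ ‖t * p * y j‖ < r ∧ r < ‖y j‖ ∧ r < ‖t * y j‖

end

end EllipticKernel

open EllipticKernel Filter

namespace EllipticKernel

/-! ### Infinite products -/

/-! The functional equation is a residue computation. The theta ratio `F(z) = ∏_k Θ(v_k z)/Θ(u_k z)`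
has its poles on the `p`-orbits of the points `1/u_k`, where `u` lists the `x_i` and the `1/(t
y_j)`. Since `Θ_p(pz) = -z⁻¹ Θ_p(z)`, `F(pz) = t^(M-N) F(z)`, so the constant terms on `|z| = r` and
`|z| = r/|p|` differ by `(1 - t^(N-M)) C_{MN}`. That difference is also the sum of one residue term
per `k` (`circleAverage_prod_theta`). The terms at `1/x_i` and `t y_j` are, up to a common constant,
the summands of `H_M Π / Π` and `H_N Π / Π`, because shifting one variable of `Π` by `q` multiplies
it by a product of theta quotients (`qShift_ellKernel`, `residue_inl`, `residue_inr`).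

This needs `p ≠ 0` and distinct poles. Both sides are continuous in the parameters
(`tendsto_functional_equation_left`, `tendsto_functional_equation_right`), so coinciding poles are
reached by scaling `y`, and `p = 0` as a limit from `p ≠ 0`. The same continuity gives the
trigonometric limit, with `C_{MN} = 1` at `p = 0` by the mean value property.

The free field formula is Wick's theorem for exponentials (`expTerm_mul_vev`): the vacuum
expectation factorises into contractions of `φ*` with `η₋`, of `η₊` with `φ`, and of `φ*` with `φ`.
The last series sums to `Π`. The other two, weighted by powers of `z`, sum to `F(z)`, and both
`[·]_1` and averaging over a circle keep exactly the terms of degree zero (`hasSum_circleAverage`).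
-/

theorem summable_norm_mul_pow_mul_pow {q p : ℂ} (hq : ‖q‖ < 1) (hp : ‖p‖ < 1) (x : ℂ) :
    Summable fun k : ℕ × ℕ => ‖x * q ^ k.1 * p ^ k.2‖ := by
  have h := ((summable_geometric_of_lt_one (norm_nonneg q) hq).mul_of_nonneg
    (summable_geometric_of_lt_one (norm_nonneg p) hp)
    (fun n => by positivity) (fun n => by positivity)).mul_left ‖x‖
  refine h.congr fun k => ?_
  simp only [norm_mul, norm_pow, mul_assoc]

theorem multipliable_qpPoch {q p : ℂ} (hq : ‖q‖ < 1) (hp : ‖p‖ < 1) (x : ℂ) :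
    Multipliable fun k : ℕ × ℕ => 1 - x * q ^ k.1 * p ^ k.2 := by
  simp only [sub_eq_add_neg]
  refine multipliable_one_add_of_summable ?_
  simpa only [norm_neg] using summable_norm_mul_pow_mul_pow hq hp x

theorem qpPoch_ne_zero {q p : ℂ} (hq : ‖q‖ < 1) (hp : ‖p‖ < 1) {x : ℂ}
    (h : ∀ m n : ℕ, x * q ^ m * p ^ n ≠ 1) : qpPoch q p x ≠ 0 := by
  unfold qpPoch
  simp only [sub_eq_add_neg]
  refine tprod_one_add_ne_zero_of_summable (fun k => ?_) ?_
  · rw [← sub_eq_add_neg]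
    exact sub_ne_zero.mpr (h k.1 k.2).symm
  · simpa only [norm_neg] using summable_norm_mul_pow_mul_pow hq hp x

theorem norm_mul_pow_mul_pow_le {q p x : ℂ} (hq : ‖q‖ < 1) (hp : ‖p‖ < 1) (m n : ℕ) :
    ‖x * q ^ m * p ^ n‖ ≤ ‖x‖ := by
  simp only [norm_mul, norm_pow]
  have h1 := pow_le_one₀ (n := m) (norm_nonneg q) hq.le
  have h2 := pow_le_one₀ (n := n) (norm_nonneg p) hp.le
  calc ‖x‖ * ‖q‖ ^ m * ‖p‖ ^ n ≤ ‖x‖ * 1 * 1 := by gcongr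
    _ = ‖x‖ := by ring

theorem qpPoch_ne_zero_of_norm_lt {q p : ℂ} (hq : ‖q‖ < 1) (hp : ‖p‖ < 1) {x : ℂ}
    (hx : ‖x‖ < 1) : qpPoch q p x ≠ 0 := by
  refine qpPoch_ne_zero hq hp fun m n h => ?_
  have := norm_mul_pow_mul_pow_le (x := x) hq hp m n
  rw [h, norm_one] at this
  linarith

/-- Dominated convergence with majorant `(‖x₀‖ + 1) |q|^m ρ^n`, where `|p₀| < ρ < 1`. The case `p₀ =
0` is included, which is what the trigonometric limit uses. -/
theorem tendsto_qpPoch {ι : Type*} {l : Filter ι} {p x : ι → ℂ} {q p₀ x₀ : ℂ} (hq : ‖q‖ < 1)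
    (hp : ‖p₀‖ < 1) (hpl : Tendsto p l (𝓝 p₀)) (hxl : Tendsto x l (𝓝 x₀)) :
    Tendsto (fun s => qpPoch q (p s) (x s)) l (𝓝 (qpPoch q p₀ x₀)) := by
  obtain ⟨ρ, hρ, hρ1⟩ := exists_between hp
  have hρ0 : 0 ≤ ρ := (norm_nonneg _).trans hρ.le
  have hbd := ((summable_geometric_of_lt_one (norm_nonneg q) hq).mul_of_nonneg
    (summable_geometric_of_lt_one hρ0 hρ1)
    (fun n => by positivity) (fun n => by positivity)).mul_left (‖x₀‖ + 1)
  unfold qpPoch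
  simp only [sub_eq_add_neg]
  refine tendsto_tprod_one_add_of_dominated_convergence hbd (fun k => ?_) ?_
  · exact ((hxl.mul_const _).mul (hpl.pow _)).neg
  · filter_upwards [hpl.norm.eventually (gt_mem_nhds hρ),
      hxl.norm.eventually (gt_mem_nhds (lt_add_one ‖x₀‖))] with s h1 h2 k
    rw [norm_neg, norm_mul, norm_mul, norm_pow, norm_pow, mul_assoc]
    gcongr

/-- At `q = 0` only the factors with `m = 0` differ from `1`, since `0 ^ 0 = 1`. Facts about single
products thus follow from those about double ones. -/
theorem qPoch_eq_qpPoch_zero (p x : ℂ) : qPoch p x = qpPoch 0 p x := by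
  have hinj : Function.Injective fun n : ℕ => ((0, n) : ℕ × ℕ) := fun a b h => by simpa using h
  have := hinj.tprod_eq (f := fun k : ℕ × ℕ => 1 - x * 0 ^ k.1 * p ^ k.2) (by
    rintro ⟨m, n⟩ h
    rcases m with _ | m
    · exact ⟨n, rfl⟩
    · simp at h)
  unfold qPoch qpPoch
  rw [← this]
  simp

theorem qpPoch_zero_right (q x : ℂ) : qpPoch q 0 x = qPoch q x := by
  have hinj : Function.Injective fun n : ℕ => ((n, 0) : ℕ × ℕ) := fun a b h => by simpa using h
  have := hinj.tprod_eq (f := fun k : ℕ × ℕ => 1 - x * q ^ k.1 * 0 ^ k.2) (by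
    rintro ⟨m, n⟩ h
    rcases n with _ | n
    · exact ⟨m, rfl⟩
    · simp at h)
  unfold qPoch qpPoch
  rw [← this]
  simp

theorem norm_zero_lt_one : ‖(0 : ℂ)‖ < 1 := by simp

theorem tendsto_qPoch {ι : Type*} {l : Filter ι} {p x : ι → ℂ} {p₀ x₀ : ℂ}
    (hp : ‖p₀‖ < 1) (hpl : Tendsto p l (𝓝 p₀)) (hxl : Tendsto x l (𝓝 x₀)) :
    Tendsto (fun s => qPoch (p s) (x s)) l (𝓝 (qPoch p₀ x₀)) := by
  simp only [qPoch_eq_qpPoch_zero]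
  exact tendsto_qpPoch norm_zero_lt_one hp hpl hxl

theorem qPoch_ne_zero {p : ℂ} (hp : ‖p‖ < 1) {x : ℂ} (h : ∀ n : ℕ, x * p ^ n ≠ 1) :
    qPoch p x ≠ 0 := by
  rw [qPoch_eq_qpPoch_zero]
  refine qpPoch_ne_zero norm_zero_lt_one hp fun m n => ?_
  rcases m with _ | m
  · simpa using h n
  · simp

theorem qPoch_ne_zero_of_norm_lt {p : ℂ} (hp : ‖p‖ < 1) {x : ℂ} (hx : ‖x‖ < 1) :
    qPoch p x ≠ 0 := by
  rw [qPoch_eq_qpPoch_zero]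
  exact qpPoch_ne_zero_of_norm_lt norm_zero_lt_one hp hx

theorem multipliable_qPoch {p : ℂ} (hp : ‖p‖ < 1) (x : ℂ) :
    Multipliable fun n : ℕ => 1 - x * p ^ n := by
  simp only [sub_eq_add_neg]
  refine multipliable_one_add_of_summable ?_
  simpa using (summable_geometric_of_lt_one (norm_nonneg p) hp).mul_left ‖x‖

theorem qPoch_eq_mul_qPoch {p : ℂ} (hp : ‖p‖ < 1) (x : ℂ) :
    qPoch p x = (1 - x) * qPoch p (p * x) := by
  unfold qPoch
  have h : Multipliable fun n : ℕ => 1 - x * p ^ (n + 1) := by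
    refine (multipliable_qPoch hp (p * x)).congr fun n => ?_
    ring
  rw [← h.prod_mul_tprod_nat_mul' (f := fun n : ℕ => 1 - x * p ^ n) (k := 1)]
  simp only [Finset.prod_range_one, pow_zero, mul_one]
  congr 1
  exact tprod_congr fun n => by ring

theorem qpPoch_eq_tprod {q p : ℂ} (hq : ‖q‖ < 1) (hp : ‖p‖ < 1) (x : ℂ) :
    HasProd (fun m : ℕ => qPoch p (x * q ^ m)) (qpPoch q p x) :=
  (multipliable_qpPoch hq hp x).hasProd.prod_fiberwise fun m =>
    (multipliable_qPoch hp (x * q ^ m)).hasProd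

theorem qpPoch_eq_mul_qpPoch {q p : ℂ} (hq : ‖q‖ < 1) (hp : ‖p‖ < 1) (x : ℂ) :
    qpPoch q p x = qPoch p x * qpPoch q p (q * x) := by
  have h1 := qpPoch_eq_tprod hq hp x
  have h2 := qpPoch_eq_tprod hq hp (q * x)
  have h : HasProd (fun m : ℕ => qPoch p (x * q ^ (m + 1))) (qpPoch q p (q * x)) := by
    convert! h2 using 3 with m
    ring
  rw [← h1.tprod_eq, ← h.multipliable.prod_mul_tprod_nat_mul' (k := 1)
    (f := fun m : ℕ => qPoch p (x * q ^ m)), h.tprod_eq]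
  simp

/-- On the ball of radius `R` the product converges locally uniformly, by the majorant `R |p|^n`. -/
theorem differentiable_qPoch {p : ℂ} (hp : ‖p‖ < 1) : Differentiable ℂ (qPoch p) := by
  have h (R : ℝ) : DifferentiableOn ℂ (qPoch p) (Metric.ball 0 R) := by
    have h1 := (((summable_geometric_of_lt_one (norm_nonneg p) hp).mul_left
      R)).hasProdLocallyUniformlyOn_nat_one_add
      (f := fun n (x : ℂ) => -(x * p ^ n)) (K := Metric.ball (0 : ℂ) R) Metric.isOpen_ball
      (.of_forall fun n x hx => by
        have : ‖x‖ ≤ R := by simpa using (mem_ball_zero_iff.mp hx).le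
        rw [norm_neg, norm_mul, norm_pow]
        gcongr) (fun n => by fun_prop)
    have h2 := h1.differentiableOn (.of_forall fun s => by
      simpa [Finset.prod_fn] using DifferentiableOn.finsetProd (fun _ _ => by fun_prop))
      Metric.isOpen_ball
    simpa only [← sub_eq_add_neg] using! h2
  intro x
  exact (h (‖x‖ + 1)).differentiableAt (Metric.isOpen_ball.mem_nhds (by simp))

/-! ### The theta function and the elliptic gamma function -/

theorem qPoch_self_ne_zero {p : ℂ} (hp : ‖p‖ < 1) : qPoch p p ≠ 0 :=
  qPoch_ne_zero_of_norm_lt hp hp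

/-- The factor `(u; p)_∞` accounts for the zeros `p^(-n)`, the factor `(p/u; p)_∞` for the zeros
`p^(n+1)`. -/
theorem theta_ne_zero {p u : ℂ} (hp : ‖p‖ < 1) (hu : u ≠ 0) (h : ∀ k : ℤ, u ≠ p ^ k) :
    theta p u ≠ 0 := by
  refine mul_ne_zero (mul_ne_zero (qPoch_self_ne_zero hp) (qPoch_ne_zero hp fun n hn => ?_))
    (qPoch_ne_zero hp fun n hn => ?_)
  · apply h (-(n : ℤ))
    rw [zpow_neg, zpow_natCast]
    exact eq_inv_of_mul_eq_one_left hn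
  · apply h ((n + 1 : ℕ) : ℤ)
    rw [zpow_natCast, pow_succ]
    field_simp at hn
    rw [← hn]; ring

theorem tendsto_theta {ι : Type*} {l : Filter ι} {p x : ι → ℂ} {p₀ x₀ : ℂ}
    (hp : ‖p₀‖ < 1) (hx : x₀ ≠ 0) (hpl : Tendsto p l (𝓝 p₀)) (hxl : Tendsto x l (𝓝 x₀)) :
    Tendsto (fun s => theta (p s) (x s)) l (𝓝 (theta p₀ x₀)) :=
  ((tendsto_qPoch hp hpl hpl).mul (tendsto_qPoch hp hpl hxl)).mul
    (tendsto_qPoch hp hpl (hpl.mul (hxl.inv₀ hx)))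

theorem theta_zero (x : ℂ) : theta 0 x = 1 - x := by
  have h (y : ℂ) : qPoch 0 y = 1 - y := by
    rw [qPoch_eq_mul_qPoch norm_zero_lt_one, zero_mul, qPoch]
    simp
  simp [theta, h]

theorem theta_inv {p x : ℂ} (hp : ‖p‖ < 1) (hx : x ≠ 0) :
    theta p x⁻¹ = -x⁻¹ * theta p x := by
  unfold theta
  rw [inv_inv, qPoch_eq_mul_qPoch hp x⁻¹, qPoch_eq_mul_qPoch hp x]
  field_simp
  ring

theorem theta_mul_left {p x : ℂ} (hp : ‖p‖ < 1) (hp0 : p ≠ 0) (hx : x ≠ 0) :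
    theta p (p * x) = -x⁻¹ * theta p x := by
  unfold theta
  have : p * (p * x)⁻¹ = x⁻¹ := by field_simp
  rw [this, qPoch_eq_mul_qPoch hp x⁻¹, qPoch_eq_mul_qPoch hp x]
  field_simp
  ring

theorem theta_eq_one_sub_mul {p x : ℂ} (hp : ‖p‖ < 1) :
    theta p x = (1 - x) * (qPoch p p * qPoch p (p * x) * qPoch p (p * x⁻¹)) := by
  rw [theta, qPoch_eq_mul_qPoch hp x]; ring

theorem ellGamma_mul_left {q p x : ℂ} (hq0 : q ≠ 0) (hq : ‖q‖ < 1) (hp : ‖p‖ < 1)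
    (hx : qPoch p x ≠ 0) :
    ellGamma q p (q * x) = ellGamma q p x * (theta p x / qPoch p p) := by
  have h1 : q * p * (q * x)⁻¹ = p * x⁻¹ := by
    rw [mul_inv]; field_simp
  have h2 : q * (p * x⁻¹) = q * p * x⁻¹ := by ring
  have h3 := qPoch_self_ne_zero hp
  unfold ellGamma theta
  rw [h1, qpPoch_eq_mul_qpPoch hq hp x, qpPoch_eq_mul_qpPoch hq hp (p * x⁻¹), h2]
  field_simp

/-- The `q`-shift of `1/Γ` is treated separately so that `(x; p)_∞` may vanish: the kernel has `Γ(t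
x_i y_j)` in its denominator, and `t x_i y_j = 1` is allowed in the final theorem. -/
theorem ellGamma_inv_eq {q p x : ℂ} (hq0 : q ≠ 0) (hq : ‖q‖ < 1) (hp : ‖p‖ < 1)
    (hx : qPoch p (p * x⁻¹) ≠ 0) :
    (ellGamma q p x)⁻¹ = (ellGamma q p (q * x))⁻¹ * (theta p x / qPoch p p) := by
  have h1 : q * p * (q * x)⁻¹ = p * x⁻¹ := by
    rw [mul_inv]; field_simp
  have h2 : q * (p * x⁻¹) = q * p * x⁻¹ := by ring
  have h3 := qPoch_self_ne_zero hp
  unfold ellGamma theta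
  rw [h1, qpPoch_eq_mul_qpPoch hq hp x, qpPoch_eq_mul_qpPoch hq hp (p * x⁻¹), h2]
  generalize qPoch p (p * x⁻¹) = A at hx ⊢
  generalize qpPoch q p (q * p * x⁻¹) = B
  field_simp

theorem tendsto_ellGamma {ι : Type*} {l : Filter ι} {p x : ι → ℂ} {q p₀ x₀ : ℂ} (hq : ‖q‖ < 1)
    (hp : ‖p₀‖ < 1) (hx : x₀ ≠ 0) (hx' : qpPoch q p₀ x₀ ≠ 0)
    (hpl : Tendsto p l (𝓝 p₀)) (hxl : Tendsto x l (𝓝 x₀)) :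
    Tendsto (fun s => ellGamma q (p s) (x s)) l (𝓝 (ellGamma q p₀ x₀)) :=
  (tendsto_qpPoch hq hp hpl ((hpl.const_mul q).mul (hxl.inv₀ hx))).div
    (tendsto_qpPoch hq hp hpl hxl) hx'

/-- The reciprocal is continuous even at poles of `Γ`. There division by zero makes `ellGamma` equal
to `0`, and its inverse `0` is the correct value of `1/Γ`. -/
theorem tendsto_ellGamma_inv {ι : Type*} {l : Filter ι} {p x : ι → ℂ} {q p₀ x₀ : ℂ}
    (hq : ‖q‖ < 1) (hp : ‖p₀‖ < 1) (hx : x₀ ≠ 0) (hx' : qpPoch q p₀ (q * p₀ * x₀⁻¹) ≠ 0)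
    (hpl : Tendsto p l (𝓝 p₀)) (hxl : Tendsto x l (𝓝 x₀)) :
    Tendsto (fun s => (ellGamma q (p s) (x s))⁻¹) l (𝓝 (ellGamma q p₀ x₀)⁻¹) := by
  simp only [ellGamma, inv_div]
  exact (tendsto_qpPoch hq hp hpl hxl).div
    (tendsto_qpPoch hq hp hpl ((hpl.const_mul q).mul (hxl.inv₀ hx))) hx'

/-! ### Logarithms of infinite products. -/

theorem summable_pow_div {ι : Type*} {c : ι → ℂ} (hc : Summable fun i => ‖c i‖) {ρ : ℝ} (hρ : ρ < 1)
    (hcρ : ∀ i, ‖c i‖ ≤ ρ) : Summable fun k : ι × ℕ => c k.1 ^ (k.2 + 1) / ((k.2 : ℂ) + 1) := by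
  rcases isEmpty_or_nonempty ι with h | h
  · exact summable_empty
  have hρ0 : 0 ≤ ρ := (norm_nonneg _).trans (hcρ h.some)
  refine .of_norm_bounded (hc.mul_of_nonneg (summable_geometric_of_lt_one hρ0 hρ)
    (fun _ => norm_nonneg _) (fun _ => by positivity)) fun k => ?_
  have h1 : (1 : ℝ) ≤ ‖((k.2 : ℂ) + 1)‖ := by
    rw [← Nat.cast_succ, Complex.norm_natCast]
    exact_mod_cast Nat.succ_le_succ (Nat.zero_le _)
  rw [norm_div, norm_pow, pow_succ']
  refine (div_le_self (by positivity) h1).trans ?_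
  gcongr
  exact hcρ _

/-- `∏ (1 - c_i) = exp (-∑_{n ≥ 1} (∑_i c_iⁿ) / n)`. -/
theorem exp_tsum_eq_tprod_inv {ι : Type*} {c : ι → ℂ} (hc : Summable fun i => ‖c i‖) {ρ : ℝ}
    (hρ : ρ < 1) (hcρ : ∀ i, ‖c i‖ ≤ ρ) {s : ℕ → ℂ}
    (hs : ∀ n, HasSum (fun i => c i ^ (n + 1)) (s n)) :
    Complex.exp (∑' n : ℕ, s n / ((n : ℂ) + 1)) = (∏' i, (1 - c i))⁻¹ := by
  have hlt (i) : ‖c i‖ < 1 := (hcρ i).trans_lt hρ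
  have hS := (summable_pow_div hc hρ hcρ).hasSum
  generalize ∑' k : ι × ℕ, c k.1 ^ (k.2 + 1) / ((k.2 : ℂ) + 1) = S at hS
  have hlog (i : ι) : HasSum (fun n : ℕ => c i ^ (n + 1) / ((n : ℂ) + 1))
      (-Complex.log (1 - c i)) := Complex.hasSum_taylorSeries_neg_log' (hlt i)
  -- The same absolutely convergent double series is summed first over the exponent (`h1`) and first
  -- over the factors (`h2`).
  have h1 : HasSum (fun i => -Complex.log (1 - c i)) S := hS.prod_fiberwise hlog
  have h2 : HasSum (fun n : ℕ => s n / ((n : ℂ) + 1)) S := by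
    have hswap : HasSum (fun k : ℕ × ι => c k.2 ^ (k.1 + 1) / ((k.1 : ℂ) + 1)) S :=
      (Equiv.prodComm ℕ ι).hasSum_iff.mpr hS
    have hfib (n : ℕ) : HasSum (fun i => c i ^ (n + 1) / ((n : ℂ) + 1)) (s n / (n + 1)) := by
      simpa only [div_eq_mul_inv] using (hs n).mul_right ((n : ℂ) + 1)⁻¹
    exact hswap.prod_fiberwise hfib
  have hne (i) : 1 - c i ≠ 0 := fun h => by
    have := hlt i
    rw [← sub_eq_zero.mp h, norm_one] at this
    exact lt_irrefl _ this
  have h3 : HasProd (fun i => 1 - c i) (Complex.exp (-S)) :=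
    Complex.hasProd_of_hasSum_log hne (by simpa only [neg_neg] using h1.neg)
  rw [h3.tprod_eq, h2.tsum_eq, Complex.exp_neg, inv_inv]

theorem exp_tsum_eq_qpPoch_inv {q p u : ℂ} (hq : ‖q‖ < 1) (hp : ‖p‖ < 1) (hu : ‖u‖ < 1) :
    Complex.exp (∑' n : ℕ, u ^ (n + 1) / ((1 - q ^ (n + 1)) * (1 - p ^ (n + 1))) / (n + 1)) =
      (qpPoch q p u)⁻¹ := by
  refine exp_tsum_eq_tprod_inv (summable_norm_mul_pow_mul_pow hq hp u) hu
    (fun k => norm_mul_pow_mul_pow_le hq hp _ _) fun n => ?_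
  have h (a : ℂ) (ha : ‖a‖ < 1) : ‖a ^ (n + 1)‖ < 1 := by
    rw [norm_pow]; exact pow_lt_one₀ (norm_nonneg _) ha (by simp)
  have h1 := hasSum_geometric_of_norm_lt_one (h q hq)
  have h2 := hasSum_geometric_of_norm_lt_one (h p hp)
  have h3 := (h1.mul h2 (summable_mul_of_summable_norm 
    (by simpa [norm_pow] using summable_geometric_of_lt_one (norm_nonneg _) (h q hq))
    (by simpa [norm_pow] using summable_geometric_of_lt_one (norm_nonneg _) (h p hp)))).mul_left
      (u ^ (n + 1))
  convert! h3 using 1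
  · ext k; simp only [mul_pow]; ring
  · rw [div_eq_mul_inv, mul_inv]

end EllipticKernel

namespace EllipticKernel

/-! ### Laurent expansions -/

/-- Averaging a sum of monomials over a circle picks the monomials of degree zero. -/
theorem hasSum_circleAverage {ι : Type*} [Countable ι] {f : ℂ → ℂ} {a : ι → ℂ} {d : ι → ℤ} {r : ℝ}
    (hr : 0 < r)
    (hf : ∀ z ∈ Metric.sphere (0 : ℂ) r, HasSum (fun n => a n * z ^ d n) (f z)) :
    HasSum (fun n => if d n = 0 then a n else 0) (Real.circleAverage f 0 r) := by
  have hmem (θ : ℝ) : circleMap 0 r θ ∈ Metric.sphere (0 : ℂ) r := circleMap_mem_sphere 0 hr.le θ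
  let F (n : ι) : C(ℝ, ℂ) := ⟨fun θ => a n * circleMap 0 r θ ^ d n,
    continuous_const.mul ((continuous_circleMap 0 r).zpow₀ (d n)
      fun θ => Or.inl (circleMap_ne_center hr.ne'))⟩
  -- The norms of the monomials are constant on the circle, so convergence at the single point `z =
  -- r` gives uniform absolute convergence.
  have hnorm : Summable fun n => ‖a n * (r : ℂ) ^ d n‖ :=
    (hf r (by simp [abs_of_pos hr])).summable.norm
  have hsum : Summable fun n => ‖(F n).restrict
      (⟨Set.uIcc 0 (2 * Real.pi), isCompact_uIcc⟩ : TopologicalSpace.Compacts ℝ)‖ := by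
    refine hnorm.of_nonneg_of_le (fun _ => norm_nonneg _) fun n => ?_
    refine (ContinuousMap.norm_le _ (norm_nonneg _)).mpr fun θ => ?_
    simp [F]
  have h1 := intervalIntegral.hasSum_intervalIntegral_of_summable_norm hsum
  have h2 : ∀ θ : ℝ, ∑' n, F n θ = f (circleMap 0 r θ) := fun θ => (hf _ (hmem θ)).tsum_eq
  simp only [h2] at h1
  rw [Real.circleAverage_def]
  convert! h1.const_smul (2 * Real.pi)⁻¹ using 2 with n
  change _ = Real.circleAverage (fun z => a n * z ^ d n) 0 r
  split_ifs with hn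
  · simp [hn, Real.circleAverage_const]
  · rw [Real.circleAverage_eq_circleIntegral hr.ne']
    have h3 : ∮ z in C(0, r), (z - 0)⁻¹ • (a n * z ^ d n) =
        ∮ z in C(0, r), a n • (z - 0) ^ (d n - 1) := by
      refine circleIntegral.integral_congr hr.le fun z hz => ?_
      have hz0 : z ≠ 0 := fun h => by simp [h, hr.ne] at hz
      simp only [sub_zero, smul_eq_mul]
      rw [zpow_sub_one₀ hz0]
      ring
    rw [h3, circleIntegral.integral_smul, circleIntegral.integral_sub_zpow_of_ne (by omega)]
    simp

namespace HasLaurentExpansionOn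

variable {f g : ℂ → ℂ} {A B : Set ℂ} {a b : ℤ → ℂ}

theorem mono (h : HasLaurentExpansionOn f A a) (hBA : B ⊆ A) : HasLaurentExpansionOn f B a :=
  fun z hz => h z (hBA hz)

theorem congr (h : HasLaurentExpansionOn f A a) (hfg : ∀ z ∈ A, g z = f z) :
    HasLaurentExpansionOn g A a := fun z hz => (hfg z hz) ▸ h z hz

theorem const_mul (h : HasLaurentExpansionOn f A a) (c : ℂ) :
    HasLaurentExpansionOn (fun z => c * f z) A fun n => c * a n := fun z hz => by
  simpa only [mul_assoc] using (h z hz).mul_left c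

theorem sum {κ : Type*} {s : Finset κ} {f : κ → ℂ → ℂ} {a : κ → ℤ → ℂ}
    (h : ∀ k ∈ s, HasLaurentExpansionOn (f k) A (a k)) :
    HasLaurentExpansionOn (fun z => ∑ k ∈ s, f k z) A fun n => ∑ k ∈ s, a k n := fun z hz => by
  simpa only [Finset.sum_mul] using hasSum_sum fun k hk => h k hk z hz

theorem mul (hA : (0 : ℂ) ∉ A) (hf : HasLaurentExpansionOn f A a)
    (hg : HasLaurentExpansionOn g A b) :
    HasLaurentExpansionOn (fun z => f z * g z) A fun n => ∑' k, a k * b (n - k) := fun z hz => by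
  have hz0 : z ≠ 0 := fun h => hA (h ▸ hz)
  have hf' : HasSum (fun n : ℤ => a n * z ^ n) (f z) := hf z hz
  have hg' : HasSum (fun n : ℤ => b n * z ^ n) (g z) := hg z hz
  have h1 : HasSum (fun k : ℤ × ℤ => a k.1 * z ^ k.1 * (b k.2 * z ^ k.2)) (f z * g z) := by
    rw [← hf'.tsum_eq, ← hg'.tsum_eq, tsum_mul_tsum_of_summable_norm hf'.summable.norm
      hg'.summable.norm]
    exact (summable_mul_of_summable_norm hf'.summable.norm hg'.summable.norm).hasSum
  -- Reindexing by `(n, k) ↦ (k, n - k)` groups the double series by total degree `n`.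
  let e : ℤ × ℤ ≃ ℤ × ℤ :=
    { toFun := fun k => (k.2, k.1 - k.2)
      invFun := fun k => (k.1 + k.2, k.1)
      left_inv := fun k => by simp
      right_inv := fun k => by simp }
  have h2 : HasSum (fun k : ℤ × ℤ => a k.2 * b (k.1 - k.2) * z ^ k.1) (f z * g z) := by
    rw [← e.hasSum_iff] at h1
    convert! h1 using 2 with k
    change _ = a k.2 * z ^ k.2 * (b (k.1 - k.2) * z ^ (k.1 - k.2))
    rw [mul_mul_mul_comm, ← zpow_add₀ hz0, add_sub_cancel]
  have h3 (n : ℤ) : HasSum (fun k => a k * b (n - k) * z ^ n) ((∑' k, a k * b (n - k)) * z ^ n) := by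
    have h4 : Summable fun k => a k * b (n - k) := by
      refine ((h2.summable.prod_factor n).mul_right (z ^ n)⁻¹).congr fun k => ?_
      field_simp
    exact h4.hasSum.mul_right _
  exact HasSum.prod_fiberwise (f := fun k : ℤ × ℤ => a k.2 * b (k.1 - k.2) * z ^ k.1)
    (g := fun n => (∑' k, a k * b (n - k)) * z ^ n) h2 h3

theorem inv (hf : HasLaurentExpansionOn f A a) :
    HasLaurentExpansionOn (fun z => f z⁻¹) {z | z⁻¹ ∈ A} fun n => a (-n) := fun z hz => by
  have := (Equiv.neg ℤ).hasSum_iff.mpr (hf z⁻¹ hz)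
  simpa [Function.comp_def] using this

/-- The Taylor coefficients at `0` do not depend on the radius chosen for each `z`, so one sequence
serves all of `A`. -/
theorem of_differentiableOn
    (hf : ∀ z ∈ A, ∃ R, ‖z‖ < R ∧ DifferentiableOn ℂ f (Metric.ball 0 R)) :
    ∃ a, HasLaurentExpansionOn f A a := by
  refine ⟨fun n => if 0 ≤ n then ((n.toNat.factorial : ℂ)⁻¹) * iteratedDeriv n.toNat f 0 else 0,
    fun z hz => ?_⟩
  obtain ⟨R, hzR, hR⟩ := hf z hz
  have h := Complex.hasSum_taylorSeries_on_ball hR (mem_ball_zero_iff.mpr hzR)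
  refine (Function.Injective.hasSum_iff (Nat.cast_injective (R := ℤ)) fun n hn => ?_).mp ?_
  · dsimp only
    rw [if_neg, zero_mul]
    intro h0
    exact hn ⟨n.toNat, Int.toNat_of_nonneg h0⟩
  · convert! h using 2 with n
    simp [mul_assoc, mul_comm (z ^ n)]

theorem prod {κ : Type*} {s : Finset κ} {f : κ → ℂ → ℂ} (hA : (0 : ℂ) ∉ A)
    (h : ∀ k ∈ s, ∃ a, HasLaurentExpansionOn (f k) A a) :
    ∃ a, HasLaurentExpansionOn (fun z => ∏ k ∈ s, f k z) A a := by
  classical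
  induction s using Finset.induction_on with
  | empty =>
    simp only [Finset.prod_empty]
    exact of_differentiableOn fun z _ => ⟨‖z‖ + 1, lt_add_one _, differentiableOn_const 1⟩
  | insert k s hk ih =>
    obtain ⟨a, ha⟩ := h k (Finset.mem_insert_self k s)
    obtain ⟨b, hb⟩ := ih fun l hl => h l (Finset.mem_insert_of_mem hl)
    simp only [Finset.prod_insert hk]
    exact ⟨_, ha.mul hA hb⟩

/-- The constant coefficient of a Laurent expansion is a circle average. -/
theorem circleAverage_eq {r : ℝ} (hr : 0 < r)
    (hf : HasLaurentExpansionOn f (Metric.sphere 0 r) a) : Real.circleAverage f 0 r = a 0 :=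
  (hasSum_circleAverage (d := id) hr hf).unique
    (hasSum_single (f := fun n : ℤ => if n = 0 then a n else 0) 0 fun _ hn => if_neg hn)

end HasLaurentExpansionOn

/-! ### Constant terms as circle averages, and residues between two circles. -/

/-- The circle average does not see which expansion was chosen, which makes the choice in
`constantTerm` harmless. -/
theorem constantTerm_eq {f : ℂ → ℂ} {A : Set ℂ} {r : ℝ} (hr : 0 < r)
    (hA : Metric.sphere 0 r ⊆ A) (h : ∃ a, HasLaurentExpansionOn f A a) :
    constantTerm f A = Real.circleAverage f 0 r := by
  rw [constantTerm, dif_pos h, (h.choose_spec.mono hA).circleAverage_eq hr]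

/-- Multiplication by `c` scales the circle by `‖c‖` and rotates it by `arg c`; the average is
invariant under rotation. -/
theorem circleAverage_comp_mul (f : ℂ → ℂ) (c : ℂ) (r : ℝ) :
    Real.circleAverage (fun z => f (c * z)) 0 r = Real.circleAverage f 0 (‖c‖ * r) := by
  rw [Real.circleAverage_eq_integral_add (f := f) c.arg, Real.circleAverage_def]
  congr 2
  ext θ
  congr 1
  simp only [circleMap, zero_add]
  have h := Complex.norm_mul_exp_arg_mul_I c
  push_cast
  rw [add_mul, Complex.exp_add]
  linear_combination -((r : ℂ) * Complex.exp (θ * Complex.I)) * h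

/-- Expansion of `1 / (1 - z / w)` for `|z| < |w|`. -/
theorem hasLaurentExpansionOn_geometric {w : ℂ} (hw : w ≠ 0) :
    HasLaurentExpansionOn (fun z => (1 - z / w)⁻¹) {z | ‖z‖ < ‖w‖}
      fun n => if 0 ≤ n then w ^ (-n) else 0 := fun z hz => by
  refine (Function.Injective.hasSum_iff (Nat.cast_injective (R := ℤ)) fun n hn => ?_).mp ?_
  · dsimp only
    rw [if_neg, zero_mul]
    intro h0
    exact hn ⟨n.toNat, Int.toNat_of_nonneg h0⟩
  · have : ‖z / w‖ < 1 := by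
      rw [norm_div, div_lt_one (norm_pos_iff.mpr hw)]; exact hz
    convert! hasSum_geometric_of_norm_lt_one this using 2 with n
    simp [div_eq_inv_mul, mul_pow]

/-- Expansion of `1 / (1 - z / w)` for `|w| < |z|`. -/
theorem hasLaurentExpansionOn_geometric_outer {w : ℂ} (hw : w ≠ 0) :
    HasLaurentExpansionOn (fun z => (1 - z / w)⁻¹) {z | ‖w‖ < ‖z‖}
      fun n => if n < 0 then -w ^ (-n) else 0 := fun z hz => by
  have hz : ‖w‖ < ‖z‖ := hz
  have hz0 : z ≠ 0 := norm_pos_iff.mp ((norm_nonneg _).trans_lt hz)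
  have hinj : Function.Injective fun n : ℕ => -((n : ℤ) + 1) := fun a b h => by simpa using h
  refine (hinj.hasSum_iff fun n hn => ?_).mp ?_
  · dsimp only
    rw [if_neg, zero_mul]
    intro h0
    exact hn ⟨(-n - 1).toNat, by simp only; omega⟩
  · have h1 : ‖w / z‖ < 1 := by
      rw [norm_div, div_lt_one (norm_pos_iff.mpr hz0)]; exact hz
    have hne : z - w ≠ 0 := sub_ne_zero.mpr fun h => by rw [h] at hz; exact lt_irrefl _ hz
    have hne' : w - z ≠ 0 := by rw [← neg_sub]; exact neg_ne_zero.mpr hne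
    convert! (hasSum_geometric_of_norm_lt_one h1).mul_left (-(w / z)) using 1
    · ext n
      have hn : -((n : ℤ) + 1) < 0 := by omega
      simp only [Function.comp, hn, if_true, neg_neg]
      rw [zpow_neg, zpow_add_one₀ hw, zpow_add_one₀ hz0, zpow_natCast, zpow_natCast, div_pow]
      field_simp
    · field_simp
      ring

/-- A function with a Laurent expansion, divided by a simple zero between two circles: the
difference of the constant terms on both sides is the residue. -/
theorem exists_expansion_div {F : ℂ → ℂ} {A : Set ℂ} {c : ℤ → ℂ}
    (hF : HasLaurentExpansionOn F A c) {w : ℂ} {r R : ℝ} (hr : 0 < r) (hrw : r < ‖w‖)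
    (hwR : ‖w‖ < R) (hrA : Metric.sphere 0 r ⊆ A) (hRA : Metric.sphere 0 R ⊆ A) (hwA : w ∈ A) :
    ∃ a b, HasLaurentExpansionOn (fun z => F z * (1 - z / w)⁻¹) (Metric.sphere 0 r) a ∧
      HasLaurentExpansionOn (fun z => F z * (1 - z / w)⁻¹) (Metric.sphere 0 R) b ∧
      a 0 - b 0 = F w := by
  have hw : w ≠ 0 := norm_pos_iff.mp (hr.trans hrw)
  have hR : 0 < R := (hr.trans hrw).trans hwR
  refine ⟨_, _, (hF.mono hrA).mul (by simpa using hr.ne)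
    ((hasLaurentExpansionOn_geometric hw).mono fun z hz => ?_), (hF.mono hRA).mul
    (by simpa using hR.ne) ((hasLaurentExpansionOn_geometric_outer hw).mono fun z hz => ?_), ?_⟩
  · simpa [mem_sphere_zero_iff_norm.mp hz] using hrw
  · simpa [mem_sphere_zero_iff_norm.mp hz] using hwR
  -- The inner constant term is `∑_{k ≤ 0} c_k w^k` and the outer one `-∑_{k > 0} c_k w^k`; their
  -- difference is the whole series at `w`.
  · have hsum := (hF w hwA).summable
    have h1 : Summable fun k : ℤ => c k * if (0 : ℤ) ≤ 0 - k then w ^ (-(0 - k)) else 0 := by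
      refine (hsum.indicator {k | 0 ≤ 0 - k}).congr fun k => ?_
      simp [Set.indicator_apply]
    have h2 : Summable fun k : ℤ => c k * if (0 : ℤ) - k < 0 then -w ^ (-(0 - k)) else 0 := by
      refine (hsum.indicator {k | 0 - k < 0}).neg.congr fun k => ?_
      by_cases hk : 0 < k <;> simp [hk]
    rw [← h1.tsum_sub h2, ← (hF w hwA).tsum_eq]
    refine tsum_congr fun k => ?_
    by_cases hk : 0 < k
    · simp [hk]
    · have : (0 : ℤ) ≤ 0 - k := by omega
      have h' : ¬ (0 : ℤ) - k < 0 := by omega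
      simp only [this, h', if_true, if_false]
      simp

/-- Partial fractions, read off from the fact that the Lagrange basis at the nodes `w` sums to `1`.
It reduces several simple poles to one. -/
theorem prod_inv_eq_sum {κ : Type*} [Fintype κ] [DecidableEq κ] [Nonempty κ] {w : κ → ℂ}
    (hinj : Function.Injective w) (hw : ∀ k, w k ≠ 0) {z : ℂ} (hz : ∀ k, z ≠ w k) :
    ∏ k, (1 - z / w k)⁻¹ =
      ∑ k, (∏ l ∈ Finset.univ.erase k, (1 - w k / w l)⁻¹) * (1 - z / w k)⁻¹ := by
  have h := congrArg (Polynomial.eval z)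
    (Lagrange.sum_basis (s := Finset.univ) (v := w) hinj.injOn Finset.univ_nonempty)
  simp only [Polynomial.eval_finsetSum, Polynomial.eval_one, Lagrange.basis,
    Polynomial.eval_prod, Lagrange.basisDivisor, Polynomial.eval_mul, Polynomial.eval_C,
    Polynomial.eval_sub, Polynomial.eval_X] at h
  have hz' (k) : 1 - z / w k ≠ 0 := by
    rw [sub_ne_zero, ne_comm, Ne, div_eq_one_iff_eq (hw k)]; exact hz k
  have h' := congrArg (fun u => (∏ k, (1 - z / w k)⁻¹) * u) h.symm
  rw [mul_one, Finset.mul_sum] at h'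
  rw [h']
  refine Finset.sum_congr rfl fun k _ => ?_
  rw [← Finset.mul_prod_erase _ _ (Finset.mem_univ k), mul_assoc, ← Finset.prod_mul_distrib,
    mul_comm]
  congr 1
  refine Finset.prod_congr rfl fun l hl => ?_
  have hkl : w k - w l ≠ 0 := sub_ne_zero.mpr fun h => (Finset.ne_of_mem_erase hl) (hinj h).symm
  have h1 : 1 - w k / w l = (w l - w k) / w l := by rw [sub_div, div_self (hw l)]
  have h2 : 1 - z / w l = (w l - z) / w l := by rw [sub_div, div_self (hw l)]
  have h3 : w l - z ≠ 0 := sub_ne_zero.mpr (hz l).symm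
  have h4 : w l - w k ≠ 0 := by rw [← neg_sub]; exact neg_ne_zero.mpr hkl
  have hl0 := hw l
  rw [h1, h2]
  field_simp
  ring

/-- Residue theorem for a function with simple poles between two circles. -/
theorem circleAverage_sub_circleAverage {F : ℂ → ℂ} {A : Set ℂ} {c : ℤ → ℂ}
    (hF : HasLaurentExpansionOn F A c) {κ : Type*} [Fintype κ] [DecidableEq κ] [Nonempty κ]
    {w : κ → ℂ} {r R : ℝ} (hinj : Function.Injective w) (hr : 0 < r) (hrw : ∀ k, r < ‖w k‖)
    (hwR : ∀ k, ‖w k‖ < R) (hrA : Metric.sphere 0 r ⊆ A) (hRA : Metric.sphere 0 R ⊆ A)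
    (hwA : ∀ k, w k ∈ A) :
    Real.circleAverage (fun z => F z * ∏ k, (1 - z / w k)⁻¹) 0 r -
      Real.circleAverage (fun z => F z * ∏ k, (1 - z / w k)⁻¹) 0 R =
      ∑ k, (∏ l ∈ Finset.univ.erase k, (1 - w k / w l)⁻¹) * F (w k) := by
  have hw (k) : w k ≠ 0 := norm_pos_iff.mp (hr.trans (hrw k))
  have hR : 0 < R := (hr.trans (hrw (Classical.arbitrary κ))).trans (hwR _)
  choose a b ha hb hab using fun k => exists_expansion_div hF hr (hrw k) (hwR k) hrA hRA (hwA k)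
  have hsplit (z : ℂ) (hz : ∀ k, z ≠ w k) : F z * ∏ k, (1 - z / w k)⁻¹ =
      ∑ k, (∏ l ∈ Finset.univ.erase k, (1 - w k / w l)⁻¹) * (F z * (1 - z / w k)⁻¹) := by
    rw [prod_inv_eq_sum hinj hw hz, Finset.mul_sum]
    exact Finset.sum_congr rfl fun k _ => by ring
  have h1 := (HasLaurentExpansionOn.sum fun k (_ : k ∈ Finset.univ) =>
    (ha k).const_mul (∏ l ∈ Finset.univ.erase k, (1 - w k / w l)⁻¹)).congr fun z hz =>
      hsplit z fun k hk => by
        rw [hk] at hz; exact (hrw k).ne' (mem_sphere_zero_iff_norm.mp hz)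
  have h2 := (HasLaurentExpansionOn.sum fun k (_ : k ∈ Finset.univ) =>
    (hb k).const_mul (∏ l ∈ Finset.univ.erase k, (1 - w k / w l)⁻¹)).congr fun z hz =>
      hsplit z fun k hk => by
        rw [hk] at hz; exact (hwR k).ne (mem_sphere_zero_iff_norm.mp hz)
  rw [h1.circleAverage_eq hr, h2.circleAverage_eq hR, ← Finset.sum_sub_distrib]
  exact Finset.sum_congr rfl fun k _ => by rw [← mul_sub, hab]

end EllipticKernel

namespace EllipticKernel

/-! ### Products of ratios of theta functions -/

theorem exists_expansion_qPoch_div {p : ℂ} (hp : ‖p‖ < 1) (a b : ℂ) :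
    ∃ c, HasLaurentExpansionOn (fun z => qPoch p (a * z) / qPoch p (b * z)) {z | ‖b * z‖ < 1} c := by
  refine HasLaurentExpansionOn.of_differentiableOn fun z hz => ?_
  obtain ⟨R, hzR, hR⟩ : ∃ R, ‖z‖ < R ∧ ∀ u ∈ Metric.ball (0 : ℂ) R, ‖b * u‖ < 1 := by
    by_cases hb : b = 0
    · exact ⟨‖z‖ + 1, lt_add_one _, by simp [hb]⟩
    · have hb' := norm_pos_iff.mpr hb
      refine ⟨1 / ‖b‖, ?_, fun u hu => ?_⟩
      · rw [lt_div_iff₀' hb', ← norm_mul]; exact hz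
      · rw [norm_mul, ← lt_div_iff₀' hb']; exact mem_ball_zero_iff.mp hu
  refine ⟨R, hzR, fun u hu => DifferentiableAt.differentiableWithinAt ?_⟩
  have h (c : ℂ) : DifferentiableAt ℂ (fun z => qPoch p (c * z)) u :=
    ((differentiable_qPoch hp).comp (differentiable_id.const_mul c)).differentiableAt
  exact (h a).div (h b) (qPoch_ne_zero_of_norm_lt hp (hR u hu))

/-- `θ_p(v z) / θ_p(u z)` without the factor `1 / (1 - u z)`. -/
noncomputable def thetaRegular (p v u z : ℂ) : ℂ :=
  qPoch p (v * z) / qPoch p (p * u * z) * (qPoch p (p * v⁻¹ * z⁻¹) / qPoch p (p * u⁻¹ * z⁻¹))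

theorem theta_div_theta {p : ℂ} (hp : ‖p‖ < 1) (v u z : ℂ) :
    theta p (v * z) / theta p (u * z) = thetaRegular p v u z * (1 - u * z)⁻¹ := by
  have h := qPoch_self_ne_zero hp
  rw [theta_eq_one_sub_mul (x := u * z) hp, theta, thetaRegular, mul_inv, mul_inv]
  simp only [← mul_assoc]
  simp only [div_eq_mul_inv, mul_inv]
  field_simp

/-- This is the residue up to normalisation. Both denominators become `(p; p)_∞` at the pole, and a
third factor `(p; p)_∞` is built into `theta`; hence the cube in the functional equation. -/
theorem thetaRegular_inv {p : ℂ} (hp : ‖p‖ < 1) {v u : ℂ} (hu : u ≠ 0) :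
    thetaRegular p v u u⁻¹ = theta p (v / u) / qPoch p p ^ 3 := by
  have h := qPoch_self_ne_zero hp
  have h1 : p * u * u⁻¹ = p := by field_simp
  have h2 : p * u⁻¹ * u⁻¹⁻¹ = p := by field_simp
  have h3 : p * v⁻¹ * u⁻¹⁻¹ = p * (v / u)⁻¹ := by rw [inv_div, inv_inv]; ring
  rw [thetaRegular, theta, h1, h2, h3, ← div_eq_mul_inv v u]
  field_simp

/-- With the pole at `1/u` removed, the nearest possible poles are at `p/u` and `1/(pu)`. The
resulting annulus is wide enough for both circles of the residue argument. -/
theorem exists_expansion_thetaRegular {p : ℂ} (hp : ‖p‖ < 1) (v u : ℂ) :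
    ∃ c, HasLaurentExpansionOn (thetaRegular p v u) {z | ‖p‖ < ‖u * z‖ ∧ ‖p * u * z‖ < 1} c := by
  obtain ⟨a, ha⟩ := exists_expansion_qPoch_div hp v (p * u)
  obtain ⟨b, hb⟩ := exists_expansion_qPoch_div hp (p * v⁻¹) (p * u⁻¹)
  refine ⟨_, HasLaurentExpansionOn.mul ?_ (ha.mono fun z hz => hz.2)
    (hb.inv.mono fun z hz => ?_)⟩
  · simp
  · have hz1 : ‖p‖ < ‖u * z‖ := hz.1
    change ‖p * u⁻¹ * z⁻¹‖ < 1
    rw [mul_assoc, ← mul_inv, norm_mul, norm_inv, ← div_eq_mul_inv]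
    exact (div_lt_one ((norm_nonneg p).trans_lt hz1)).mpr hz1

theorem exists_expansion_theta_div {p : ℂ} (hp : ‖p‖ < 1) (v : ℂ) {u : ℂ} (hu : u ≠ 0) :
    ∃ c, HasLaurentExpansionOn (fun z => theta p (v * z) / theta p (u * z))
      {z | ‖p‖ < ‖u * z‖ ∧ ‖u * z‖ < 1} c := by
  obtain ⟨a, ha⟩ := exists_expansion_thetaRegular hp v u
  refine ⟨_, (HasLaurentExpansionOn.mul (A := {z | ‖p‖ < ‖u * z‖ ∧ ‖u * z‖ < 1}) ?_
    (ha.mono fun z hz => ⟨hz.1, ?_⟩)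
    ((hasLaurentExpansionOn_geometric (inv_ne_zero hu)).mono fun z hz => ?_)).congr fun z _ => ?_⟩
  · simp
  · rw [mul_assoc, norm_mul]
    exact mul_lt_one_of_nonneg_of_lt_one_left (norm_nonneg _) hp hz.2.le
  · have hz2 : ‖u * z‖ < 1 := hz.2
    change ‖z‖ < ‖u⁻¹‖
    rw [norm_inv, ← one_div, lt_div_iff₀' (norm_pos_iff.mpr hu), ← norm_mul]
    exact hz2
  · rw [theta_div_theta hp, div_inv_eq_mul, mul_comm z u]

variable {κ : Type*} [Fintype κ]

theorem exists_expansion_prod_theta {p : ℂ} (hp : ‖p‖ < 1) [Nonempty κ] (v : κ → ℂ) {u : κ → ℂ}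
    (hu : ∀ k, u k ≠ 0) :
    ∃ c, HasLaurentExpansionOn (fun z => ∏ k, theta p (v k * z) / theta p (u k * z))
      {z | ∀ k, ‖p‖ < ‖u k * z‖ ∧ ‖u k * z‖ < 1} c := by
  refine HasLaurentExpansionOn.prod (fun h => ?_) fun k _ => ?_
  · have := (h (Classical.arbitrary κ)).1
    rw [mul_zero, norm_zero] at this
    exact absurd this (norm_nonneg p).not_gt
  · obtain ⟨c, hc⟩ := exists_expansion_theta_div hp (v k) (hu k)
    exact ⟨c, hc.mono fun z hz => hz k⟩

/-- Quasi-periodicity: each numerator contributes `-(v_k z)⁻¹`, each denominator `-(u_k z)`, and `z`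
cancels because there are as many of one as of the other. -/
theorem prod_theta_mul_left {p : ℂ} (hp : ‖p‖ < 1) (hp0 : p ≠ 0) {v u : κ → ℂ}
    (hv : ∀ k, v k ≠ 0) (hu : ∀ k, u k ≠ 0) {z : ℂ} (hz : z ≠ 0) :
    ∏ k, theta p (v k * (p * z)) / theta p (u k * (p * z)) =
      (∏ k, u k / v k) * ∏ k, theta p (v k * z) / theta p (u k * z) := by
  rw [← Finset.prod_mul_distrib]
  refine Finset.prod_congr rfl fun k _ => ?_
  have h1 := hv k
  have h2 := hu k
  rw [mul_left_comm, mul_left_comm (u k), theta_mul_left hp hp0 (mul_ne_zero h1 hz),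
    theta_mul_left hp hp0 (mul_ne_zero h2 hz)]
  simp only [div_eq_mul_inv, mul_inv, neg_mul, neg_inv.symm, inv_inv, mul_neg, neg_neg]
  field_simp

/-- The residue theorem for `∏_k θ_p(v_k z) / θ_p(u_k z)` on a fundamental annulus. -/
theorem circleAverage_prod_theta [DecidableEq κ] [Nonempty κ] {p : ℂ} (hp : ‖p‖ < 1) (hp0 : p ≠ 0)
    {v u : κ → ℂ} (hv : ∀ k, v k ≠ 0) (hinj : Function.Injective u) {r : ℝ} (hr : 0 < r)
    (hpu : ∀ k, ‖p‖ < ‖u k‖ * r) (hu1 : ∀ k, ‖u k‖ * r < 1) :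
    (1 - (∏ k, u k / v k)⁻¹) *
        Real.circleAverage (fun z => ∏ k, theta p (v k * z) / theta p (u k * z)) 0 r =
      ∑ k, theta p (v k / u k) / qPoch p p ^ 3 *
        ∏ l ∈ Finset.univ.erase k, theta p (v l / u k) / theta p (u l / u k) := by
  have hpp := norm_pos_iff.mpr hp0
  have hu (k) : u k ≠ 0 := fun h => by
    have := hpu k
    rw [h, norm_zero, zero_mul] at this
    linarith
  have hun (k) := norm_pos_iff.mpr (hu k)
  set A : Set ℂ := {z | ∀ k, ‖p‖ < ‖u k * z‖ ∧ ‖p * u k * z‖ < 1} with hA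
  obtain ⟨c, hc⟩ : ∃ c, HasLaurentExpansionOn (fun z => ∏ k, thetaRegular p (v k) (u k) z) A c := by
    refine HasLaurentExpansionOn.prod (fun h => ?_) fun k _ => ?_
    · have := (h (Classical.arbitrary κ)).1
      rw [mul_zero, norm_zero] at this
      linarith
    · obtain ⟨c, hc⟩ := exists_expansion_thetaRegular hp (v k) (u k)
      exact ⟨c, hc.mono fun z hz => hz k⟩
  have hfac (z : ℂ) : ∏ k, theta p (v k * z) / theta p (u k * z) =
      (∏ k, thetaRegular p (v k) (u k) z) * ∏ k, (1 - z / (u k)⁻¹)⁻¹ := by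
    rw [← Finset.prod_mul_distrib]
    exact Finset.prod_congr rfl fun k _ => by
      rw [theta_div_theta hp, div_inv_eq_mul, mul_comm z]
  -- The annulus from `r` to `r/|p|` is a fundamental domain for `z ↦ pz`, and contains one
  -- representative `1/u_k` of each orbit of poles.
  have key := circleAverage_sub_circleAverage hc (w := fun k => (u k)⁻¹) (r := r) (R := ‖p⁻¹‖ * r)
    (fun k l h => hinj (inv_injective h)) hr
    (fun k => by
      rw [norm_inv, ← one_div, lt_div_iff₀' (hun k)]; exact hu1 k)
    (fun k => by
      rw [norm_inv, norm_inv, ← one_div, div_lt_iff₀' (hun k), ← mul_assoc, mul_comm ‖u k‖,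
        mul_assoc, ← div_eq_inv_mul, lt_div_iff₀ hpp, one_mul]
      exact hpu k)
    (fun z hz k => by
      rw [mul_assoc, norm_mul p, norm_mul, mem_sphere_zero_iff_norm.mp hz]
      exact ⟨hpu k, mul_lt_one_of_nonneg_of_lt_one_left (norm_nonneg _) hp (hu1 k).le⟩)
    (fun z hz k => by
      have h1 : ‖p * u k * z‖ = ‖u k‖ * r := by
        rw [norm_mul, norm_mul, mem_sphere_zero_iff_norm.mp hz, norm_inv]
        field_simp
      have h2 : ‖u k * z‖ = ‖p‖⁻¹ * (‖u k‖ * r) := by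
        rw [norm_mul, mem_sphere_zero_iff_norm.mp hz, norm_inv]
        ring
      refine ⟨?_, h1 ▸ hu1 k⟩
      rw [h2]
      refine (hpu k).trans_le (le_mul_of_one_le_left ?_ ?_)
      · exact (norm_nonneg _).trans (hpu k).le
      · exact (one_le_inv₀ hpp).mpr hp.le)
    (fun l k => by
      have h1 : ‖u k * (u l)⁻¹‖ = (‖u k‖ * r) / (‖u l‖ * r) := by
        rw [norm_mul, norm_inv]; field_simp
      have h2 := hpu k
      have h3 := hpu l
      have h4 := hu1 k
      have h5 := hu1 l
      have h6 : 0 < ‖u l‖ * r := mul_pos (hun l) hr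
      rw [mul_assoc, norm_mul p, h1]
      refine ⟨?_, ?_⟩
      · rw [lt_div_iff₀ h6]
        exact (mul_lt_of_lt_one_right hpp h5).trans h2
      · rw [← mul_div_assoc, div_lt_one h6]
        exact (mul_lt_of_lt_one_right hpp h4).trans h3)
  simp only [← hfac] at key
  -- The outer circle is the image of the inner one under `z ↦ p⁻¹ z`, so its average is the inner
  -- average times the inverse multiplier.
  have hq : Real.circleAverage (fun z => ∏ k, theta p (v k * z) / theta p (u k * z)) 0 (‖p⁻¹‖ * r) =
      (∏ k, u k / v k)⁻¹ *
        Real.circleAverage (fun z => ∏ k, theta p (v k * z) / theta p (u k * z)) 0 r := by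
    rw [← circleAverage_comp_mul, ← smul_eq_mul, ← Real.circleAverage_fun_smul]
    refine Real.circleAverage_congr_sphere fun z hz => ?_
    have hz0 : z ≠ 0 := fun h => by
      rw [h, abs_of_pos hr] at hz; simp [hr.ne] at hz
    have h := prod_theta_mul_left hp hp0 hv hu (z := p⁻¹ * z)
      (mul_ne_zero (inv_ne_zero hp0) hz0)
    rw [mul_inv_cancel_left₀ hp0] at h
    have hne : ∏ k, u k / v k ≠ 0 := Finset.prod_ne_zero_iff.mpr fun k _ => div_ne_zero (hu k) (hv k)
    rw [h, smul_eq_mul, inv_mul_cancel_left₀ hne]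
  rw [hq] at key
  rw [sub_mul, one_mul, key]
  refine Finset.sum_congr rfl fun k _ => ?_
  rw [← Finset.mul_prod_erase _ _ (Finset.mem_univ k), thetaRegular_inv hp (hu k), mul_left_comm,
    ← Finset.prod_mul_distrib]
  congr 1
  refine Finset.prod_congr rfl fun l _ => ?_
  rw [div_inv_eq_mul, div_eq_mul_inv (v l), div_eq_mul_inv (u l), theta_div_theta hp,
    mul_comm (u k)⁻¹, mul_comm]

end EllipticKernel

namespace EllipticKernel

/-! ### The constant term `C_{MN}` -/

variable {M N : ℕ} {q t p : ℂ} {x : Fin M → ℂ} {y : Fin N → ℂ}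

/-- The inverses of the poles of `thetaRatio` modulo `p`. -/
noncomputable def poleInv (t : ℂ) (x : Fin M → ℂ) (y : Fin N → ℂ) : Fin M ⊕ Fin N → ℂ :=
  Sum.elim x fun j => t⁻¹ * (y j)⁻¹

/-- The inverses of the zeros of `thetaRatio` modulo `p`. -/
noncomputable def zeroInv (t : ℂ) (x : Fin M → ℂ) (y : Fin N → ℂ) : Fin M ⊕ Fin N → ℂ :=
  Sum.elim (fun i => t⁻¹ * x i) fun j => (y j)⁻¹

theorem thetaRatio_eq (t p : ℂ) (x : Fin M → ℂ) (y : Fin N → ℂ) :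
    thetaRatio M N t p x y =
      fun z => ∏ k, theta p (zeroInv t x y k * z) / theta p (poleInv t x y k * z) := by
  ext z
  simp only [thetaRatio, Fintype.prod_sum_type, zeroInv, poleInv, Sum.elim_inl, Sum.elim_inr]
  congr 1
  refine Finset.prod_congr rfl fun j _ => ?_
  congr 2 <;> ring

theorem expansionDomain_eq (t p : ℂ) (x : Fin M → ℂ) (y : Fin N → ℂ) :
    expansionDomain M N t p x y =
      {z | ∀ k, ‖p‖ < ‖poleInv t x y k * z‖ ∧ ‖poleInv t x y k * z‖ < 1} := by
  ext z
  simp only [expansionDomain, Set.mem_ofPred_eq, Sum.forall, poleInv, Sum.elim_inl, Sum.elim_inr]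
  have h (j) : t⁻¹ * z / y j = t⁻¹ * (y j)⁻¹ * z := by ring
  simp only [h]

theorem poleInv_ne_zero (ht : t ≠ 0) (hx : ∀ i, x i ≠ 0) (hy : ∀ j, y j ≠ 0) (k) :
    poleInv t x y k ≠ 0 := by
  rcases k with i | j
  · exact hx i
  · exact mul_ne_zero (inv_ne_zero ht) (inv_ne_zero (hy j))

theorem zeroInv_ne_zero (ht : t ≠ 0) (hx : ∀ i, x i ≠ 0) (hy : ∀ j, y j ≠ 0) (k) :
    zeroInv t x y k ≠ 0 := by
  rcases k with i | j
  · exact mul_ne_zero (inv_ne_zero ht) (hx i)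
  · exact inv_ne_zero (hy j)

theorem poleInv_injective (ht : t ≠ 0) (hy : ∀ j, y j ≠ 0)
    (hxi : Function.Injective x) (hyi : Function.Injective y)
    (hxy : ∀ i j, t * x i * y j ≠ 1) : Function.Injective (poleInv t x y) := by
  have h (i j) : x i ≠ t⁻¹ * (y j)⁻¹ := fun h => by
    apply hxy i j
    have := hy j
    rw [h]; field_simp
  rintro (i | j) (i' | j') hk <;> simp only [poleInv, Sum.elim_inl, Sum.elim_inr] at hk
  · rw [hxi hk]
  · exact absurd hk (h i j')
  · exact absurd hk.symm (h i' j)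
  · rw [hyi (inv_injective (mul_left_cancel₀ (inv_ne_zero ht) hk))]

theorem exists_expansion_thetaRatio (hM : 0 < M) (hp : ‖p‖ < 1) (ht : t ≠ 0) (hx : ∀ i, x i ≠ 0)
    (hy : ∀ j, y j ≠ 0) :
    ∃ a, HasLaurentExpansionOn (thetaRatio M N t p x y) (expansionDomain M N t p x y) a := by
  have : Nonempty (Fin M ⊕ Fin N) := ⟨Sum.inl ⟨0, hM⟩⟩
  rw [thetaRatio_eq, expansionDomain_eq]
  exact exists_expansion_prod_theta hp _ (poleInv_ne_zero ht hx hy)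

theorem sphere_subset_expansionDomain {r : ℝ}
    (h : ∀ k, ‖p‖ < ‖poleInv t x y k‖ * r ∧ ‖poleInv t x y k‖ * r < 1) :
    Metric.sphere 0 r ⊆ expansionDomain M N t p x y := fun z hz => by
  rw [expansionDomain_eq]
  intro k
  rw [norm_mul, mem_sphere_zero_iff_norm.mp hz]
  exact h k

theorem ellC_eq_circleAverage (hM : 0 < M) (hp : ‖p‖ < 1) (ht : t ≠ 0) (hx : ∀ i, x i ≠ 0)
    (hy : ∀ j, y j ≠ 0) {r : ℝ} (hr : 0 < r)
    (h : ∀ k, ‖p‖ < ‖poleInv t x y k‖ * r ∧ ‖poleInv t x y k‖ * r < 1) :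
    ellC M N t p x y = Real.circleAverage (thetaRatio M N t p x y) 0 r :=
  constantTerm_eq hr (sphere_subset_expansionDomain h) (exists_expansion_thetaRatio hM hp ht hx hy)

/-- The domain is described by `|z|` alone, so any point of it supplies a radius; one variable `x_i`
is enough to exclude `z = 0`. -/
theorem exists_radius (hM : 0 < M) (hne : (expansionDomain M N t p x y).Nonempty) :
    ∃ r : ℝ, 0 < r ∧ ∀ k, ‖p‖ < ‖poleInv t x y k‖ * r ∧ ‖poleInv t x y k‖ * r < 1 := by
  obtain ⟨z, hz⟩ := hne
  rw [expansionDomain_eq] at hz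
  refine ⟨‖z‖, ?_, fun k => ?_⟩
  · refine norm_pos_iff.mpr fun h => ?_
    have := (hz (Sum.inl ⟨0, hM⟩)).1
    rw [h, mul_zero, norm_zero] at this
    exact absurd this (norm_nonneg p).not_gt
  · rw [← norm_mul]; exact hz k

/-! ### The functional equation -/

theorem ellKernel_swap (M N : ℕ) (q t p : ℂ) (x : Fin M → ℂ) (y : Fin N → ℂ) :
    ellKernel M N q t p x y = ellKernel N M q t p y x := by
  rw [ellKernel, Finset.prod_comm, ellKernel]
  refine Finset.prod_congr rfl fun j _ => Finset.prod_congr rfl fun i _ => ?_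
  rw [mul_comm (x i), mul_assoc, mul_comm (x i), ← mul_assoc]

theorem ellGamma_div_mul_left {s : ℂ} (hq0 : q ≠ 0) (hq : ‖q‖ < 1) (hp : ‖p‖ < 1)
    (hs : qPoch p s ≠ 0) (hts : theta p (t * s) ≠ 0) :
    ellGamma q p (q * s) / ellGamma q p (t * (q * s)) =
      ellGamma q p s / ellGamma q p (t * s) * (theta p s / theta p (t * s)) := by
  have h0 := qPoch_self_ne_zero hp
  have h1 := ellGamma_mul_left hq0 hq hp hs
  have h2 := ellGamma_inv_eq (x := t * s) hq0 hq hp (right_ne_zero_of_mul hts)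
  rw [mul_left_comm t q s, h1, div_eq_mul_inv, div_eq_mul_inv (ellGamma q p s), h2]
  field_simp

/-- Only row `i` of the product changes, and each entry there picks up a theta quotient from the
`q`-difference equation of `Γ`. -/
theorem qShift_ellKernel (hq0 : q ≠ 0) (hq : ‖q‖ < 1) (hp : ‖p‖ < 1) (i : Fin M)
    (hs : ∀ j, qPoch p (x i * y j) ≠ 0) (hts : ∀ j, theta p (t * x i * y j) ≠ 0) :
    qShift q i (fun x' => ellKernel M N q t p x' y) x =
      ellKernel M N q t p x y * ∏ j, theta p (x i * y j) / theta p (t * x i * y j) := by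
  rw [qShift, ellKernel, ellKernel, ← Finset.mul_prod_erase _ _ (Finset.mem_univ i),
    ← Finset.mul_prod_erase _ _ (Finset.mem_univ i), mul_right_comm, ← Finset.prod_mul_distrib]
  congr 1
  · refine Finset.prod_congr rfl fun j _ => ?_
    have := ellGamma_div_mul_left hq0 hq hp (hs j) (by simpa only [mul_assoc] using hts j)
    simpa only [Function.update_self, mul_assoc] using this
  · refine Finset.prod_congr rfl fun i' hi' => ?_
    rw [Function.update_of_ne (Finset.ne_of_mem_erase hi')]

theorem theta_div_theta_inv (hp : ‖p‖ < 1) (ht : t ≠ 0) {s : ℂ} (hs : s ≠ 0) :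
    theta p (t * s)⁻¹ / theta p s⁻¹ = t⁻¹ * (theta p (t * s) / theta p s) := by
  rw [theta_inv hp hs, theta_inv hp (mul_ne_zero ht hs)]
  simp only [div_eq_mul_inv, mul_inv, neg_mul, neg_inv.symm, inv_inv, mul_neg, neg_neg]
  field_simp

theorem theta_div_theta_inv' (hp : ‖p‖ < 1) (ht : t ≠ 0) {s : ℂ} (hs : s ≠ 0) :
    theta p s⁻¹ / theta p (t * s)⁻¹ = t * (theta p s / theta p (t * s)) := by
  rw [← inv_div, theta_div_theta_inv hp ht hs, mul_inv, inv_inv, inv_div]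

theorem univ_erase_inl (i : Fin M) : (Finset.univ : Finset (Fin M ⊕ Fin N)).erase (Sum.inl i) =
    (Finset.univ.erase i).disjSum Finset.univ := by
  ext k; rcases k with k | k <;> simp

theorem univ_erase_inr (j : Fin N) : (Finset.univ : Finset (Fin M ⊕ Fin N)).erase (Sum.inr j) =
    Finset.univ.disjSum (Finset.univ.erase j) := by
  ext k; rcases k with k | k <;> simp

theorem prod_poleInv_div_zeroInv (ht : t ≠ 0) (hx : ∀ i, x i ≠ 0) (hy : ∀ j, y j ≠ 0) :
    ∏ k, poleInv t x y k / zeroInv t x y k = t ^ ((M : ℤ) - (N : ℤ)) := by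
  simp only [Fintype.prod_sum_type, zeroInv, poleInv, Sum.elim_inl, Sum.elim_inr]
  have h1 (i) : x i / (t⁻¹ * x i) = t := by have := hx i; field_simp
  have h2 (j) : t⁻¹ * (y j)⁻¹ / (y j)⁻¹ = t⁻¹ := by have := hy j; field_simp
  simp only [h1, h2, Finset.prod_const, Finset.card_univ, Fintype.card_fin]
  rw [zpow_sub₀ ht, zpow_natCast, zpow_natCast, inv_pow, div_eq_mul_inv]

/-- Inverting the theta arguments produces the prefactor: `-t⁻¹` from `Θ(t⁻¹)`, `t⁻¹` from each of
the `M - 1` other `x`'s, and `t` from each of the `N` values `y_j`. -/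
theorem residue_inl (hp : ‖p‖ < 1) (ht : t ≠ 0) (hx : ∀ i, x i ≠ 0) (hy : ∀ j, y j ≠ 0)
    (i : Fin M) :
    theta p (zeroInv t x y (Sum.inl i) / poleInv t x y (Sum.inl i)) / qPoch p p ^ 3 *
        ∏ l ∈ Finset.univ.erase (Sum.inl i), theta p (zeroInv t x y l / poleInv t x y (Sum.inl i)) /
          theta p (poleInv t x y l / poleInv t x y (Sum.inl i)) =
      -(t ^ ((M : ℤ) - (N : ℤ)))⁻¹ * (theta p t / qPoch p p ^ 3) *
        ((∏ j ∈ Finset.univ.erase i, theta p (t * x i / x j) / theta p (x i / x j)) *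
          ∏ j, theta p (x i * y j) / theta p (t * x i * y j)) := by
  have hi := hx i
  rw [univ_erase_inl, Finset.prod_disjSum]
  simp only [zeroInv, poleInv, Sum.elim_inl, Sum.elim_inr]
  have h1 : t⁻¹ * x i / x i = t⁻¹ := by field_simp
  have h2 (i') : theta p (t⁻¹ * x i' / x i) / theta p (x i' / x i) =
      t⁻¹ * (theta p (t * x i / x i') / theta p (x i / x i')) := by
    have := theta_div_theta_inv (p := p) hp ht (div_ne_zero hi (hx i'))
    rw [mul_div_assoc t, ← this]
    congr 2
    · rw [mul_inv, inv_div, mul_div_assoc]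
    · rw [inv_div]
  have h3 (j) : theta p ((y j)⁻¹ / x i) / theta p (t⁻¹ * (y j)⁻¹ / x i) =
      t * (theta p (x i * y j) / theta p (t * x i * y j)) := by
    have := theta_div_theta_inv' (p := p) hp ht (mul_ne_zero hi (hy j))
    rw [mul_assoc t, ← this]
    congr 2
    · rw [mul_inv, div_eq_mul_inv, mul_comm]
    · rw [mul_inv, mul_inv, div_eq_mul_inv, mul_assoc, mul_comm (y j)⁻¹]
  simp only [h1, h2, h3, Finset.prod_mul_distrib, Finset.prod_const, Finset.card_univ,
    Fintype.card_fin, Finset.card_erase_of_mem (Finset.mem_univ i), theta_inv hp ht]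
  rw [zpow_sub₀ ht, zpow_natCast, zpow_natCast, inv_div]
  have hM : t ^ M = t * t ^ (M - 1) := by
    rw [← pow_succ', Nat.sub_add_cancel i.pos]
  rw [hM, inv_pow]
  field_simp

/-- At the pole `z = t y_j` the arguments already have the required form, so no inversion and no
power of `t` occurs. -/
theorem residue_inr (ht : t ≠ 0) (hy : ∀ j, y j ≠ 0) (j : Fin N) :
    theta p (zeroInv t x y (Sum.inr j) / poleInv t x y (Sum.inr j)) / qPoch p p ^ 3 *
        ∏ l ∈ Finset.univ.erase (Sum.inr j), theta p (zeroInv t x y l / poleInv t x y (Sum.inr j)) /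
          theta p (poleInv t x y l / poleInv t x y (Sum.inr j)) =
      theta p t / qPoch p p ^ 3 *
        ((∏ i ∈ Finset.univ.erase j, theta p (t * y j / y i) / theta p (y j / y i)) *
          ∏ i, theta p (y j * x i) / theta p (t * y j * x i)) := by
  have hj := hy j
  rw [univ_erase_inr, Finset.prod_disjSum, mul_comm (∏ i ∈ Finset.univ.erase j, _)]
  simp only [zeroInv, poleInv, Sum.elim_inl, Sum.elim_inr]
  congr 1
  · congr 2; field_simp
  congr 1
  · refine Finset.prod_congr rfl fun i _ => ?_
    congr 2 <;> field_simp
  · refine Finset.prod_congr rfl fun i _ => ?_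
    have := hy i
    congr 2 <;> field_simp

/-- In the open annulus `|p| < |s| < 1/|p|` the only possible power of `p` is `p ^ 0`. -/
theorem ne_zpow_of_norm {s : ℂ} (hp : ‖p‖ < 1) (hps : ‖p‖ < ‖s‖) (hps' : ‖p‖ * ‖s‖ < 1)
    (hs : s ≠ 1) (k : ℤ) : s ≠ p ^ k := by
  rintro rfl
  rcases lt_trichotomy k 0 with hk | rfl | hk
  · obtain ⟨n, rfl⟩ : ∃ n : ℕ, k = -((n : ℤ) + 1) := ⟨(-k - 1).toNat, by omega⟩
    have hp0 : p ≠ 0 := by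
      rintro rfl
      rw [zero_zpow _ (by omega)] at hps
      exact lt_irrefl _ hps
    have hpp := norm_pos_iff.mpr hp0
    rw [norm_zpow, zpow_neg, zpow_add_one₀ hpp.ne', zpow_natCast, mul_inv, mul_left_comm,
      mul_inv_cancel₀ hpp.ne', mul_one] at hps'
    exact absurd hps' (not_lt.mpr ((one_le_inv₀ (by positivity)).mpr
      (pow_le_one₀ hpp.le hp.le)))
  · exact hs (zpow_zero p)
  · obtain ⟨n, rfl⟩ : ∃ n : ℕ, k = (n : ℤ) + 1 := ⟨(k - 1).toNat, by omega⟩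
    have : ((n : ℤ) + 1) = ((n + 1 : ℕ) : ℤ) := by simp
    rw [this, zpow_natCast, norm_pow, pow_succ] at hps
    exact absurd hps (not_lt.mpr (mul_le_of_le_one_left (norm_nonneg _)
      (pow_le_one₀ (norm_nonneg _) hp.le)))

/-- `t x_i y_j` is the ratio of two entries of `poleInv`; scaled by `r`, their norms lie in `(|p|,
1)`. So the nonempty annulus forces `Θ(t x_i y_j) ≠ 0` as soon as `t x_i y_j ≠ 1`. -/
theorem norm_mul_mul_bounds (ht : t ≠ 0) (hy : ∀ j, y j ≠ 0) {r : ℝ}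
    (hr : 0 < r) (h : ∀ k, ‖p‖ < ‖poleInv t x y k‖ * r ∧ ‖poleInv t x y k‖ * r < 1) (i j) :
    ‖p‖ < ‖t * x i * y j‖ ∧ ‖p‖ * ‖t * x i * y j‖ < 1 := by
  have h1 := h (Sum.inl i)
  have h2 := h (Sum.inr j)
  simp only [poleInv, Sum.elim_inl, Sum.elim_inr] at h1 h2
  have h3 : ‖t * x i * y j‖ = ‖x i‖ * r / (‖t⁻¹ * (y j)⁻¹‖ * r) := by
    have := norm_pos_iff.mpr ht
    have := norm_pos_iff.mpr (hy j)
    simp only [norm_mul, norm_inv]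
    field_simp
  have h4 : 0 < ‖t⁻¹ * (y j)⁻¹‖ * r := (norm_nonneg _).trans_lt h2.1
  rw [h3, lt_div_iff₀ h4, ← mul_div_assoc, div_lt_one h4]
  exact ⟨(mul_le_of_le_one_right (norm_nonneg _) h2.2.le).trans_lt h1.1,
    (mul_le_of_le_one_right (norm_nonneg _) h1.2.le).trans_lt h2.1⟩

theorem mul_sub_eq_of_residue {l C T P S₁ S₂ K : ℂ} (hl : l ≠ 0) (hP : P ≠ 0) (hT : T ≠ 0)
    (h : (1 - l⁻¹) * C = -l⁻¹ * (T / P ^ 3) * S₁ + T / P ^ 3 * S₂) :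
    K * S₁ - l * (K * S₂) = (1 - l) * P ^ 3 / T * C * K := by
  have h1 : (1 - l) * C = T / P ^ 3 * (S₁ - l * S₂) := by
    have h2 : (1 - l) * C = -l * ((1 - l⁻¹) * C) := by field_simp; ring
    rw [h2, h]
    field_simp
    ring
  have h3 : (1 - l) * P ^ 3 / T * C * K = P ^ 3 / T * ((1 - l) * C) * K := by ring
  rw [h3, h1]
  field_simp

/-- The direct residue proof. The condition `t x_i y_j ≠ 1` keeps the poles `1/x_i` and `t y_j`
apart, and `p ≠ 0` is needed for quasi-periodicity. -/
theorem functional_equation_of_generic (hM : 0 < M) (hq0 : q ≠ 0) (hq : ‖q‖ < 1) (ht : t ≠ 0)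
    (hp : ‖p‖ < 1) (hp0 : p ≠ 0) (htp : ∀ k : ℤ, t ≠ p ^ k) (hx : ∀ i, x i ≠ 0)
    (hy : ∀ j, y j ≠ 0) (hxi : Function.Injective x) (hyi : Function.Injective y)
    (hxy : ∀ i j, qPoch p (x i * y j) ≠ 0) (htxy : ∀ i j, t * x i * y j ≠ 1)
    (hne : (expansionDomain M N t p x y).Nonempty) :
    ellMacdonald M q t p (fun x' => ellKernel M N q t p x' y) x -
        t ^ ((M : ℤ) - (N : ℤ)) * ellMacdonald N q t p (fun y' => ellKernel M N q t p x y') y =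
      (1 - t ^ ((M : ℤ) - (N : ℤ))) * qPoch p p ^ 3 / theta p t *
        ellC M N t p x y * ellKernel M N q t p x y := by
  have : Nonempty (Fin M ⊕ Fin N) := ⟨Sum.inl ⟨0, hM⟩⟩
  obtain ⟨r, hr, hrk⟩ := exists_radius hM hne
  have hth (i j) : theta p (t * x i * y j) ≠ 0 := by
    have h := norm_mul_mul_bounds ht hy hr hrk i j
    exact theta_ne_zero hp (mul_ne_zero (mul_ne_zero ht (hx i)) (hy j))
      (ne_zpow_of_norm hp h.1 h.2 (htxy i j))
  have h1 := circleAverage_prod_theta hp hp0 (zeroInv_ne_zero ht hx hy)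
    (poleInv_injective ht hy hxi hyi htxy) hr (fun k => (hrk k).1) (fun k => (hrk k).2)
  rw [← thetaRatio_eq, ← ellC_eq_circleAverage hM hp ht hx hy hr hrk, Fintype.sum_sum_type,
    prod_poleInv_div_zeroInv ht hx hy] at h1
  simp only [residue_inl hp ht hx hy, residue_inr ht hy] at h1
  rw [← Finset.mul_sum, ← Finset.mul_sum] at h1
  have h2 : ellMacdonald M q t p (fun x' => ellKernel M N q t p x' y) x =
      ellKernel M N q t p x y *
        ∑ i, (∏ j ∈ Finset.univ.erase i, theta p (t * x i / x j) / theta p (x i / x j)) *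
          ∏ j, theta p (x i * y j) / theta p (t * x i * y j) := by
    rw [ellMacdonald, Finset.mul_sum]
    refine Finset.sum_congr rfl fun i _ => ?_
    rw [qShift_ellKernel hq0 hq hp i (hxy i) (hth i)]
    ring
  have h3 : ellMacdonald N q t p (fun y' => ellKernel M N q t p x y') y =
      ellKernel M N q t p x y *
        ∑ j, (∏ i ∈ Finset.univ.erase j, theta p (t * y j / y i) / theta p (y j / y i)) *
          ∏ i, theta p (y j * x i) / theta p (t * y j * x i) := by
    simp only [ellKernel_swap M N]
    rw [ellMacdonald, Finset.mul_sum]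
    refine Finset.sum_congr rfl fun j _ => ?_
    rw [qShift_ellKernel hq0 hq hp j (fun i => by rw [mul_comm]; exact hxy i j)
      (fun i => by rw [mul_assoc, mul_comm (y j), ← mul_assoc]; exact hth i j)]
    ring
  rw [h2, h3]
  exact mul_sub_eq_of_residue (zpow_ne_zero _ ht) (qPoch_self_ne_zero hp)
    (theta_ne_zero hp ht htp) h1

end EllipticKernel

namespace EllipticKernel

/-! ### Continuity in the parameters -/

/-- Convergence jointly in the parameter and `z`, at each point of the circle, yields by compactness
a uniform bound near the limit; dominated convergence then applies. -/
theorem tendsto_circleAverage {ι : Type*} {l : Filter ι} [l.IsCountablyGenerated] {Φ : ι → ℂ → ℂ}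
    {Φ₀ : ℂ → ℂ} {r : ℝ} (hr : 0 < r) (hΦ : ∀ᶠ s in l, ContinuousOn (Φ s) (Metric.sphere 0 r))
    (hΦ₀ : ContinuousOn Φ₀ (Metric.sphere 0 r))
    (hlim : ∀ z ∈ Metric.sphere (0 : ℂ) r,
      Tendsto (fun k : ι × ℂ => Φ k.1 k.2) (l ×ˢ 𝓝 z) (𝓝 (Φ₀ z))) :
    Tendsto (fun s => Real.circleAverage (Φ s) 0 r) l (𝓝 (Real.circleAverage Φ₀ 0 r)) := by
  obtain ⟨B, hB⟩ := (isCompact_sphere (0 : ℂ) r).exists_bound_of_continuousOn hΦ₀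
  have hmem (θ : ℝ) : circleMap 0 r θ ∈ Metric.sphere (0 : ℂ) r := circleMap_mem_sphere 0 hr.le θ
  have hbd : ∀ᶠ s in l, ∀ z ∈ Metric.sphere (0 : ℂ) r, ‖Φ s z‖ ≤ B + 1 := by
    have h1 : {k : ι × ℂ | ‖Φ k.1 k.2‖ ≤ B + 1} ∈ l ×ˢ 𝓝ˢ (Metric.sphere (0 : ℂ) r) := by
      refine (isCompact_sphere (0 : ℂ) r).mem_prod_nhdsSet_of_forall fun z hz => ?_
      filter_upwards [(hlim z hz).norm.eventually (gt_mem_nhds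
        ((hB z hz).trans_lt (lt_add_one B)))] with k hk using hk.le
    obtain ⟨t₁, ht₁, t₂, ht₂, h⟩ := mem_prod_iff.mp h1
    filter_upwards [ht₁] with s hs z hz
    exact h (Set.mk_mem_prod hs (subset_of_mem_nhdsSet ht₂ hz))
  simp only [Real.circleAverage_def]
  refine Tendsto.const_smul ?_ _
  refine intervalIntegral.tendsto_integral_filter_of_dominated_convergence (fun _ => B + 1)
    ?_ ?_ (by simp) ?_
  · filter_upwards [hΦ] with s hs
    exact (hs.comp_continuous (continuous_circleMap 0 r) hmem).aestronglyMeasurable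
  · filter_upwards [hbd] with s hs
    exact Eventually.of_forall fun θ _ => hs _ (hmem θ)
  · refine Eventually.of_forall fun θ _ => ?_
    exact (hlim _ (hmem θ)).comp (tendsto_id.prodMk tendsto_const_nhds)

variable {κ : Type*} [Fintype κ] {ι : Type*} {l : Filter ι}

theorem tendsto_prod_theta {p : ι → ℂ} {u v : ι → κ → ℂ} {z : ι → ℂ}
    {p₀ : ℂ} {u₀ v₀ : κ → ℂ} {z₀ : ℂ} (hp₀ : ‖p₀‖ < 1) (hv₀ : ∀ k, v₀ k ≠ 0) (hz₀ : z₀ ≠ 0)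
    (hdom : ∀ k, ‖p₀‖ < ‖u₀ k * z₀‖ ∧ ‖u₀ k * z₀‖ < 1)
    (hp : Tendsto p l (𝓝 p₀)) (hu : ∀ k, Tendsto (fun s => u s k) l (𝓝 (u₀ k)))
    (hv : ∀ k, Tendsto (fun s => v s k) l (𝓝 (v₀ k))) (hz : Tendsto z l (𝓝 z₀)) :
    Tendsto (fun s => ∏ k, theta (p s) (v s k * z s) / theta (p s) (u s k * z s)) l
      (𝓝 (∏ k, theta p₀ (v₀ k * z₀) / theta p₀ (u₀ k * z₀))) := by
  refine tendsto_finsetProd _ fun k _ => ?_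
  have h := hdom k
  have hne : u₀ k * z₀ ≠ 0 := norm_pos_iff.mp ((norm_nonneg _).trans_lt h.1)
  refine (tendsto_theta hp₀ (mul_ne_zero (hv₀ k) hz₀) hp ((hv k).mul hz)).div
    (tendsto_theta hp₀ hne hp ((hu k).mul hz)) (theta_ne_zero hp₀ hne ?_)
  refine ne_zpow_of_norm hp₀ h.1 ?_ fun h1 => ?_
  · exact (mul_le_of_le_one_right (norm_nonneg _) h.2.le).trans_lt hp₀
  · rw [h1, norm_one] at h; exact lt_irrefl _ h.2

theorem continuousOn_prod_theta {p : ℂ} {u v : κ → ℂ} (hp : ‖p‖ < 1) (hv : ∀ k, v k ≠ 0) {r : ℝ}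
    (hr : 0 < r) (hdom : ∀ k, ‖p‖ < ‖u k‖ * r ∧ ‖u k‖ * r < 1) :
    ContinuousOn (fun z => ∏ k, theta p (v k * z) / theta p (u k * z)) (Metric.sphere 0 r) := by
  intro z hz
  have hz' := mem_sphere_zero_iff_norm.mp hz
  have hz0 : z ≠ 0 := norm_pos_iff.mp (hz' ▸ hr)
  refine (tendsto_prod_theta (l := 𝓝 z) (p := fun _ => p) (u := fun _ => u) (v := fun _ => v)
    (z := fun z => z) hp hv hz0 (fun k => ?_) tendsto_const_nhds (fun k => tendsto_const_nhds)
    (fun k => tendsto_const_nhds) tendsto_id).mono_left nhdsWithin_le_nhds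
  rw [norm_mul, hz']
  exact hdom k

theorem eventually_norm_bounds {p : ι → ℂ} {u : ι → κ → ℂ} {p₀ : ℂ} {u₀ : κ → ℂ} {r : ℝ}
    (hdom : ∀ k, ‖p₀‖ < ‖u₀ k‖ * r ∧ ‖u₀ k‖ * r < 1)
    (hp : Tendsto p l (𝓝 p₀)) (hu : ∀ k, Tendsto (fun s => u s k) l (𝓝 (u₀ k))) :
    ∀ᶠ s in l, ∀ k, ‖p s‖ < ‖u s k‖ * r ∧ ‖u s k‖ * r < 1 :=
  eventually_all.mpr fun k =>
    (hp.norm.eventually_lt ((hu k).norm.mul_const r) (hdom k).1).and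
      (((hu k).norm.mul_const r).eventually (gt_mem_nhds (hdom k).2))

variable {M N : ℕ} {q t : ℂ} {p : ι → ℂ} {x : ι → Fin M → ℂ} {y : ι → Fin N → ℂ}
  {p₀ : ℂ} {x₀ : Fin M → ℂ} {y₀ : Fin N → ℂ}

theorem tendsto_poleInv (hy₀ : ∀ j, y₀ j ≠ 0) (hx : ∀ i, Tendsto (fun s => x s i) l (𝓝 (x₀ i)))
    (hy : ∀ j, Tendsto (fun s => y s j) l (𝓝 (y₀ j))) (k) :
    Tendsto (fun s => poleInv t (x s) (y s) k) l (𝓝 (poleInv t x₀ y₀ k)) := by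
  rcases k with i | j
  · exact hx i
  · exact ((hy j).inv₀ (hy₀ j)).const_mul _

theorem tendsto_zeroInv (hy₀ : ∀ j, y₀ j ≠ 0) (hx : ∀ i, Tendsto (fun s => x s i) l (𝓝 (x₀ i)))
    (hy : ∀ j, Tendsto (fun s => y s j) l (𝓝 (y₀ j))) (k) :
    Tendsto (fun s => zeroInv t (x s) (y s) k) l (𝓝 (zeroInv t x₀ y₀ k)) := by
  rcases k with i | j
  · exact (hx i).const_mul _
  · exact (hy j).inv₀ (hy₀ j)

theorem tendsto_ellC [l.IsCountablyGenerated] (hM : 0 < M) (ht : t ≠ 0) (hp₀ : ‖p₀‖ < 1)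
    (hx₀ : ∀ i, x₀ i ≠ 0) (hy₀ : ∀ j, y₀ j ≠ 0) {r : ℝ} (hr : 0 < r)
    (hdom : ∀ k, ‖p₀‖ < ‖poleInv t x₀ y₀ k‖ * r ∧ ‖poleInv t x₀ y₀ k‖ * r < 1)
    (hp : Tendsto p l (𝓝 p₀)) (hx : ∀ i, Tendsto (fun s => x s i) l (𝓝 (x₀ i)))
    (hy : ∀ j, Tendsto (fun s => y s j) l (𝓝 (y₀ j))) :
    Tendsto (fun s => ellC M N t (p s) (x s) (y s)) l (𝓝 (ellC M N t p₀ x₀ y₀)) := by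
  have hu := tendsto_poleInv (t := t) hy₀ hx hy
  have hv := tendsto_zeroInv (t := t) hy₀ hx hy
  have hev := eventually_norm_bounds hdom hp hu
  have hev1 : ∀ᶠ s in l, ‖p s‖ < 1 := hp.norm.eventually (gt_mem_nhds hp₀)
  have hevx : ∀ᶠ s in l, ∀ i, x s i ≠ 0 := eventually_all.mpr fun i => (hx i).eventually_ne (hx₀ i)
  have hevy : ∀ᶠ s in l, ∀ j, y s j ≠ 0 := eventually_all.mpr fun j => (hy j).eventually_ne (hy₀ j)
  rw [ellC_eq_circleAverage hM hp₀ ht hx₀ hy₀ hr hdom]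
  have h1 : Tendsto (fun s => Real.circleAverage (thetaRatio M N t (p s) (x s) (y s)) 0 r) l
      (𝓝 (Real.circleAverage (thetaRatio M N t p₀ x₀ y₀) 0 r)) := by
    refine tendsto_circleAverage hr ?_ ?_ fun z hz => ?_
    · filter_upwards [hev, hev1, hevx, hevy] with s h1 h2 h3 h4
      rw [thetaRatio_eq]
      exact continuousOn_prod_theta h2 (zeroInv_ne_zero ht h3 h4) hr h1
    · rw [thetaRatio_eq]
      exact continuousOn_prod_theta hp₀ (zeroInv_ne_zero ht hx₀ hy₀) hr hdom
    · have hz' := mem_sphere_zero_iff_norm.mp hz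
      simp only [thetaRatio_eq]
      refine tendsto_prod_theta hp₀ (zeroInv_ne_zero ht hx₀ hy₀) (norm_pos_iff.mp (hz' ▸ hr))
        (fun k => ?_) (hp.comp tendsto_fst) (fun k => (hu k).comp tendsto_fst)
        (fun k => (hv k).comp tendsto_fst) tendsto_snd
      rw [norm_mul, hz']
      exact hdom k
  refine h1.congr' ?_
  filter_upwards [hev, hev1, hevx, hevy] with s h1 h2 h3 h4
  exact (ellC_eq_circleAverage hM h2 ht h3 h4 hr h1).symm

/-- The denominators `Γ(t x_i y_j)` enter through their reciprocals, so their poles do no harm and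
only their zeros have to be avoided; `|q p₀| < |t x_i y_j|` suffices. -/
theorem tendsto_ellKernel (hq : ‖q‖ < 1) (ht : t ≠ 0) (hp₀ : ‖p₀‖ < 1) (hx₀ : ∀ i, x₀ i ≠ 0)
    (hy₀ : ∀ j, y₀ j ≠ 0) (hxy : ∀ i j, qpPoch q p₀ (x₀ i * y₀ j) ≠ 0)
    (htxy : ∀ i j, ‖q * p₀‖ < ‖t * x₀ i * y₀ j‖)
    (hp : Tendsto p l (𝓝 p₀)) (hx : ∀ i, Tendsto (fun s => x s i) l (𝓝 (x₀ i)))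
    (hy : ∀ j, Tendsto (fun s => y s j) l (𝓝 (y₀ j))) :
    Tendsto (fun s => ellKernel M N q t (p s) (x s) (y s)) l (𝓝 (ellKernel M N q t p₀ x₀ y₀)) := by
  unfold ellKernel
  simp only [div_eq_mul_inv]
  refine tendsto_finsetProd _ fun i _ => tendsto_finsetProd _ fun j _ => ?_
  have hne := mul_ne_zero (mul_ne_zero ht (hx₀ i)) (hy₀ j)
  refine (tendsto_ellGamma hq hp₀ (mul_ne_zero (hx₀ i) (hy₀ j)) (hxy i j) hp
    ((hx i).mul (hy j))).mul (tendsto_ellGamma_inv hq hp₀ hne ?_ hp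
      (((hx i).const_mul t).mul (hy j)))
  refine qpPoch_ne_zero_of_norm_lt hq hp₀ ?_
  rw [norm_mul, norm_inv, ← div_eq_mul_inv, div_lt_one (norm_pos_iff.mpr hne)]
  exact htxy i j

theorem tendsto_ellMacdonald (hq0 : q ≠ 0) (hq : ‖q‖ < 1) (ht : t ≠ 0) (hp₀ : ‖p₀‖ < 1)
    (hx₀ : ∀ i, x₀ i ≠ 0) (hy₀ : ∀ j, y₀ j ≠ 0) (hxy : ∀ i j, qpPoch q p₀ (x₀ i * y₀ j) ≠ 0)
    (htxy : ∀ i j, ‖p₀‖ < ‖t * x₀ i * y₀ j‖)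
    (hth : ∀ i j, j ≠ i → theta p₀ (x₀ i / x₀ j) ≠ 0)
    (hp : Tendsto p l (𝓝 p₀)) (hx : ∀ i, Tendsto (fun s => x s i) l (𝓝 (x₀ i)))
    (hy : ∀ j, Tendsto (fun s => y s j) l (𝓝 (y₀ j))) :
    Tendsto (fun s => ellMacdonald M q t (p s) (fun x' => ellKernel M N q t (p s) x' (y s)) (x s)) l
      (𝓝 (ellMacdonald M q t p₀ (fun x' => ellKernel M N q t p₀ x' y₀) x₀)) := by
  unfold ellMacdonald
  refine tendsto_finsetSum _ fun i _ => (tendsto_finsetProd _ fun j hj => ?_).mul ?_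
  · exact (tendsto_theta hp₀ (div_ne_zero (mul_ne_zero ht (hx₀ i)) (hx₀ j)) hp
      (((hx i).const_mul t).div (hx j) (hx₀ j))).div (tendsto_theta hp₀
        (div_ne_zero (hx₀ i) (hx₀ j)) hp ((hx i).div (hx j) (hx₀ j)))
        (hth i j (Finset.ne_of_mem_erase hj))
  · unfold qShift
    have hqp : ‖q * p₀‖ ≤ ‖p₀‖ := by
      rw [norm_mul]; exact mul_le_of_le_one_left (norm_nonneg _) hq.le
    refine tendsto_ellKernel hq ht hp₀ (fun i' => ?_) hy₀ (fun i' j => ?_) (fun i' j => ?_) hp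
      (fun i' => ?_) hy
    all_goals rcases eq_or_ne i' i with rfl | hi
    all_goals first | simp only [Function.update_of_ne hi] | simp only [Function.update_self]
    · exact mul_ne_zero hq0 (hx₀ _)
    · exact hx₀ i'
    · have := hxy i' j
      rw [qpPoch_eq_mul_qpPoch hq hp₀] at this
      rw [mul_assoc]
      exact right_ne_zero_of_mul this
    · exact hxy i' j
    -- The shift shrinks `t x y` by `|q|`, which is why `|p₀| < |t x y|` is assumed here while the
    -- kernel itself needs only `|q p₀| < |t x y|`.
    · have : t * (q * x₀ i') * y₀ j = q * (t * x₀ i' * y₀ j) := by ring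
      rw [this, norm_mul, norm_mul q]
      exact mul_lt_mul_of_pos_left (htxy i' j) (norm_pos_iff.mpr hq0)
    · exact hqp.trans_lt (htxy i' j)
    · exact (hx i').const_mul q
    · exact hx i'

theorem theta_div_ne_zero {p : ℂ} {a b : ℂ} {r : ℝ} (hp : ‖p‖ < 1) (hr : 0 < r) (hab : a ≠ b)
    (ha : ‖p‖ < ‖a‖ * r ∧ ‖a‖ * r < 1) (hb : ‖p‖ < ‖b‖ * r ∧ ‖b‖ * r < 1) :
    theta p (a / b) ≠ 0 := by
  have ha' : 0 < ‖a‖ * r := (norm_nonneg _).trans_lt ha.1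
  have hb' : 0 < ‖b‖ * r := (norm_nonneg _).trans_lt hb.1
  have ha0 : a ≠ 0 := fun h => by simp [h] at ha'
  have hb0 : b ≠ 0 := fun h => by simp [h] at hb'
  have h3 : ‖a / b‖ = ‖a‖ * r / (‖b‖ * r) := by
    rw [norm_div, mul_div_mul_right _ _ hr.ne']
  refine theta_ne_zero hp (div_ne_zero ha0 hb0) (ne_zpow_of_norm hp ?_ ?_ ?_)
  · rw [h3, lt_div_iff₀ hb']
    exact (mul_le_of_le_one_right (norm_nonneg _) hb.2.le).trans_lt ha.1
  · rw [h3, ← mul_div_assoc, div_lt_one hb']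
    exact (mul_le_of_le_one_right (norm_nonneg _) ha.2.le).trans_lt hb.1
  · rwa [Ne, div_eq_one_iff_eq hb0]

/-- Continuity of both sides of the functional equation in all parameters. -/
theorem tendsto_functional_equation_left (hq0 : q ≠ 0) (hq : ‖q‖ < 1) (ht : t ≠ 0)
    (hp₀ : ‖p₀‖ < 1) (hx₀ : ∀ i, x₀ i ≠ 0) (hy₀ : ∀ j, y₀ j ≠ 0)
    (hxi : Function.Injective x₀) (hyi : Function.Injective y₀)
    (hxy : ∀ i j, qpPoch q p₀ (x₀ i * y₀ j) ≠ 0) {r : ℝ} (hr : 0 < r)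
    (hdom : ∀ k, ‖p₀‖ < ‖poleInv t x₀ y₀ k‖ * r ∧ ‖poleInv t x₀ y₀ k‖ * r < 1)
    (hp : Tendsto p l (𝓝 p₀)) (hx : ∀ i, Tendsto (fun s => x s i) l (𝓝 (x₀ i)))
    (hy : ∀ j, Tendsto (fun s => y s j) l (𝓝 (y₀ j))) :
    Tendsto (fun s => ellMacdonald M q t (p s) (fun x' => ellKernel M N q t (p s) x' (y s)) (x s) -
        t ^ ((M : ℤ) - (N : ℤ)) *
          ellMacdonald N q t (p s) (fun y' => ellKernel M N q t (p s) (x s) y') (y s)) l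
      (𝓝 (ellMacdonald M q t p₀ (fun x' => ellKernel M N q t p₀ x' y₀) x₀ -
        t ^ ((M : ℤ) - (N : ℤ)) *
          ellMacdonald N q t p₀ (fun y' => ellKernel M N q t p₀ x₀ y') y₀)) := by
  have hb (i j) := (norm_mul_mul_bounds ht hy₀ hr hdom i j).1
  refine (tendsto_ellMacdonald hq0 hq ht hp₀ hx₀ hy₀ hxy hb (fun i j hij => ?_) hp hx hy).sub
    (Tendsto.const_mul _ ?_)
  · exact theta_div_ne_zero hp₀ hr (fun h => hij (hxi h).symm) (hdom (Sum.inl i)) (hdom (Sum.inl j))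
  · simp only [ellKernel_swap M N]
    refine tendsto_ellMacdonald hq0 hq ht hp₀ hy₀ hx₀ (fun j i => mul_comm (x₀ i) _ ▸ hxy i j)
      (fun j i => ?_) (fun j i hij => ?_) hp hy hx
    · have := hb i j
      rwa [mul_right_comm] at this
    -- As a quotient of two entries of `poleInv`, this falls under the same bound as `x_i / x_j`.
    · have h1 : y₀ j / y₀ i = (t⁻¹ * (y₀ i)⁻¹) / (t⁻¹ * (y₀ j)⁻¹) := by
        have := hy₀ i
        have := hy₀ j
        field_simp
      rw [h1]
      refine theta_div_ne_zero hp₀ hr (fun h => hij (hyi ?_)) (hdom (Sum.inr i)) (hdom (Sum.inr j))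
      exact inv_injective (mul_left_cancel₀ (inv_ne_zero ht) h)

theorem tendsto_functional_equation_right [l.IsCountablyGenerated] (hM : 0 < M) (hq : ‖q‖ < 1)
    (ht : t ≠ 0) (hp₀ : ‖p₀‖ < 1) (htp : ∀ k : ℤ, t ≠ p₀ ^ k) (hx₀ : ∀ i, x₀ i ≠ 0)
    (hy₀ : ∀ j, y₀ j ≠ 0) (hxy : ∀ i j, qpPoch q p₀ (x₀ i * y₀ j) ≠ 0) {r : ℝ} (hr : 0 < r)
    (hdom : ∀ k, ‖p₀‖ < ‖poleInv t x₀ y₀ k‖ * r ∧ ‖poleInv t x₀ y₀ k‖ * r < 1)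
    (hp : Tendsto p l (𝓝 p₀)) (hx : ∀ i, Tendsto (fun s => x s i) l (𝓝 (x₀ i)))
    (hy : ∀ j, Tendsto (fun s => y s j) l (𝓝 (y₀ j))) :
    Tendsto (fun s => (1 - t ^ ((M : ℤ) - (N : ℤ))) * qPoch (p s) (p s) ^ 3 / theta (p s) t *
        ellC M N t (p s) (x s) (y s) * ellKernel M N q t (p s) (x s) (y s)) l
      (𝓝 ((1 - t ^ ((M : ℤ) - (N : ℤ))) * qPoch p₀ p₀ ^ 3 / theta p₀ t *
        ellC M N t p₀ x₀ y₀ * ellKernel M N q t p₀ x₀ y₀)) := by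
  have hqp : ‖q * p₀‖ ≤ ‖p₀‖ := by
    rw [norm_mul]; exact mul_le_of_le_one_left (norm_nonneg _) hq.le
  exact (((((tendsto_qPoch hp₀ hp hp).pow 3).const_mul _).div
    (tendsto_theta hp₀ ht hp tendsto_const_nhds) (theta_ne_zero hp₀ ht htp)).mul
    (tendsto_ellC hM ht hp₀ hx₀ hy₀ hr hdom hp hx hy)).mul
    (tendsto_ellKernel hq ht hp₀ hx₀ hy₀ hxy
      (fun i j => hqp.trans_lt (norm_mul_mul_bounds ht hy₀ hr hdom i j).1) hp hx hy)

end EllipticKernel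

namespace EllipticKernel

variable {M N : ℕ} {q t p : ℂ} {x : Fin M → ℂ} {y : Fin N → ℂ}

/-! ### Removal of the genericity assumption. -/

theorem expansionDomain_nonempty {r : ℝ} (hr : 0 < r)
    (hdom : ∀ k, ‖p‖ < ‖poleInv t x y k‖ * r ∧ ‖poleInv t x y k‖ * r < 1) :
    (expansionDomain M N t p x y).Nonempty :=
  ⟨r, sphere_subset_expansionDomain hdom (by simp [abs_of_pos hr])⟩

/-- Replacing `y` by `s y` with `s → 1`, `s ≠ 1`, separates coinciding poles while keeping a fixed
radius admissible; continuity transfers the identity to `s = 1`. -/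
theorem functional_equation_of_ne_zero (hM : 0 < M) (hq0 : q ≠ 0) (hq : ‖q‖ < 1) (ht : t ≠ 0)
    (hp : ‖p‖ < 1) (hp0 : p ≠ 0) (htp : ∀ k : ℤ, t ≠ p ^ k) (hx : ∀ i, x i ≠ 0)
    (hy : ∀ j, y j ≠ 0) (hxi : Function.Injective x) (hyi : Function.Injective y)
    (hxy : ∀ i j, qpPoch q p (x i * y j) ≠ 0) (hne : (expansionDomain M N t p x y).Nonempty) :
    ellMacdonald M q t p (fun x' => ellKernel M N q t p x' y) x -
        t ^ ((M : ℤ) - (N : ℤ)) * ellMacdonald N q t p (fun y' => ellKernel M N q t p x y') y =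
      (1 - t ^ ((M : ℤ) - (N : ℤ))) * qPoch p p ^ 3 / theta p t *
        ellC M N t p x y * ellKernel M N q t p x y := by
  obtain ⟨r, hr, hdom⟩ := exists_radius hM hne
  have hid : Tendsto (fun s : ℂ => s) (𝓝[≠] 1) (𝓝 1) := tendsto_id.mono_left nhdsWithin_le_nhds
  have hyl (j) : Tendsto (fun s : ℂ => s * y j) (𝓝[≠] 1) (𝓝 (y j)) := by
    simpa using hid.mul_const (y j)
  have hpl : Tendsto (fun _ : ℂ => p) (𝓝[≠] 1) (𝓝 p) := tendsto_const_nhds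
  have hxl (i) : Tendsto (fun _ : ℂ => x i) (𝓝[≠] 1) (𝓝 (x i)) := tendsto_const_nhds
  have h1 := tendsto_functional_equation_left hq0 hq ht hp hx hy hxi hyi hxy hr hdom hpl hxl hyl
  have h2 := tendsto_functional_equation_right hM hq ht hp htp hx hy hxy hr hdom hpl hxl hyl
  refine tendsto_nhds_unique_of_eventuallyEq h1 h2 ?_
  have e1 : ∀ᶠ s : ℂ in 𝓝[≠] 1, s ≠ 0 := hid.eventually_ne one_ne_zero
  have e2 : ∀ᶠ s : ℂ in 𝓝[≠] 1, ∀ i j, qPoch p (x i * (s * y j)) ≠ 0 := by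
    refine eventually_all.mpr fun i => eventually_all.mpr fun j => ?_
    have h := hxy i j
    rw [qpPoch_eq_mul_qpPoch hq hp] at h
    exact (tendsto_qPoch hp hpl ((hxl i).mul (hyl j))).eventually_ne (left_ne_zero_of_mul h)
  have e3 : ∀ᶠ s : ℂ in 𝓝[≠] 1, ∀ i j, t * x i * (s * y j) ≠ 1 := by
    refine eventually_all.mpr fun i => eventually_all.mpr fun j => ?_
    by_cases h : t * x i * y j = 1
    -- If `t x_i y_j = 1`, the perturbed product is exactly `s`, which differs from `1` in the
    -- punctured neighbourhood.
    · filter_upwards [self_mem_nhdsWithin] with s hs h'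
      refine hs ?_
      rw [mul_left_comm, h, mul_one] at h'
      exact h'
    · exact ((hyl j).const_mul (t * x i)).eventually_ne h
  have e4 := eventually_norm_bounds hdom hpl (tendsto_poleInv (t := t) hy hxl hyl)
  filter_upwards [e1, e2, e3, e4] with s h1 h2 h3 h4
  exact functional_equation_of_generic hM hq0 hq ht hp hp0 htp hx (fun j => mul_ne_zero h1 (hy j))
    hxi (fun j j' h => hyi (mul_left_cancel₀ h1 h)) h2 h3 (expansionDomain_nonempty hr h4)

/-! ### The limit `p → 0` -/

theorem ellGamma_zero (q x : ℂ) : ellGamma q 0 x = (qPoch q x)⁻¹ := by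
  have : qpPoch q 0 0 = 1 := by simp [qpPoch]
  rw [ellGamma, mul_zero, zero_mul, this, qpPoch_zero_right, one_div]

theorem ellKernel_zero (q t : ℂ) (x : Fin M → ℂ) (y : Fin N → ℂ) :
    ellKernel M N q t 0 x y = trigKernel M N q t x y := by
  refine Finset.prod_congr rfl fun i _ => Finset.prod_congr rfl fun j _ => ?_
  rw [ellGamma_zero, ellGamma_zero, inv_div_inv]

theorem ellMacdonald_zero (q t : ℂ) (f : (Fin M → ℂ) → ℂ) (hx : ∀ i, x i ≠ 0) :
    ellMacdonald M q t 0 f x = trigMacdonald M q t f x := by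
  refine Finset.sum_congr rfl fun i _ => ?_
  congr 1
  refine Finset.prod_congr rfl fun j _ => ?_
  have hj := hx j
  rw [theta_zero, theta_zero, one_sub_div hj, one_sub_div hj, div_div_div_cancel_right₀ hj,
    ← neg_sub (t * x i), ← neg_sub (x i), neg_div_neg_eq]

theorem exists_radius_zero (ht : t ≠ 0) (hx : ∀ i, x i ≠ 0) (hy : ∀ j, y j ≠ 0) :
    ∃ r : ℝ, 0 < r ∧ ∀ k, ‖(0 : ℂ)‖ < ‖poleInv t x y k‖ * r ∧ ‖poleInv t x y k‖ * r < 1 := by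
  have hS : 0 ≤ ∑ k, ‖poleInv t x y k‖ := Finset.sum_nonneg fun _ _ => norm_nonneg _
  refine ⟨1 / (1 + ∑ k, ‖poleInv t x y k‖), by positivity, fun k => ?_⟩
  have hk := norm_pos_iff.mpr (poleInv_ne_zero ht hx hy k)
  refine ⟨by rw [norm_zero]; positivity, ?_⟩
  rw [mul_one_div, div_lt_one (by positivity)]
  have := Finset.single_le_sum (f := fun k => ‖poleInv t x y k‖) (fun _ _ => norm_nonneg _)
    (Finset.mem_univ k)
  linarith

/-- At `p = 0` the theta ratio is a rational function, holomorphic on the closed disc of radius `r`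
and equal to `1` at the origin, so its circle average is `1`. -/
theorem ellC_zero (hM : 0 < M) (ht : t ≠ 0) (hx : ∀ i, x i ≠ 0) (hy : ∀ j, y j ≠ 0) :
    ellC M N t 0 x y = 1 := by
  obtain ⟨r, hr, hdom⟩ := exists_radius_zero ht hx hy
  rw [ellC_eq_circleAverage hM norm_zero_lt_one ht hx hy hr hdom, thetaRatio_eq]
  simp only [theta_zero]
  have hd (z : ℂ) (hz : z ∈ Metric.closedBall (0 : ℂ) |r|) : DifferentiableAt ℂ (fun z =>
      ∏ k, (1 - zeroInv t x y k * z) / (1 - poleInv t x y k * z)) z := by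
    refine DifferentiableAt.fun_finsetProd fun k _ => ?_
    refine DifferentiableAt.fun_div (by fun_prop) (by fun_prop) fun h => ?_
    have hz' : ‖z‖ ≤ r := by simpa [abs_of_pos hr] using hz
    have h1 := congrArg norm (sub_eq_zero.mp h)
    rw [norm_one, norm_mul] at h1
    have h2 := mul_le_mul_of_nonneg_left hz' (norm_nonneg (poleInv t x y k))
    linarith [(hdom k).2]
  rw [circleAverage_of_differentiable_on_off_countable Set.countable_empty
    (fun z hz => (hd z hz).continuousAt.continuousWithinAt)
    (fun z hz => hd z (Metric.ball_subset_closedBall hz.1))]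
  simp

theorem eventually_ne_zpow (ht : t ≠ 0) (ht1 : t ≠ 1) :
    ∀ᶠ p : ℂ in 𝓝 0, ∀ k : ℤ, t ≠ p ^ k := by
  have h0 : Tendsto (fun p : ℂ => ‖p‖) (𝓝 0) (𝓝 0) := by
    simpa using (continuous_norm (E := ℂ)).tendsto 0
  have h1 : Tendsto (fun p : ℂ => ‖p‖ * ‖t‖) (𝓝 0) (𝓝 0) := by simpa using h0.mul_const ‖t‖
  filter_upwards [h0.eventually (gt_mem_nhds one_pos),
    h0.eventually (gt_mem_nhds (norm_pos_iff.mpr ht)), h1.eventually (gt_mem_nhds one_pos)]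
    with p e1 e2 e3 using ne_zpow_of_norm e1 e2 e3 ht1

theorem qpPoch_zero_ne_zero (hq : ‖q‖ < 1) {s : ℂ} (hs : ∀ m : ℕ, s * q ^ m ≠ 1) :
    qpPoch q 0 s ≠ 0 := by
  rw [qpPoch_zero_right]; exact qPoch_ne_zero hq hs

/-- Quasi-periodicity degenerates at `p = 0`, so this case is the limit of the identity over `p ≠
0`. -/
theorem functional_equation_zero (hM : 0 < M) (hq0 : q ≠ 0) (hq : ‖q‖ < 1) (ht : t ≠ 0)
    (ht1 : t ≠ 1) (hx : ∀ i, x i ≠ 0) (hy : ∀ j, y j ≠ 0) (hxi : Function.Injective x)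
    (hyi : Function.Injective y) (hxy : ∀ i j, ∀ m : ℕ, x i * y j * q ^ m ≠ 1) :
    ellMacdonald M q t 0 (fun x' => ellKernel M N q t 0 x' y) x -
        t ^ ((M : ℤ) - (N : ℤ)) * ellMacdonald N q t 0 (fun y' => ellKernel M N q t 0 x y') y =
      (1 - t ^ ((M : ℤ) - (N : ℤ))) * qPoch 0 0 ^ 3 / theta 0 t *
        ellC M N t 0 x y * ellKernel M N q t 0 x y := by
  obtain ⟨r, hr, hdom⟩ := exists_radius_zero ht hx hy
  have hxy' (i j) := qpPoch_zero_ne_zero hq (hxy i j)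
  have hpl : Tendsto (fun p : ℂ => p) (𝓝[≠] 0) (𝓝 0) := tendsto_id.mono_left nhdsWithin_le_nhds
  have hxl (i) : Tendsto (fun _ : ℂ => x i) (𝓝[≠] 0) (𝓝 (x i)) := tendsto_const_nhds
  have hyl (j) : Tendsto (fun _ : ℂ => y j) (𝓝[≠] 0) (𝓝 (y j)) := tendsto_const_nhds
  have htp := (eventually_ne_zpow ht ht1).self_of_nhds
  have h1 := tendsto_functional_equation_left hq0 hq ht norm_zero_lt_one hx hy hxi hyi hxy' hr hdom
    hpl hxl hyl
  have h2 := tendsto_functional_equation_right hM hq ht norm_zero_lt_one htp hx hy hxy' hr hdom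
    hpl hxl hyl
  refine tendsto_nhds_unique_of_eventuallyEq h1 h2 ?_
  have e1 : ∀ᶠ p : ℂ in 𝓝[≠] 0, ∀ i j, qpPoch q p (x i * y j) ≠ 0 :=
    eventually_all.mpr fun i => eventually_all.mpr fun j =>
      (tendsto_qpPoch hq norm_zero_lt_one hpl tendsto_const_nhds).eventually_ne (hxy' i j)
  have e2 := eventually_norm_bounds hdom hpl (tendsto_poleInv (t := t) hy hxl hyl)
  filter_upwards [e1, e2, self_mem_nhdsWithin, hpl.eventually (eventually_ne_zpow ht ht1),
    hpl.norm.eventually (gt_mem_nhds norm_zero_lt_one)] with p h1 h2 h3 h4 h5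
  exact functional_equation_of_ne_zero hM hq0 hq ht h5 h3 h4 hx hy hxi hyi h1
    (expansionDomain_nonempty hr h2)

theorem functional_equation (hM : 0 < M) (hq0 : q ≠ 0) (hq : ‖q‖ < 1) (ht : t ≠ 0)
    (hp : ‖p‖ < 1) (htp : ∀ k : ℤ, t ≠ p ^ k) (hx : ∀ i, x i ≠ 0)
    (hy : ∀ j, y j ≠ 0) (hxi : Function.Injective x) (hyi : Function.Injective y)
    (hxy : ∀ i j, ∀ m n : ℕ, x i * y j * q ^ m * p ^ n ≠ 1)
    (hne : (expansionDomain M N t p x y).Nonempty) :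
    ellMacdonald M q t p (fun x' => ellKernel M N q t p x' y) x -
        t ^ ((M : ℤ) - (N : ℤ)) * ellMacdonald N q t p (fun y' => ellKernel M N q t p x y') y =
      (1 - t ^ ((M : ℤ) - (N : ℤ))) * qPoch p p ^ 3 / theta p t *
        ellC M N t p x y * ellKernel M N q t p x y := by
  rcases eq_or_ne p 0 with rfl | hp0
  · exact functional_equation_zero hM hq0 hq ht (by simpa using htp 0) hx hy hxi hyi
      fun i j m => by simpa using hxy i j m 0
  · exact functional_equation_of_ne_zero hM hq0 hq ht hp hp0 htp hx hy hxi hyi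
      (fun i j => qpPoch_ne_zero hq hp (hxy i j)) hne

theorem qPoch_zero_zero : qPoch 0 0 = 1 := by simp [qPoch]

theorem trigonometric_limit (hM : 0 < M) (hq0 : q ≠ 0) (hq : ‖q‖ < 1) (ht : t ≠ 0)
    (ht1 : t ≠ 1) (hx : ∀ i, x i ≠ 0) (hy : ∀ j, y j ≠ 0) (hxi : Function.Injective x)
    (hyi : Function.Injective y) (hxy : ∀ i j, ∀ m : ℕ, x i * y j * q ^ m ≠ 1) :
    Tendsto (fun p => ellC M N t p x y) (𝓝[≠] 0) (𝓝 1) ∧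
      Tendsto (fun p => ellMacdonald M q t p (fun x' => ellKernel M N q t p x' y) x -
          t ^ ((M : ℤ) - (N : ℤ)) * ellMacdonald N q t p (fun y' => ellKernel M N q t p x y') y)
        (𝓝[≠] 0)
        (𝓝 (trigMacdonald M q t (fun x' => trigKernel M N q t x' y) x -
          t ^ ((M : ℤ) - (N : ℤ)) * trigMacdonald N q t (fun y' => trigKernel M N q t x y') y)) ∧
      Tendsto (fun p => (1 - t ^ ((M : ℤ) - (N : ℤ))) * qPoch p p ^ 3 / theta p t *
          ellC M N t p x y * ellKernel M N q t p x y)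
        (𝓝[≠] 0)
        (𝓝 ((1 - t ^ ((M : ℤ) - (N : ℤ))) / (1 - t) * trigKernel M N q t x y)) ∧
      trigMacdonald M q t (fun x' => trigKernel M N q t x' y) x -
          t ^ ((M : ℤ) - (N : ℤ)) * trigMacdonald N q t (fun y' => trigKernel M N q t x y') y =
        (1 - t ^ ((M : ℤ) - (N : ℤ))) / (1 - t) * trigKernel M N q t x y := by
  obtain ⟨r, hr, hdom⟩ := exists_radius_zero ht hx hy
  have hxy' (i j) := qpPoch_zero_ne_zero hq (hxy i j)
  have hpl : Tendsto (fun p : ℂ => p) (𝓝[≠] 0) (𝓝 0) := tendsto_id.mono_left nhdsWithin_le_nhds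
  have hxl (i) : Tendsto (fun _ : ℂ => x i) (𝓝[≠] 0) (𝓝 (x i)) := tendsto_const_nhds
  have hyl (j) : Tendsto (fun _ : ℂ => y j) (𝓝[≠] 0) (𝓝 (y j)) := tendsto_const_nhds
  have htp := (eventually_ne_zpow ht ht1).self_of_nhds
  have h0 := tendsto_ellC hM ht norm_zero_lt_one hx hy hr hdom hpl hxl hyl
  have h1 := tendsto_functional_equation_left hq0 hq ht norm_zero_lt_one hx hy hxi hyi hxy' hr hdom
    hpl hxl hyl
  have h2 := tendsto_functional_equation_right hM hq ht norm_zero_lt_one htp hx hy hxy' hr hdom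
    hpl hxl hyl
  have h3 := functional_equation_zero hM hq0 hq ht ht1 hx hy hxi hyi hxy
  simp only [ellMacdonald_zero _ _ _ hx, ellMacdonald_zero _ _ _ hy, ellKernel_zero,
    ellC_zero hM ht hx hy, theta_zero, qPoch_zero_zero, one_pow, mul_one] at h0 h1 h2 h3
  exact ⟨h0, h1, h2, h3⟩

end EllipticKernel

namespace EllipticKernel

/-! ### Exponential series in commuting symbols -/

/-- The monomials of `exp (∑_m h_m)`. -/
noncomputable def expTerm {σ : Type*} (h : σ → ℂ) (k : σ →₀ ℕ) : ℂ :=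
  k.prod fun m e => h m ^ e / (e.factorial : ℂ)

section expTerm

variable {σ : Type*} {h : σ → ℂ}

theorem expTerm_eq_prod (h : σ → ℂ) {k : σ →₀ ℕ} {s : Finset σ} (hs : k.support ⊆ s) :
    expTerm h k = ∏ m ∈ s, h m ^ k m / ((k m).factorial : ℂ) :=
  Finsupp.prod_of_support_subset k hs _ fun m _ => by simp

open Classical in
-- Induction on the finite set of symbols: adjoining `m` multiplies by the exponential series of `h
-- m`, and exponents split as `single m n + k'` with `k'` supported on `s`.
theorem hasSum_expTerm_of_subset (h : σ → ℂ) (s : Finset σ) :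
    HasSum (fun k : σ →₀ ℕ => if k.support ⊆ s then expTerm h k else 0)
      (Complex.exp (∑ m ∈ s, h m)) := by
  induction s using Finset.induction_on with
  | empty =>
    have h0 : Complex.exp (∑ m ∈ (∅ : Finset σ), h m) =
        (if (0 : σ →₀ ℕ).support ⊆ ∅ then expTerm h 0 else 0) := by simp [expTerm]
    rw [h0]
    refine hasSum_single (f := fun k : σ →₀ ℕ => if k.support ⊆ ∅ then expTerm h k else 0) 0
      fun k hk => if_neg fun hs => hk ?_
    rwa [Finset.subset_empty, Finsupp.support_eq_empty] at hs
  | insert m s hm ih =>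
    have hexp : HasSum (fun n : ℕ => h m ^ n / (n.factorial : ℂ)) (Complex.exp (h m)) := by
      rw [Complex.exp_eq_exp_ℂ]; exact NormedSpace.expSeries_div_hasSum_exp (h m)
    rw [Finset.sum_insert hm, Complex.exp_add]
    let G : ℕ × (σ →₀ ℕ) → ℂ := fun k => h m ^ k.1 / (k.1.factorial : ℂ) *
      if k.2.support ⊆ s then expTerm h k.2 else 0
    have hprod : HasSum G (Complex.exp (h m) * Complex.exp (∑ m ∈ s, h m)) := by
      rw [← hexp.tsum_eq, ← ih.tsum_eq, tsum_mul_tsum_of_summable_norm hexp.summable.norm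
        ih.summable.norm]
      exact (summable_mul_of_summable_norm hexp.summable.norm ih.summable.norm).hasSum
    have hsub (k : Function.support G) : k.1.2.support ⊆ s := by
      by_contra hk
      exact k.2 (by simp [G, hk])
    have hzero (k : Function.support G) : k.1.2 m = 0 :=
      Finsupp.notMem_support_iff.mp fun h' => hm (hsub k h')
    -- The map `(n, k') ↦ single m n + k'` is not injective in general, only where `k' m = 0`;
    -- restricting to nonzero terms ensures this.
    refine (hasSum_iff_hasSum_of_ne_zero_bij
      (fun k : Function.support G => Finsupp.single m k.1.1 + k.1.2) ?_ ?_ ?_).mpr hprod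
    · intro k k' hkk
      dsimp only at hkk
      have h1 : k.1.1 = k'.1.1 := by
        have := DFunLike.congr_fun hkk m
        simpa [hzero] using this
      rw [h1] at hkk
      exact Subtype.ext (Prod.ext h1 (add_left_cancel hkk))
    · intro k hk
      have hks : k.support ⊆ insert m s := by
        by_contra h'
        exact hk (if_neg h')
      have hes : (k.erase m).support ⊆ s := by
        rw [Finsupp.support_erase]
        exact fun a ha => (Finset.mem_insert.mp (hks (Finset.mem_of_mem_erase ha))).resolve_left
          (Finset.ne_of_mem_erase ha)
      have hval : G (k m, k.erase m) ≠ 0 := by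
        intro h0
        refine hk ?_
        dsimp only
        rw [if_pos hks, expTerm_eq_prod h hks, Finset.prod_insert hm, ← h0]
        simp only [G]
        rw [if_pos hes, expTerm_eq_prod h hes]
        congr 1
        refine Finset.prod_congr rfl fun a ha => ?_
        have ham : a ≠ m := fun h' => hm (h' ▸ ha)
        rw [Finsupp.erase_ne ham]
      exact ⟨⟨(k m, k.erase m), hval⟩, Finsupp.single_add_erase m k⟩
    · intro k
      have hks : (Finsupp.single m k.1.1 + k.1.2).support ⊆ insert m s := by
        refine Finsupp.support_add.trans (Finset.union_subset ?_ ?_)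
        · exact Finsupp.support_single_subset.trans (by simp)
        · exact (hsub k).trans (Finset.subset_insert m s)
      rw [if_pos hks, expTerm_eq_prod h hks, Finset.prod_insert hm]
      simp only [G]
      rw [if_pos (hsub k), expTerm_eq_prod h (hsub k)]
      congr 1
      · simp [hzero k]
      · refine Finset.prod_congr rfl fun a ha => ?_
        have ha' : m ≠ a := fun h' => hm (h' ▸ ha)
        simp [ha']

theorem expTerm_norm (h : σ → ℂ) (k : σ →₀ ℕ) :
    expTerm (fun m => (‖h m‖ : ℂ)) k = (‖expTerm h k‖ : ℂ) := by
  simp [expTerm, Finsupp.prod, norm_prod]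

/-- A finite set of exponents involves finitely many symbols, so each partial sum is bounded by a
finite exponential, hence by `exp (∑ ‖h m‖)`. -/
theorem summable_norm_expTerm (hh : Summable fun m => ‖h m‖) :
    Summable fun k => ‖expTerm h k‖ := by
  classical
  refine summable_of_sum_le (c := Real.exp (∑' m, ‖h m‖)) (fun _ => norm_nonneg _) fun T => ?_
  set S := T.biUnion Finsupp.support with hS
  have h1 := hasSum_expTerm_of_subset (fun m => (‖h m‖ : ℂ)) S
  have h2 : HasSum (fun k : σ →₀ ℕ => if k.support ⊆ S then ‖expTerm h k‖ else 0)
      (Real.exp (∑ m ∈ S, ‖h m‖)) := by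
    rw [← Complex.hasSum_ofReal]
    convert! h1 using 2 with k
    · rw [expTerm_norm]; split_ifs <;> simp
    · push_cast; rfl
  calc ∑ k ∈ T, ‖expTerm h k‖ = ∑ k ∈ T, if k.support ⊆ S then ‖expTerm h k‖ else 0 :=
        Finset.sum_congr rfl fun k hk => (if_pos (Finset.subset_biUnion_of_mem _ hk)).symm
    _ ≤ Real.exp (∑ m ∈ S, ‖h m‖) :=
        sum_le_hasSum T (fun k _ => by split_ifs <;> positivity) h2
    _ ≤ Real.exp (∑' m, ‖h m‖) :=
        Real.exp_le_exp.mpr (hh.sum_le_tsum S fun _ _ => norm_nonneg _)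

/-- `∑_k ∏_m h_m^{k_m} / k_m! = exp (∑_m h_m)`. -/
theorem hasSum_expTerm (hh : Summable fun m => ‖h m‖) :
    HasSum (expTerm h) (Complex.exp (∑' m, h m)) := by
  classical
  have hs := summable_norm_expTerm hh
  have h1 : Tendsto (fun S : Finset σ => ∑' k : σ →₀ ℕ,
      if k.support ⊆ S then expTerm h k else 0) atTop (𝓝 (∑' k, expTerm h k)) := by
    refine tendsto_tsum_of_dominated_convergence hs (fun k => ?_) (.of_forall fun S k => ?_)
    · refine tendsto_const_nhds.congr' ?_
      filter_upwards [eventually_ge_atTop k.support] with S hS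
      exact (if_pos hS).symm
    · split_ifs <;> simp
  simp only [(hasSum_expTerm_of_subset h _).tsum_eq] at h1
  have h2 : Tendsto (fun S : Finset σ => Complex.exp (∑ m ∈ S, h m)) atTop
      (𝓝 (Complex.exp (∑' m, h m))) :=
    (Complex.continuous_exp.tendsto _).comp hh.of_norm.hasSum
  rw [← tendsto_nhds_unique h1 h2]
  exact hs.of_norm.hasSum

/-- The binomial theorem for each symbol, followed by expanding the product of sums; families of
splittings of the `k m` correspond to the antidiagonal of `k`. -/
theorem expTerm_add [DecidableEq σ] (h h' : σ → ℂ) (k : σ →₀ ℕ) :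
    expTerm (fun m => h m + h' m) k =
      ∑ ab ∈ Finset.HasAntidiagonal.antidiagonal k, expTerm h ab.1 * expTerm h' ab.2 := by
  classical
  have hadd (m : σ) : (h m + h' m) ^ k m / ((k m).factorial : ℂ) =
      ∑ ij ∈ Finset.HasAntidiagonal.antidiagonal (k m), h m ^ ij.1 / (ij.1.factorial : ℂ) *
        (h' m ^ ij.2 / (ij.2.factorial : ℂ)) := by
    rw [(Commute.all (h m) (h' m)).add_pow', Finset.sum_div]
    refine Finset.sum_congr rfl fun ij hij => ?_
    have hij := Finset.HasAntidiagonal.mem_antidiagonal.mp hij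
    have h1 := Nat.add_choose_mul_factorial_mul_factorial ij.1 ij.2
    rw [hij] at h1
    have h2 : ((k m).choose ij.1 : ℂ) * ij.1.factorial * ij.2.factorial = (k m).factorial := by
      rw [Nat.choose_symm_of_eq_add hij.symm]
      exact_mod_cast h1
    have h3 : (ij.1.factorial : ℂ) ≠ 0 := Nat.cast_ne_zero.mpr (Nat.factorial_ne_zero _)
    have h4 : (ij.2.factorial : ℂ) ≠ 0 := Nat.cast_ne_zero.mpr (Nat.factorial_ne_zero _)
    have h5 : ((k m).factorial : ℂ) ≠ 0 := Nat.cast_ne_zero.mpr (Nat.factorial_ne_zero _)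
    rw [nsmul_eq_mul]
    field_simp
    rw [← h2]
    ring
  rw [expTerm_eq_prod _ subset_rfl]
  simp only [hadd]
  rw [Finset.prod_sum]
  symm
  refine Finset.sum_bij' (fun ab _ m _ => (ab.1 m, ab.2 m))
    (fun f _ => (Finsupp.indicator k.support fun m hm => (f m hm).1,
      Finsupp.indicator k.support fun m hm => (f m hm).2)) ?_ ?_ ?_ ?_ ?_
  · intro ab hab
    have := Finset.HasAntidiagonal.mem_antidiagonal.mp hab
    simp [← this]
  · intro f hf
    rw [Finset.HasAntidiagonal.mem_antidiagonal]
    ext m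
    by_cases hm : m ∈ k.support
    · have := Finset.HasAntidiagonal.mem_antidiagonal.mp (Finset.mem_pi.mp hf m hm)
      simp [Finsupp.indicator_apply, hm, this]
    · simp [Finsupp.indicator_apply, hm, Finsupp.notMem_support_iff.mp hm]
  · intro ab hab
    have hab := Finset.HasAntidiagonal.mem_antidiagonal.mp hab
    have h0 (m) (hm : m ∉ k.support) : ab.1 m = 0 ∧ ab.2 m = 0 := by
      rw [Finsupp.notMem_support_iff, ← hab, Finsupp.add_apply] at hm
      omega
    ext m <;> by_cases hm : m ∈ k.support <;> simp [Finsupp.indicator_apply, hm, h0]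
  · intro f hf
    ext m hm <;> simp [Finsupp.indicator_apply, hm]
  · intro ab hab
    have hab := Finset.HasAntidiagonal.mem_antidiagonal.mp hab
    have h1 : ab.1.support ⊆ k.support := fun m hm => by
      rw [Finsupp.mem_support_iff] at hm ⊢
      rw [← hab, Finsupp.add_apply]; omega
    have h2 : ab.2.support ⊆ k.support := fun m hm => by
      rw [Finsupp.mem_support_iff] at hm ⊢
      rw [← hab, Finsupp.add_apply]; omega
    rw [expTerm_eq_prod h h1, expTerm_eq_prod h' h2, ← Finset.prod_mul_distrib]
    exact (Finset.prod_attach k.support _).symm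

theorem expTerm_zero (k : σ →₀ ℕ) [Decidable (k = 0)] :
    expTerm (fun _ => 0) k = if k = 0 then 1 else 0 := by
  split_ifs with hk
  · simp [hk, expTerm]
  · obtain ⟨m, hm⟩ := Finsupp.support_nonempty_iff.mpr hk
    exact Finset.prod_eq_zero hm (by simp [Finsupp.mem_support_iff.mp hm])

end expTerm

theorem coeff_expSeries (d : Mode → ℂ) (k : Mode →₀ ℕ) :
    MvPowerSeries.coeff k (expSeries d) = expTerm d k := by
  change (k.prod fun m e => ((e.factorial : ℂ)⁻¹) • d m ^ e) = _
  simp only [expTerm, smul_eq_mul, div_eq_inv_mul]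

theorem coeff_prod_expSeries {κ : Type*} (s : Finset κ) (d : κ → Mode → ℂ) (k : Mode →₀ ℕ) :
    MvPowerSeries.coeff k (∏ i ∈ s, expSeries (d i)) = expTerm (fun m => ∑ i ∈ s, d i m) k := by
  classical
  induction s using Finset.induction_on generalizing k with
  | empty =>
    simp only [Finset.prod_empty, Finset.sum_empty]
    rw [expTerm_zero, MvPowerSeries.coeff_one]
  | insert i s hi ih =>
    rw [Finset.prod_insert hi, MvPowerSeries.coeff_mul]
    simp only [Finset.sum_insert hi, ih, coeff_expSeries]
    rw [expTerm_add]

end EllipticKernel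

namespace EllipticKernel

/-! ### Vacuum expectation values of monomials -/

theorem creationMonomial_apply (k : Mode →₀ ℕ) (f : Fock) :
    creationMonomial k f = MvPolynomial.monomial k 1 * f := by
  classical
  have h (s : Finset Mode) (hs) : s.noncommProd (fun m => creation m ^ k m) hs f =
      (∏ m ∈ s, MvPolynomial.X m ^ k m) * f := by
    induction s using Finset.induction_on with
    | empty => simp
    | insert m s hm ih =>
      rw [Finset.noncommProd_insert_of_notMem _ _ _ _ hm, Module.End.mul_apply, ih,
        Finset.prod_insert hm, creation, LinearMap.pow_mulLeft, LinearMap.mulLeft_apply, mul_assoc]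
  refine (h k.support fun m _ n _ _ => (creation_commute m n).pow_pow _ _).trans ?_
  rw [MvPolynomial.monomial_eq, map_one, one_mul]
  rfl

variable {q t p : ℂ}

theorem annihilation_pow_monomial (m : Mode) (n : ℕ) (e : Mode →₀ ℕ) (c : ℂ) :
    (annihilation q t p m ^ n) (MvPolynomial.monomial e c) =
      MvPolynomial.monomial (e - Finsupp.single m n)
        (c * (bosonNorm q t p m ^ n * ((e m).descFactorial n : ℂ))) := by
  induction n with
  | zero => simp
  | succ n ih =>
    rw [pow_succ', Module.End.mul_apply, ih, annihilation, LinearMap.smul_apply,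
      Derivation.coeFn_coe, MvPolynomial.pderiv_monomial, MvPolynomial.smul_monomial,
      tsub_tsub, ← Finsupp.single_add]
    congr 1
    rw [Nat.descFactorial_succ, Finsupp.tsub_apply, Finsupp.single_eq_same, smul_eq_mul]
    push_cast
    ring

theorem annihilationMonomial_monomial (k e : Mode →₀ ℕ) (c : ℂ) :
    annihilationMonomial q t p k (MvPolynomial.monomial e c) =
      MvPolynomial.monomial (e - k)
        (c * ∏ m ∈ k.support, (bosonNorm q t p m ^ k m * ((e m).descFactorial (k m) : ℂ))) := by
  classical
  have h (s : Finset Mode) (hs) :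
      s.noncommProd (fun m => annihilation q t p m ^ k m) hs (MvPolynomial.monomial e c) =
      MvPolynomial.monomial (e - ∑ m ∈ s, Finsupp.single m (k m))
        (c * ∏ m ∈ s, (bosonNorm q t p m ^ k m * ((e m).descFactorial (k m) : ℂ))) := by
    induction s using Finset.induction_on with
    | empty => simp
    | insert m s hm ih =>
      have h0 : (e - ∑ m ∈ s, Finsupp.single m (k m)) m = e m := by
        rw [Finsupp.tsub_apply, Finsupp.finsetSum_apply, Finset.sum_eq_zero, tsub_zero]
        intro i hi
        exact Finsupp.single_eq_of_ne fun h' => hm (h' ▸ hi)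
      rw [Finset.noncommProd_insert_of_notMem _ _ _ _ hm, Module.End.mul_apply, ih,
        annihilation_pow_monomial, h0, tsub_tsub, Finset.sum_insert hm, Finset.prod_insert hm,
        add_comm (Finsupp.single m (k m))]
      congr 1
      ring
  refine (h k.support fun m _ n _ _ => (annihilation_commute q t p m n).pow_pow _ _).trans ?_
  congr 3
  exact Finsupp.sum_single k

/-- The subtractions are truncated; whenever truncation occurs, a falling factorial on the right
vanishes, so no order condition on the exponents is needed. -/
theorem vev_monomials (k₁ k₂ k₃ k₄ : Mode →₀ ℕ) :
    vev (annihilationMonomial q t p k₁ * creationMonomial k₂ *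
        annihilationMonomial q t p k₃ * creationMonomial k₄) =
      if k₂ + (k₄ - k₃) - k₁ = 0 then
        (∏ m ∈ k₃.support, (bosonNorm q t p m ^ k₃ m * ((k₄ m).descFactorial (k₃ m) : ℂ))) *
          ∏ m ∈ k₁.support, (bosonNorm q t p m ^ k₁ m *
            (((k₂ + (k₄ - k₃)) m).descFactorial (k₁ m) : ℂ))
      else 0 := by
  classical
  rw [vev, Module.End.mul_apply, Module.End.mul_apply, Module.End.mul_apply,
    creationMonomial_apply k₄, mul_one, annihilationMonomial_monomial, creationMonomial_apply,
    MvPolynomial.monomial_mul, annihilationMonomial_monomial, MvPolynomial.constantCoeff_monomial]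
  simp only [one_mul]

theorem prod_descFactorial_eq_zero {k e : Mode →₀ ℕ} (h : ¬ k ≤ e) :
    ∏ m ∈ k.support, (bosonNorm q t p m ^ k m * ((e m).descFactorial (k m) : ℂ)) = 0 := by
  obtain ⟨m, hm⟩ := not_forall.mp h
  rw [not_le] at hm
  refine Finset.prod_eq_zero (i := m) (Finsupp.mem_support_iff.mpr (by omega)) ?_
  rw [Nat.descFactorial_eq_zero_iff_lt.mpr hm, Nat.cast_zero, mul_zero]

theorem vev_monomials_eq_zero {k₁ k₂ k₃ k₄ : Mode →₀ ℕ}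
    (h : ¬ (k₃ ≤ k₄ ∧ k₁ = k₂ + (k₄ - k₃))) :
    vev (annihilationMonomial q t p k₁ * creationMonomial k₂ *
        annihilationMonomial q t p k₃ * creationMonomial k₄) = 0 := by
  rw [vev_monomials]
  split_ifs with h1
  · by_cases h3 : k₃ ≤ k₄
    · rw [prod_descFactorial_eq_zero (k := k₁), mul_zero]
      exact fun h4 => h ⟨h3, le_antisymm h4 (tsub_eq_zero_iff_le.mp h1)⟩
    · rw [prod_descFactorial_eq_zero h3, zero_mul]
  · rfl

/-- Wick's theorem. The exponents `a`, `b`, `c` count the contractions of the first factor with the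
second, the third with the fourth, and the first with the fourth. The falling factorials turn the
factorials of `a + c` and `b + c` into those of the separate contractions. -/
theorem expTerm_mul_vev (α β γ δ : Mode → ℂ) (a b c : Mode →₀ ℕ) :
    expTerm α (a + c) * (expTerm β a * expTerm γ b) * expTerm δ (b + c) *
      vev (annihilationMonomial q t p (a + c) * creationMonomial a *
        annihilationMonomial q t p b * creationMonomial (b + c)) =
      expTerm (fun m => bosonNorm q t p m * α m * β m) a *
        expTerm (fun m => bosonNorm q t p m * δ m * γ m) b *
        expTerm (fun m => bosonNorm q t p m * α m * δ m) c := by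
  classical
  rw [vev_monomials, add_tsub_cancel_left, if_pos (tsub_self _)]
  set S := a.support ∪ b.support ∪ c.support with hS
  have ha : a.support ⊆ S := fun m hm => by simp [hS, Finsupp.mem_support_iff.mp hm]
  have hb : b.support ⊆ S := fun m hm => by simp [hS, Finsupp.mem_support_iff.mp hm]
  have hc : c.support ⊆ S := fun m hm => by simp [hS, Finsupp.mem_support_iff.mp hm]
  have hac : (a + c).support ⊆ S := Finsupp.support_add.trans (Finset.union_subset ha hc)
  have hbc : (b + c).support ⊆ S := Finsupp.support_add.trans (Finset.union_subset hb hc)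
  have hext (k e : Mode →₀ ℕ) (hk : k.support ⊆ S) :
      ∏ m ∈ k.support, (bosonNorm q t p m ^ k m * ((e m).descFactorial (k m) : ℂ)) =
        ∏ m ∈ S, (bosonNorm q t p m ^ k m * ((e m).descFactorial (k m) : ℂ)) :=
    Finset.prod_subset hk fun m _ hm => by simp [Finsupp.notMem_support_iff.mp hm]
  rw [expTerm_eq_prod _ ha, expTerm_eq_prod _ ha, expTerm_eq_prod _ hb, expTerm_eq_prod _ hb,
    expTerm_eq_prod _ hc, expTerm_eq_prod _ hac, expTerm_eq_prod _ hbc, hext _ _ hb, hext _ _ hac]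
  simp only [← Finset.prod_mul_distrib]
  refine Finset.prod_congr rfl fun m _ => ?_
  simp only [Finsupp.add_apply, Nat.descFactorial_self]
  have h1 := Nat.factorial_mul_descFactorial (Nat.le_add_right (b m) (c m))
  rw [Nat.add_sub_cancel_left] at h1
  have h2 : ((c m).factorial : ℂ) * ((b m + c m).descFactorial (b m) : ℂ) =
      ((b m + c m).factorial : ℂ) := by exact_mod_cast h1
  have f1 : ((c m).factorial : ℂ) ≠ 0 := Nat.cast_ne_zero.mpr (Nat.factorial_ne_zero _)
  have f2 : ((a m + c m).factorial : ℂ) ≠ 0 := Nat.cast_ne_zero.mpr (Nat.factorial_ne_zero _)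
  have f3 : ((b m + c m).factorial : ℂ) ≠ 0 := Nat.cast_ne_zero.mpr (Nat.factorial_ne_zero _)
  have h3 : ((b m + c m).descFactorial (b m) : ℂ) =
      ((b m + c m).factorial : ℂ) / ((c m).factorial : ℂ) := by
    rw [← h2]; field_simp
  rw [h3]
  field_simp
  ring

/-! ### Laurent degrees -/

/-- The `z`-degree of the coefficients of `(η(p; z))_-`. -/
def modeDegree : Mode → ℤ
  | Sum.inl n => n
  | Sum.inr n => -n

/-- The `z`-degree of a monomial of `(η(p; z))_-`. -/
def monomialDegree (k : Mode →₀ ℕ) : ℤ := k.sum fun m e => e * modeDegree m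

theorem coeff_expSeries_laurent (c : Mode → ℂ) (d : Mode → ℤ) (k : Mode →₀ ℕ) :
    MvPowerSeries.coeff k
        (expSeries fun m => LaurentPolynomial.C (c m) * LaurentPolynomial.T (d m)) =
      LaurentPolynomial.C (expTerm c k) * LaurentPolynomial.T (k.sum fun m e => e * d m) := by
  classical
  change (k.prod fun m e => ((e.factorial : ℂ)⁻¹) •
    (LaurentPolynomial.C (c m) * LaurentPolynomial.T (d m)) ^ e) = _
  have h (s : Finset Mode) : ∏ m ∈ s, ((k m).factorial : ℂ)⁻¹ •
      (LaurentPolynomial.C (c m) * LaurentPolynomial.T (d m)) ^ k m =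
      LaurentPolynomial.C (∏ m ∈ s, c m ^ k m / ((k m).factorial : ℂ)) *
        LaurentPolynomial.T (∑ m ∈ s, (k m : ℤ) * d m) := by
    induction s using Finset.induction_on with
    | empty => simp
    | insert m s hm ih =>
      rw [Finset.prod_insert hm, Finset.prod_insert hm, Finset.sum_insert hm, ih,
        LaurentPolynomial.smul_eq_C_mul, mul_pow, ← map_pow, LaurentPolynomial.T_pow,
        LaurentPolynomial.T_add, map_mul, div_eq_inv_mul, map_mul]
      ring
  exact h k.support

theorem coeff_zero_C_mul_T (x y : ℂ) (m n : ℤ) :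
    ((LaurentPolynomial.C x * LaurentPolynomial.T m) *
      (LaurentPolynomial.C y * LaurentPolynomial.T n)).coeff 0 =
      if m + n = 0 then x * y else 0 := by
  rw [mul_mul_mul_comm, ← map_mul, ← LaurentPolynomial.T_add,
    ← LaurentPolynomial.single_eq_C_mul_T, AddMonoidAlgebra.coeff_single, Finsupp.single_apply]

end EllipticKernel

namespace EllipticKernel

/-! ### Exponents of infinite products as sums over modes -/

/-- The terms of `-log (u; q, p)_∞`. -/
noncomputable def pochLogTerm (q p u : ℂ) (n : ℕ+) : ℂ :=
  u ^ (n : ℕ) / ((1 - q ^ (n : ℕ)) * (1 - p ^ (n : ℕ))) / (n : ℂ)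

/-- `-log (u; q, p)_∞`. -/
noncomputable def pochLog (q p u : ℂ) : ℂ := ∑' n, pochLogTerm q p u n

variable {q t p : ℂ}

theorem one_sub_pow_ne_zero {a : ℂ} (ha : ‖a‖ < 1) (n : ℕ+) : 1 - a ^ (n : ℕ) ≠ 0 := fun h => by
  have h1 := congrArg norm (sub_eq_zero.mp h)
  rw [norm_one, norm_pow] at h1
  exact (pow_lt_one₀ (norm_nonneg a) ha n.ne_zero).ne h1.symm

theorem one_sub_norm_le (a : ℂ) (ha : ‖a‖ < 1) (n : ℕ) (hn : n ≠ 0) :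
    1 - ‖a‖ ≤ ‖1 - a ^ n‖ := by
  have h1 : ‖a ^ n‖ ≤ ‖a‖ := by
    rw [norm_pow]; exact pow_le_of_le_one (norm_nonneg a) ha.le hn
  have h2 := norm_sub_norm_le 1 (a ^ n)
  rw [norm_one] at h2
  linarith

theorem hasSum_pochLogTerm (hq : ‖q‖ < 1) (hp : ‖p‖ < 1) {u : ℂ} (hu : ‖u‖ < 1) :
    HasSum (pochLogTerm q p u) (pochLog q p u) := by
  refine Summable.hasSum ?_
  refine (summable_pnat_iff_summable_nat
    (f := fun n : ℕ => u ^ n / ((1 - q ^ n) * (1 - p ^ n)) / (n : ℂ))).mpr ?_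
  have hq' : 0 < 1 - ‖q‖ := by linarith
  have hp' : 0 < 1 - ‖p‖ := by linarith
  refine .of_norm_bounded ((summable_geometric_of_lt_one (norm_nonneg u) hu).div_const
    ((1 - ‖q‖) * (1 - ‖p‖))) fun n => ?_
  rcases eq_or_ne n 0 with rfl | hn
  · simp; positivity
  · have h1 := one_sub_norm_le q hq n hn
    have h2 := one_sub_norm_le p hp n hn
    have h3 : (1 : ℝ) ≤ ‖(n : ℂ)‖ := by
      rw [Complex.norm_natCast]; exact_mod_cast Nat.one_le_iff_ne_zero.mpr hn
    rw [norm_div, norm_div, norm_mul, norm_pow]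
    refine (div_le_self (by positivity) h3).trans ?_
    gcongr

theorem exp_pochLog (hq : ‖q‖ < 1) (hp : ‖p‖ < 1) {u : ℂ} (hu : ‖u‖ < 1) :
    Complex.exp (pochLog q p u) = (qpPoch q p u)⁻¹ := by
  rw [← exp_tsum_eq_qpPoch_inv hq hp hu, pochLog]
  congr 1
  refine (tsum_pnat_eq_tsum_succ
    (f := fun n : ℕ => u ^ n / ((1 - q ^ n) * (1 - p ^ n)) / (n : ℂ))).trans ?_
  push_cast
  rfl

theorem pochLogTerm_zero (p u : ℂ) (n : ℕ+) :
    pochLogTerm 0 p u n = u ^ (n : ℕ) / (1 - p ^ (n : ℕ)) / (n : ℂ) := by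
  simp [pochLogTerm]

/-- Single products are taken as double ones with `q = 0`; the leftover `(p; p)_∞` cancels in every
quotient of theta functions. -/
theorem exp_thetaLog (hp : ‖p‖ < 1) {u : ℂ} (hu : ‖u‖ < 1) (hu' : ‖p * u⁻¹‖ < 1) :
    Complex.exp (pochLog 0 p u + pochLog 0 p (p * u⁻¹)) = qPoch p p / theta p u := by
  have h := qPoch_self_ne_zero hp
  rw [Complex.exp_add, exp_pochLog norm_zero_lt_one hp hu, exp_pochLog norm_zero_lt_one hp hu',
    ← qPoch_eq_qpPoch_zero, ← qPoch_eq_qpPoch_zero, theta, ← mul_inv, mul_assoc,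
    div_mul_cancel_left₀ h]

theorem exp_gammaLog (hq : ‖q‖ < 1) (hp : ‖p‖ < 1) {u : ℂ} (hu : ‖u‖ < 1)
    (hu' : ‖q * p * u⁻¹‖ < 1) :
    Complex.exp (pochLog q p u - pochLog q p (q * p * u⁻¹)) = ellGamma q p u := by
  rw [Complex.exp_sub, exp_pochLog hq hp hu, exp_pochLog hq hp hu', inv_div_inv, ellGamma]

/-! ### Pairings of the exponents -/

/-- `x^{±n}`. -/
noncomputable def modePow (x : ℂ) : Mode → ℂ
  | Sum.inl n => x ^ (n : ℕ)
  | Sum.inr n => (x ^ (n : ℕ))⁻¹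

/-- The constants in the exponent of `(η(p; z))_-`. -/
noncomputable def etaMinusConst (t p : ℂ) : Mode → ℂ
  | Sum.inl n => (1 - t⁻¹ ^ (n : ℕ)) / (1 - p ^ (n : ℕ)) / (n : ℂ)
  | Sum.inr n => (1 - t ^ (n : ℕ)) * p ^ (n : ℕ) / (1 - p ^ (n : ℕ)) / (n : ℂ)

/-- The constants in the exponent of `(η(p; p⁻¹ z))_+`. -/
noncomputable def etaPlusConst (t p : ℂ) : Mode → ℂ
  | Sum.inl n => -((1 - t ^ (n : ℕ)) * p ^ (n : ℕ) / (1 - p ^ (n : ℕ)) / (n : ℂ))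
  | Sum.inr n => -((1 - t⁻¹ ^ (n : ℕ)) / (1 - p ^ (n : ℕ)) / (n : ℂ))

theorem etaMinusCoeff_eq (t p : ℂ) : etaMinusCoeff t p 1 = fun m =>
    LaurentPolynomial.C (etaMinusConst t p m) * LaurentPolynomial.T (modeDegree m) := by
  ext1 m
  rcases m with n | n
  · have h : -((1 - t ^ (-(n : ℤ))) / (1 - p ^ (-(n : ℤ)).natAbs)) *
        (1 ^ (-(-(n : ℤ))) / ((-(n : ℤ) : ℤ) : ℂ)) = etaMinusConst t p (Sum.inl n) := by
      simp [etaMinusConst]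
      ring
    rw [etaMinusCoeff, etaCoeffA, h, neg_neg]
    rfl
  · have h : -((1 - t ^ (-(-(n : ℤ)))) / (1 - p ^ (-(n : ℤ)).natAbs) * p ^ (-(n : ℤ)).natAbs) *
        (1 ^ (-(n : ℤ)) / ((-(n : ℤ) : ℤ) : ℂ)) = etaMinusConst t p (Sum.inr n) := by
      simp [etaMinusConst]
      ring
    rw [etaMinusCoeff, etaCoeffB, h]
    rfl

/-- Evaluation at `p⁻¹ z` moves the factor `p^n` from the `b`-modes to the `a`-modes, the reverse of
the situation in `etaMinusConst`. -/
theorem etaPlusCoeff_eq (t : ℂ) (hp0 : p ≠ 0) : etaPlusCoeff t p p⁻¹ = fun m =>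
    LaurentPolynomial.C (etaPlusConst t p m) * LaurentPolynomial.T (-modeDegree m) := by
  ext1 m
  rcases m with n | n
  · have h : -((1 - t ^ (n : ℤ)) / (1 - p ^ (n : ℤ).natAbs)) *
        (p⁻¹ ^ (-(n : ℤ)) / ((n : ℤ) : ℂ)) = etaPlusConst t p (Sum.inl n) := by
      simp [etaPlusConst]
      ring
    rw [etaPlusCoeff, etaCoeffA, h]
    rfl
  · have h : -((1 - t ^ (-(n : ℤ))) / (1 - p ^ (n : ℤ).natAbs) * p ^ (n : ℤ).natAbs) *
        (p⁻¹ ^ (n : ℤ) / ((n : ℤ) : ℂ)) = etaPlusConst t p (Sum.inr n) := by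
      have hpn : p ^ (n : ℕ) ≠ 0 := pow_ne_zero _ hp0
      simp [etaPlusConst]
      field_simp
    rw [etaPlusCoeff, etaCoeffB, h, modeDegree, neg_neg]

/-- The commutators are normalised so that contracting with `φ` or `φ*` substitutes a pure power of
the variable. As `1 - t^n` occurs in their denominators, `t` must not be a root of unity. -/
theorem bosonNorm_mul_phiCoeff (hq0 : q ≠ 0) (hq : ‖q‖ < 1) (ht : t ≠ 0)
    (ht1 : ∀ n : ℕ, 0 < n → t ^ n ≠ 1) (hp0 : p ≠ 0) (hp : ‖p‖ < 1) (x : ℂ) (m : Mode) :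
    bosonNorm q t p m * phiCoeff q t p x m = modePow x m := by
  have h1 (n : ℕ+) : 1 - t ^ (n : ℕ) ≠ 0 := sub_ne_zero.mpr (ht1 n n.pos).symm
  have h2 (n : ℕ+) : (n : ℂ) ≠ 0 := Nat.cast_ne_zero.mpr n.ne_zero
  have h3 (n : ℕ+) : (q * t⁻¹ * p) ^ (n : ℕ) ≠ 0 :=
    pow_ne_zero _ (mul_ne_zero (mul_ne_zero hq0 (inv_ne_zero ht)) hp0)
  rcases m with n | n <;> have h1 := h1 n <;> have h2 := h2 n <;> have h3 := h3 n <;>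
    have h4 := one_sub_pow_ne_zero hq n <;> have h5 := one_sub_pow_ne_zero hp n <;>
    simp only [bosonNorm, phiCoeff, modePow]
  · field_simp
  · generalize (q * t⁻¹ * p) ^ (n : ℕ) = A at h3 ⊢
    field_simp

/-- The `a`-modes give the powers of `xz`, the `b`-modes those of `p/(xz)`: together the two halves
of the logarithm of a theta quotient. -/
theorem hasSum_modePow_etaMinus (hp : ‖p‖ < 1) {x z : ℂ}
    (h1 : ‖x * z‖ < 1) (h2 : ‖t⁻¹ * x * z‖ < 1) (h3 : ‖p * (x * z)⁻¹‖ < 1)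
    (h4 : ‖p * (t⁻¹ * x * z)⁻¹‖ < 1) :
    HasSum (fun m => modePow x m * etaMinusConst t p m * z ^ modeDegree m)
      ((pochLog 0 p (x * z) + pochLog 0 p (p * (x * z)⁻¹)) -
        (pochLog 0 p (t⁻¹ * x * z) + pochLog 0 p (p * (t⁻¹ * x * z)⁻¹))) := by
  rw [add_sub_add_comm]
  have h0 := norm_zero_lt_one
  refine HasSum.sum ?_ ?_
  · convert! (hasSum_pochLogTerm h0 hp h1).sub (hasSum_pochLogTerm h0 hp h2) using 2 with n
    simp only [Function.comp, modePow, etaMinusConst, modeDegree, pochLogTerm_zero, mul_pow]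
    rw [show (z ^ ((n : ℕ+) : ℤ)) = z ^ (n : ℕ) from zpow_natCast z n]
    ring
  · convert! (hasSum_pochLogTerm h0 hp h3).sub (hasSum_pochLogTerm h0 hp h4) using 2 with n
    simp only [Function.comp, modePow, etaMinusConst, modeDegree, pochLogTerm_zero, mul_pow,
      inv_pow, mul_inv, inv_inv]
    rw [show (z ^ (-((n : ℕ+) : ℤ))) = (z ^ (n : ℕ))⁻¹ by rw [zpow_neg]; congr 1]
    ring

theorem hasSum_modePow_etaPlus (hp : ‖p‖ < 1) {y z : ℂ}
    (h1 : ‖t⁻¹ * z / y‖ < 1) (h2 : ‖z / y‖ < 1) (h3 : ‖p * (t⁻¹ * z / y)⁻¹‖ < 1)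
    (h4 : ‖p * (z / y)⁻¹‖ < 1) :
    HasSum (fun m => modePow y m * etaPlusConst t p m * z ^ (-modeDegree m))
      ((pochLog 0 p (t⁻¹ * z / y) + pochLog 0 p (p * (t⁻¹ * z / y)⁻¹)) -
        (pochLog 0 p (z / y) + pochLog 0 p (p * (z / y)⁻¹))) := by
  rw [add_sub_add_comm, add_comm]
  have h0 := norm_zero_lt_one
  refine HasSum.sum ?_ ?_
  · convert! (hasSum_pochLogTerm h0 hp h3).sub (hasSum_pochLogTerm h0 hp h4) using 2 with n
    simp only [Function.comp, modePow, etaPlusConst, modeDegree, pochLogTerm_zero, mul_pow,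
      inv_pow, mul_inv, inv_inv, div_eq_mul_inv]
    rw [show (z ^ (-((n : ℕ+) : ℤ))) = (z ^ (n : ℕ))⁻¹ by rw [zpow_neg]; congr 1]
    ring
  · convert! (hasSum_pochLogTerm h0 hp h1).sub (hasSum_pochLogTerm h0 hp h2) using 2 with n
    simp only [Function.comp, modePow, etaPlusConst, modeDegree, pochLogTerm_zero, mul_pow,
      div_eq_mul_inv, neg_neg]
    rw [show (z ^ ((n : ℕ+) : ℤ)) = z ^ (n : ℕ) from zpow_natCast z n]
    ring

theorem hasSum_modePow_phi (hq : ‖q‖ < 1) (hp : ‖p‖ < 1) {x y : ℂ}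
    (h1 : ‖x * y‖ < 1) (h2 : ‖t * x * y‖ < 1) (h3 : ‖q * p * (x * y)⁻¹‖ < 1)
    (h4 : ‖q * p * (t * x * y)⁻¹‖ < 1) (ht : t ≠ 0) :
    HasSum (fun m => modePow x m * phiCoeff q t p y m)
      ((pochLog q p (x * y) - pochLog q p (q * p * (x * y)⁻¹)) -
        (pochLog q p (t * x * y) - pochLog q p (q * p * (t * x * y)⁻¹))) := by
  have e : (pochLog q p (x * y) - pochLog q p (q * p * (x * y)⁻¹)) -
        (pochLog q p (t * x * y) - pochLog q p (q * p * (t * x * y)⁻¹)) =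
      (pochLog q p (x * y) - pochLog q p (t * x * y)) +
        (pochLog q p (q * p * (t * x * y)⁻¹) - pochLog q p (q * p * (x * y)⁻¹)) := by ring
  rw [e]
  refine HasSum.sum ?_ ?_
  · convert! (hasSum_pochLogTerm hq hp h1).sub (hasSum_pochLogTerm hq hp h2) using 2 with n
    simp only [Function.comp, modePow, phiCoeff, pochLogTerm, mul_pow]
    ring
  · convert! (hasSum_pochLogTerm hq hp h4).sub (hasSum_pochLogTerm hq hp h3) using 2 with n
    have : t ^ (n : ℕ) ≠ 0 := pow_ne_zero _ ht
    simp only [Function.comp, modePow, phiCoeff, pochLogTerm, mul_pow, inv_pow, mul_inv]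
    field_simp

end EllipticKernel

namespace EllipticKernel

/-! ### The matrix element of the free field representation -/

theorem expTerm_mul_zpow {σ : Type*} (h : σ → ℂ) (d : σ → ℤ) {z : ℂ} (hz : z ≠ 0) (k : σ →₀ ℕ) :
    expTerm (fun m => h m * z ^ d m) k = expTerm h k * z ^ (k.sum fun m e => e * d m) := by
  have hs (s : Finset σ) : ∏ m ∈ s, (h m * z ^ d m) ^ k m / ((k m).factorial : ℂ) =
      (∏ m ∈ s, h m ^ k m / ((k m).factorial : ℂ)) * z ^ ∑ m ∈ s, (k m : ℤ) * d m := by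
    classical
    induction s using Finset.induction_on with
    | empty => simp
    | insert m s hm ih =>
      rw [Finset.prod_insert hm, Finset.prod_insert hm, Finset.sum_insert hm, ih,
        zpow_add₀ hz, mul_pow, mul_comm (k m : ℤ), zpow_mul, zpow_natCast]
      ring
  exact hs k.support

theorem sum_neg_modeDegree (k : Mode →₀ ℕ) :
    (k.sum fun m e => (e : ℤ) * -modeDegree m) = -monomialDegree k := by
  simp [monomialDegree, Finsupp.sum]

/-- The monomials exchanged between the four factors of the matrix element. -/
noncomputable def wickIndex (k : ((Mode →₀ ℕ) × (Mode →₀ ℕ)) × (Mode →₀ ℕ)) :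
    (Mode →₀ ℕ) × (Mode →₀ ℕ) × (Mode →₀ ℕ) × (Mode →₀ ℕ) :=
  (k.1.1 + k.2, k.1.1, k.1.2, k.1.2 + k.2)

theorem wickIndex_injective : Function.Injective wickIndex := by
  rintro ⟨⟨a, b⟩, c⟩ ⟨⟨a', b'⟩, c'⟩ h
  simp only [wickIndex, Prod.mk.injEq] at h
  obtain ⟨h1, rfl, rfl, -⟩ := h
  rw [add_left_cancel h1]

variable {M N : ℕ} {q t p : ℂ} {x : Fin M → ℂ} {y : Fin N → ℂ}

/-- A nonzero expectation value needs every `η₊` annihilator matched by a creator of `φ`, and all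
remaining creators matched by `φ*`; such exponents are exactly those in the range. -/
theorem matrixElementTerm_eq_zero {k} (hk : k ∉ Set.range wickIndex) :
    matrixElementTerm M N q t p x y k = 0 := by
  rw [matrixElementTerm, vev_monomials_eq_zero, mul_zero]
  rintro ⟨h1, h2⟩
  refine hk ⟨((k.2.1, k.2.2.1), k.2.2.2 - k.2.2.1), ?_⟩
  simp only [wickIndex, ← h2, add_tsub_cancel_of_le h1]

theorem matrixElementTerm_wickIndex (hp0 : p ≠ 0)
    (k : ((Mode →₀ ℕ) × (Mode →₀ ℕ)) × (Mode →₀ ℕ)) :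
    matrixElementTerm M N q t p x y (wickIndex k) =
      (if monomialDegree k.1.1 - monomialDegree k.1.2 = 0 then
        expTerm (fun m => bosonNorm q t p m * (∑ i, phiCoeff q t p (x i) m) *
          etaMinusConst t p m) k.1.1 *
        expTerm (fun m => bosonNorm q t p m * (∑ j, phiCoeff q t p (y j) m) *
          etaPlusConst t p m) k.1.2 else 0) *
      expTerm (fun m => bosonNorm q t p m * (∑ i, phiCoeff q t p (x i) m) *
        ∑ j, phiCoeff q t p (y j) m) k.2 := by
  obtain ⟨⟨a, b⟩, c⟩ := k
  simp only [matrixElementTerm, wickIndex]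
  rw [coeff_prod_expSeries, coeff_prod_expSeries, etaMinusCoeff_eq, etaPlusCoeff_eq t hp0,
    coeff_expSeries_laurent, coeff_expSeries_laurent, coeff_zero_C_mul_T, sum_neg_modeDegree,
    ← monomialDegree, ← sub_eq_add_neg]
  split_ifs with h
  · exact expTerm_mul_vev _ _ _ _ a b c
  · simp

theorem hasSum_expTerm_of_hasSum {σ : Type*} {h : σ → ℂ} {s : ℂ} (hh : HasSum h s) :
    HasSum (expTerm h) (Complex.exp s) :=
  hh.tsum_eq ▸ hasSum_expTerm hh.summable.norm

theorem hasSum_mul_prod {ι κ : Type*} {f : ι → ℂ} {g : κ → ℂ} {a b : ℂ} (hf : HasSum f a)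
    (hg : HasSum g b) : HasSum (fun k : ι × κ => f k.1 * g k.2) (a * b) := by
  rw [← hf.tsum_eq, ← hg.tsum_eq, tsum_mul_tsum_of_summable_norm hf.summable.norm
    hg.summable.norm]
  exact (summable_mul_of_summable_norm hf.summable.norm hg.summable.norm).hasSum

theorem exp_thetaLog_sub (hp : ‖p‖ < 1) {u v : ℂ} (hu : ‖u‖ < 1) (hu' : ‖p * u⁻¹‖ < 1)
    (hv : ‖v‖ < 1) (hv' : ‖p * v⁻¹‖ < 1) :
    Complex.exp ((pochLog 0 p u + pochLog 0 p (p * u⁻¹)) -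
      (pochLog 0 p v + pochLog 0 p (p * v⁻¹))) = theta p v / theta p u := by
  rw [Complex.exp_sub, exp_thetaLog hp hu hu', exp_thetaLog hp hv hv',
    div_div_div_cancel_left' _ _ (qPoch_self_ne_zero hp)]

theorem hasSum_expTerm_etaMinus (hp : ‖p‖ < 1) {z : ℂ} (hz : z ≠ 0)
    (h1 : ∀ i, ‖x i * z‖ < 1) (h2 : ∀ i, ‖t⁻¹ * x i * z‖ < 1)
    (h3 : ∀ i, ‖p * (x i * z)⁻¹‖ < 1) (h4 : ∀ i, ‖p * (t⁻¹ * x i * z)⁻¹‖ < 1) :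
    HasSum (fun k => expTerm (fun m => (∑ i, modePow (x i) m) * etaMinusConst t p m) k *
        z ^ monomialDegree k)
      (∏ i, theta p (t⁻¹ * x i * z) / theta p (x i * z)) := by
  have h := hasSum_expTerm_of_hasSum (hasSum_sum fun i (_ : i ∈ Finset.univ) =>
    hasSum_modePow_etaMinus hp (h1 i) (h2 i) (h3 i) (h4 i))
  rw [Complex.exp_sum] at h
  convert! h using 2 with k i
  · rw [monomialDegree, ← expTerm_mul_zpow _ _ hz]
    simp only [Finset.sum_mul]
  · exact (exp_thetaLog_sub hp (h1 _) (h3 _) (h2 _) (h4 _)).symm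

theorem hasSum_expTerm_etaPlus (hp : ‖p‖ < 1) {z : ℂ} (hz : z ≠ 0)
    (h1 : ∀ j, ‖t⁻¹ * z / y j‖ < 1) (h2 : ∀ j, ‖z / y j‖ < 1)
    (h3 : ∀ j, ‖p * (t⁻¹ * z / y j)⁻¹‖ < 1) (h4 : ∀ j, ‖p * (z / y j)⁻¹‖ < 1) :
    HasSum (fun k => expTerm (fun m => (∑ j, modePow (y j) m) * etaPlusConst t p m) k *
        z ^ (-monomialDegree k))
      (∏ j, theta p (z / y j) / theta p (t⁻¹ * z / y j)) := by
  have h := hasSum_expTerm_of_hasSum (hasSum_sum fun j (_ : j ∈ Finset.univ) =>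
    hasSum_modePow_etaPlus hp (h1 j) (h2 j) (h3 j) (h4 j))
  rw [Complex.exp_sum] at h
  convert! h using 2 with k j
  · rw [← sum_neg_modeDegree, ← expTerm_mul_zpow _ _ hz]
    simp only [Finset.sum_mul]
  · exact (exp_thetaLog_sub hp (h1 _) (h3 _) (h2 _) (h4 _)).symm

theorem norm_mul_inv_lt_one {a b : ℂ} (h : ‖a‖ < ‖b‖) : ‖a * b⁻¹‖ < 1 := by
  rw [norm_mul, norm_inv, ← div_eq_mul_inv]
  exact (div_lt_one ((norm_nonneg a).trans_lt h)).mpr h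

/-- The sum is left indexed by pairs of boson exponents, not collected by powers of `z`, so that its
degree-zero part matches the matrix element term by term. -/
theorem hasSum_expTerm_thetaRatio (hp : ‖p‖ < 1) {r : ℝ} (hr : 0 < r)
    (hx : ∀ i, ‖x i‖ * r < 1 ∧ ‖t⁻¹ * x i‖ * r < 1 ∧ ‖p‖ < ‖x i‖ * r ∧ ‖t * p‖ < ‖x i‖ * r)
    (hy : ∀ j, ‖p * y j‖ < r ∧ ‖t * p * y j‖ < r ∧ r < ‖y j‖ ∧ r < ‖t * y j‖)
    {z : ℂ} (hz : z ∈ Metric.sphere (0 : ℂ) r) :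
    HasSum (fun k : (Mode →₀ ℕ) × (Mode →₀ ℕ) =>
      expTerm (fun m => (∑ i, modePow (x i) m) * etaMinusConst t p m) k.1 *
        expTerm (fun m => (∑ j, modePow (y j) m) * etaPlusConst t p m) k.2 *
        z ^ (monomialDegree k.1 - monomialDegree k.2))
      (thetaRatio M N t p x y z) := by
  have hzr : ‖z‖ = r := mem_sphere_zero_iff_norm.mp hz
  have hz0 : z ≠ 0 := norm_pos_iff.mp (hzr ▸ hr)
  have hminus := hasSum_expTerm_etaMinus (t := t) (x := x) hp hz0
    (fun i => by rw [norm_mul, hzr]; exact (hx i).1)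
    (fun i => by rw [norm_mul, hzr]; exact (hx i).2.1)
    (fun i => norm_mul_inv_lt_one (by rw [norm_mul, hzr]; exact (hx i).2.2.1))
    (fun i => by
      have := norm_mul_inv_lt_one (a := t * p) (b := x i * z)
        (by rw [norm_mul (x i), hzr]; exact (hx i).2.2.2)
      convert this using 2
      rw [mul_assoc t⁻¹, mul_inv t⁻¹, inv_inv]
      ring)
  have hplus := hasSum_expTerm_etaPlus (t := t) (y := y) hp hz0
    (fun j => by
      have := norm_mul_inv_lt_one (a := z) (b := t * y j) (hzr ▸ (hy j).2.2.2)
      convert this using 2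
      rw [mul_inv]
      ring)
    (fun j => norm_mul_inv_lt_one (hzr ▸ (hy j).2.2.1))
    (fun j => by
      have := norm_mul_inv_lt_one (a := t * p * y j) (b := z) (hzr ▸ (hy j).2.1)
      convert this using 2
      rw [inv_div, div_eq_mul_inv, mul_inv, inv_inv]
      ring)
    (fun j => by
      have := norm_mul_inv_lt_one (a := p * y j) (b := z) (hzr ▸ (hy j).1)
      convert this using 2
      rw [inv_div]
      ring)
  rw [thetaRatio]
  convert! hasSum_mul_prod hminus hplus using 2 with k
  rw [sub_eq_add_neg, zpow_add₀ hz0]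
  ring

theorem hasSum_expTerm_ellKernel (hq : ‖q‖ < 1) (hp : ‖p‖ < 1) (ht : t ≠ 0)
    (h : ∀ i j, ‖x i * y j‖ < 1 ∧ ‖t * x i * y j‖ < 1 ∧
      ‖q * p‖ < ‖x i * y j‖ ∧ ‖q * p‖ < ‖t * x i * y j‖) :
    HasSum (expTerm fun m => (∑ i, modePow (x i) m) * ∑ j, phiCoeff q t p (y j) m)
      (ellKernel M N q t p x y) ∧ ellKernel M N q t p x y ≠ 0 := by
  have h3 (i j) := norm_mul_inv_lt_one (h i j).2.2.1
  have h4 (i j) := norm_mul_inv_lt_one (h i j).2.2.2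
  have hs := hasSum_sum fun i (_ : i ∈ Finset.univ) => hasSum_sum fun j (_ : j ∈ Finset.univ) =>
    hasSum_modePow_phi hq hp (h i j).1 (h i j).2.1 (h3 i j) (h4 i j) ht
  have he : ellKernel M N q t p x y = Complex.exp (∑ i, ∑ j,
      ((pochLog q p (x i * y j) - pochLog q p (q * p * (x i * y j)⁻¹)) -
        (pochLog q p (t * x i * y j) - pochLog q p (q * p * (t * x i * y j)⁻¹)))) := by
    simp only [Complex.exp_sum, ellKernel]
    refine Finset.prod_congr rfl fun i _ => Finset.prod_congr rfl fun j _ => ?_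
    rw [Complex.exp_sub, exp_gammaLog hq hp (h i j).1 (h3 i j),
      exp_gammaLog hq hp (h i j).2.1 (h4 i j)]
  rw [he]
  refine ⟨?_, Complex.exp_ne_zero _⟩
  convert! hasSum_expTerm_of_hasSum hs using 2
  ext1 m
  rw [Finset.sum_mul_sum]

theorem ellC_eq_matrixElement_div (hM : 0 < M) (hN : 0 < N) (hq0 : q ≠ 0) (hq : ‖q‖ < 1)
    (ht : t ≠ 0) (hp0 : p ≠ 0) (hp : ‖p‖ < 1) (ht1 : ∀ n : ℕ, 0 < n → t ^ n ≠ 1)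
    (h : FreeFieldRegion M N q t p x y) :
    Summable (matrixElementTerm M N q t p x y) ∧ ellKernel M N q t p x y ≠ 0 ∧
      ellC M N t p x y = matrixElement M N q t p x y / ellKernel M N q t p x y := by
  obtain ⟨hxy, r, hr, hx, hy⟩ := h
  obtain ⟨hkernel, hne⟩ := hasSum_expTerm_ellKernel hq hp ht hxy
  have hx0 (i) : x i ≠ 0 := left_ne_zero_of_mul
    (norm_pos_iff.mp ((norm_nonneg _).trans_lt (hxy i ⟨0, hN⟩).2.2.1))
  have hy0 (j) : y j ≠ 0 := norm_pos_iff.mp (hr.trans (hy j).2.2.1)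
  have hpole (k) : ‖p‖ < ‖poleInv t x y k‖ * r ∧ ‖poleInv t x y k‖ * r < 1 := by
    rcases k with i | j
    · exact ⟨(hx i).2.2.1, (hx i).1⟩
    · have hty : 0 < ‖t‖ * ‖y j‖ := by
        have := hy0 j
        positivity
      have h1 := (hy j).2.1
      have h2 := (hy j).2.2.2
      rw [norm_mul, norm_mul] at h1
      rw [norm_mul] at h2
      simp only [poleInv, Sum.elim_inr]
      rw [norm_mul, norm_inv, norm_inv, ← mul_inv, ← div_eq_inv_mul]
      exact ⟨(lt_div_iff₀ hty).mpr (by linarith), (div_lt_one hty).mpr h2⟩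
  -- Averaging over `|z| = r` selects the pairs of equal degree, the same selection that `[·]_1`
  -- makes in the matrix element.
  have hC := hasSum_circleAverage hr fun z hz => hasSum_expTerm_thetaRatio hp hr hx hy hz
  rw [← ellC_eq_circleAverage hM hp ht hx0 hy0 hr hpole] at hC
  have hnorm (m : Mode) {κ : Type} [Fintype κ] (w : κ → ℂ) :
      bosonNorm q t p m * ∑ i, phiCoeff q t p (w i) m = ∑ i, modePow (w i) m := by
    rw [Finset.mul_sum]
    exact Finset.sum_congr rfl fun i _ => bosonNorm_mul_phiCoeff hq0 hq ht ht1 hp0 hp (w i) m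
  have hcomp : HasSum (matrixElementTerm M N q t p x y ∘ wickIndex)
      (ellC M N t p x y * ellKernel M N q t p x y) := by
    convert! hasSum_mul_prod hC hkernel using 2 with k
    rw [Function.comp_apply, matrixElementTerm_wickIndex hp0]
    simp only [hnorm]
  have hsum : HasSum (matrixElementTerm M N q t p x y)
      (ellC M N t p x y * ellKernel M N q t p x y) :=
    (wickIndex_injective.hasSum_iff fun _ => matrixElementTerm_eq_zero).mp hcomp
  exact ⟨hsum.summable, hne, by rw [matrixElement, hsum.tsum_eq, mul_div_cancel_right₀ _ hne]⟩

end EllipticKernel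

theorem theorem3p2 (M N : ℕ) (hM : 0 < M) (hN : 0 < N) (q t : ℂ) (hq : q ≠ 0) (hq1 : ‖q‖ < 1)
    (ht : t ≠ 0) :
    -- the functional equation
    (∀ (p : ℂ) (x : Fin M → ℂ) (y : Fin N → ℂ), ‖p‖ < 1 → (∀ k : ℤ, t ≠ p ^ k) →
      (∀ i, x i ≠ 0) → (∀ j, y j ≠ 0) → Function.Injective x → Function.Injective y →
      (∀ i j, ∀ m n : ℕ, x i * y j * q ^ m * p ^ n ≠ 1) →
      (expansionDomain M N t p x y).Nonempty →
      (∃ a, HasLaurentExpansionOn (thetaRatio M N t p x y) (expansionDomain M N t p x y) a) ∧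
      ellMacdonald M q t p (fun x' => ellKernel M N q t p x' y) x -
          t ^ ((M : ℤ) - (N : ℤ)) * ellMacdonald N q t p (fun y' => ellKernel M N q t p x y') y =
        (1 - t ^ ((M : ℤ) - (N : ℤ))) * qPoch p p ^ 3 / theta p t *
          ellC M N t p x y * ellKernel M N q t p x y) ∧
    -- the two expressions for `C_{MN}` agree
    (∀ (p : ℂ) (x : Fin M → ℂ) (y : Fin N → ℂ), p ≠ 0 → ‖p‖ < 1 → (∀ n : ℕ, 0 < n → t ^ n ≠ 1) →
      FreeFieldRegion M N q t p x y →
      Summable (matrixElementTerm M N q t p x y) ∧ ellKernel M N q t p x y ≠ 0 ∧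
      ellC M N t p x y = matrixElement M N q t p x y / ellKernel M N q t p x y) ∧
    -- the limit `p → 0`
    (∀ (x : Fin M → ℂ) (y : Fin N → ℂ), t ≠ 1 →
      (∀ i, x i ≠ 0) → (∀ j, y j ≠ 0) → Function.Injective x → Function.Injective y →
      (∀ i j, ∀ m : ℕ, x i * y j * q ^ m ≠ 1) →
      Tendsto (fun p => ellC M N t p x y) (𝓝[≠] 0) (𝓝 1) ∧
      Tendsto (fun p => ellMacdonald M q t p (fun x' => ellKernel M N q t p x' y) x -
          t ^ ((M : ℤ) - (N : ℤ)) * ellMacdonald N q t p (fun y' => ellKernel M N q t p x y') y)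
        (𝓝[≠] 0)
        (𝓝 (trigMacdonald M q t (fun x' => trigKernel M N q t x' y) x -
          t ^ ((M : ℤ) - (N : ℤ)) * trigMacdonald N q t (fun y' => trigKernel M N q t x y') y)) ∧
      Tendsto (fun p => (1 - t ^ ((M : ℤ) - (N : ℤ))) * qPoch p p ^ 3 / theta p t *
          ellC M N t p x y * ellKernel M N q t p x y)
        (𝓝[≠] 0)
        (𝓝 ((1 - t ^ ((M : ℤ) - (N : ℤ))) / (1 - t) * trigKernel M N q t x y)) ∧
      trigMacdonald M q t (fun x' => trigKernel M N q t x' y) x -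
          t ^ ((M : ℤ) - (N : ℤ)) * trigMacdonald N q t (fun y' => trigKernel M N q t x y') y =
        (1 - t ^ ((M : ℤ) - (N : ℤ))) / (1 - t) * trigKernel M N q t x y) := by
  exact ⟨fun p x y hp htp hx hy hxi hyi hxy hne =>
      ⟨exists_expansion_thetaRatio hM hp ht hx hy,
        functional_equation hM hq hq1 ht hp htp hx hy hxi hyi hxy hne⟩,
    fun p x y hp0 hp ht1 h => ellC_eq_matrixElement_div hM hN hq hq1 ht hp0 hp ht1 h,
    fun x y ht1 hx hy hxi hyi hxy => trigonometric_limit hM hq hq1 ht ht1 hx hy hxi hyi hxy⟩
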